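/- Let $n\ge 1$, let $\Omega\subset\mathbb R^n$ be a bounded domain with Lipschitz boundary, let $T>0$, $k>0$, $m_3\ge 1$, $m_4\ge 1$ be real numbers, and put $Q_T=\Omega\times(0,T)$. Let $\mathcal U(Q_T)$ be the set of all $u\in L^\infty(Q_T)$ whose weak derivatives $\partial_t u,\nabla u$ belong to $L^2(\{(x,t)\in Q_T: t\ge\tau\})$ for every $\tau>0$, and let $\mathcal V(Q_T)$ be the set of all $v\in L^\infty(Q_T)$ with weak derivative $\partial_t v\in L^1(Q_T)$. The values of such functions at $t=0$ and $t=T$ are understood as traces: $w(\cdot,0)\in L^\infty(\Omega)$ satisfies $\lim_{h\downarrow0}\frac1h\int_0^h\int_\Omega w\,\psi\,dx\,dt=\int_\Omega w(x,0)\psi(x)\,dx$ for all $\psi\in C_c^\infty(\Omega)$, and similarly at $t=T$ with averages over $(T-h,T)$. For $f\in L^2(Q_T)$ and $u\in\mathcal U(Q_T)$ having traces at $t=0$ and $t=T$, "$\partial_t u\ge\Delta u-f$ in $Q_T$, $\partial_\nu u=0$ on $\partial\Omega\times(0,T)$" means that $\nabla u\in L^1(Q_T)$ and that, for every $\phi\in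 C^\infty(\overline{Q_T})$ with $\phi\ge 0$, $$\int_{Q_T}\bigl(-u\,\partial_t\phi+\nabla u\cdot\nabla\phi+f\phi\bigr)\,dx\,dt+\int_\Omega\bigl(u(x,T)\phi(x,T)-u(x,0)\phi(x,0)\bigr)\,dx\ \ge\ 0 .$$ For $v\in\mathcal V(Q_T)$, "$\partial_t v\ge -f$ in $Q_T$" means $\int_{Q_T}(-v\,\partial_t\phi+f\phi)\,dx\,dt\ge 0$ for every nonnegative $\phi\in C_c^\infty(Q_T)$. The relations with $\le$ are defined by reversing the respective inequality. **Theorem 2.1 (comparison principle).** Let $u,\tilde u\in\mathcal U(Q_T)$ and $v,\tilde v\in\mathcal V(Q_T)$ be nonnegative a.e. and satisfy, in the above sense, $$\partial_t u\ge\Delta u-k\,uv,\qquad \partial_t\tilde u\le\Delta\tilde u-k\,\tilde u\tilde v\qquad\text{in }Q_T,$$ $$\partial_t v\le -k\,u^{m_3}v^{m_4},\qquad \partial_t\tilde v\ge -k\,\tilde u^{m_3}\tilde v^{m_4}\qquad\text{in }Q_T,$$ $$\partial_\nu u=\partial_\nu\tilde u=0\qquad\text{on }\partial\Omega\times(0,T),$$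 $$u(x,0)\ge\tilde u(x,0),\qquad v(x,0)\le\tilde v(x,0)\qquad\text{for a.e. }x\in\Omega.$$ Then $u\ge\tilde u$ and $v\le\tilde v$ a.e. in $Q_T$. -/

import Mathlib

open MeasureTheory Filter Topology
open scoped ContDiff

namespace UnbalancedRD

/-- A bounded domain (nonempty connected open set) with Lipschitz boundary: near every boundary
point `x₀` there is a unit vector `e` such that `Ω` is the strict epigraph, in the direction `e`,
of a Lipschitz function of the component `x - ⟪e, x⟫ e` of `x` orthogonal to `e`. -/
structure IsBoundedLipschitzDomain {n : ℕ} (Ω : Set (EuclideanSpace ℝ (Fin n))) : Prop where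
  isOpen : IsOpen Ω
  isConnected : IsConnected Ω
  isBounded : Bornology.IsBounded Ω
  lipschitz_boundary : ∀ x₀ ∈ frontier Ω,
    ∃ (e : EuclideanSpace ℝ (Fin n)) (K : NNReal) (γ : EuclideanSpace ℝ (Fin n) → ℝ) (r : ℝ),
      ‖e‖ = 1 ∧ LipschitzWith K γ ∧ 0 < r ∧
      ∀ x ∈ Metric.ball x₀ r, x ∈ Ω ↔ γ (x - inner ℝ e x • e) < inner ℝ e x

/-- The space-time cylinder `Q_T = Ω × (0, T)`. -/
def spaceTimeCylinder {n : ℕ} (Ω : Set (EuclideanSpace ℝ (Fin n))) (T : ℝ) :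
    Set (EuclideanSpace ℝ (Fin n) × ℝ) :=
  Ω ×ˢ Set.Ioo 0 T

/-- The part `A_τ = {(x, t) ∈ A | t ≥ τ}` of a space-time set. -/
def laterPart {n : ℕ} (A : Set (EuclideanSpace ℝ (Fin n) × ℝ)) (τ : ℝ) :
    Set (EuclideanSpace ℝ (Fin n) × ℝ) :=
  {z ∈ A | τ ≤ z.2}

/-- The classical time derivative `∂ₜφ` of a (test) function. -/
noncomputable def timeDeriv {n : ℕ} (φ : EuclideanSpace ℝ (Fin n) × ℝ → ℝ)
    (z : EuclideanSpace ℝ (Fin n) × ℝ) : ℝ :=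
  deriv (fun t => φ (z.1, t)) z.2

/-- The classical spatial gradient `∇φ` of a (test) function. -/
noncomputable def spaceGrad {n : ℕ} (φ : EuclideanSpace ℝ (Fin n) × ℝ → ℝ)
    (z : EuclideanSpace ℝ (Fin n) × ℝ) : EuclideanSpace ℝ (Fin n) :=
  gradient (fun x => φ (x, z.2)) z.1

/-- `φ ∈ C_c^∞(A)`. -/
structure IsTestFunction {F : Type*} [NormedAddCommGroup F] [NormedSpace ℝ F]
    (A : Set F) (φ : F → ℝ) : Prop where
  contDiff : ContDiff ℝ ∞ φ
  hasCompactSupport : HasCompactSupport φ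
  tsupport_subset : tsupport φ ⊆ A

/-- `g` is the weak time derivative `∂ₜu` on `A`. -/
structure HasWeakTimeDeriv {n : ℕ} (A : Set (EuclideanSpace ℝ (Fin n) × ℝ))
    (u g : EuclideanSpace ℝ (Fin n) × ℝ → ℝ) : Prop where
  locallyIntegrable : LocallyIntegrableOn u A
  locallyIntegrable_deriv : LocallyIntegrableOn g A
  integral_eq : ∀ φ, IsTestFunction A φ →
    ∫ z in A, u z * timeDeriv φ z = -∫ z in A, g z * φ z

/-- `G` is the weak spatial gradient `∇u` on `A`. -/
structure HasWeakSpaceGrad {n : ℕ} (A : Set (EuclideanSpace ℝ (Fin n) × ℝ))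
    (u : EuclideanSpace ℝ (Fin n) × ℝ → ℝ)
    (G : EuclideanSpace ℝ (Fin n) × ℝ → EuclideanSpace ℝ (Fin n)) : Prop where
  locallyIntegrable : LocallyIntegrableOn u A
  locallyIntegrable_grad : LocallyIntegrableOn G A
  integral_eq : ∀ φ, IsTestFunction A φ →
    ∫ z in A, u z • spaceGrad φ z = -∫ z in A, φ z • G z

/-- The class `𝒰(A)`: `u ∈ L^∞(A)` with `∂ₜu, ∇u ∈ L²(A_τ)` for every `τ > 0`. -/
def MemU {n : ℕ} (A : Set (EuclideanSpace ℝ (Fin n) × ℝ))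
    (u : EuclideanSpace ℝ (Fin n) × ℝ → ℝ) : Prop :=
  MemLp u ⊤ (volume.restrict A) ∧
  (∃ g, HasWeakTimeDeriv A u g ∧ ∀ τ > 0, MemLp g 2 (volume.restrict (laterPart A τ))) ∧
  (∃ G, HasWeakSpaceGrad A u G ∧ ∀ τ > 0, MemLp G 2 (volume.restrict (laterPart A τ)))

/-- The class `𝒱(A)`: `v ∈ L^∞(A)` with `∂ₜv ∈ L¹(A)`. -/
def MemV {n : ℕ} (A : Set (EuclideanSpace ℝ (Fin n) × ℝ))
    (v : EuclideanSpace ℝ (Fin n) × ℝ → ℝ) : Prop :=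
  MemLp v ⊤ (volume.restrict A) ∧
  ∃ g, HasWeakTimeDeriv A v g ∧ IntegrableOn g A

/-- The values `w(·, 0)` are the (weak) trace at time `0⁺` of the function `w` on `Ω × (0, T)`. -/
def HasInitialTrace {n : ℕ} (Ω : Set (EuclideanSpace ℝ (Fin n)))
    (w : EuclideanSpace ℝ (Fin n) × ℝ → ℝ) : Prop :=
  MemLp (fun x => w (x, 0)) ⊤ (volume.restrict Ω) ∧
  ∀ ψ, IsTestFunction Ω ψ →
    Tendsto (fun h : ℝ => h⁻¹ * ∫ z in Ω ×ˢ Set.Ioo 0 h, w z * ψ z.1) (𝓝[>] 0)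
      (𝓝 (∫ x in Ω, w (x, 0) * ψ x))

/-- The values `w(·, T)` are the (weak) trace at time `T⁻` of the function `w` on `Ω × (0, T)`. -/
def HasFinalTrace {n : ℕ} (Ω : Set (EuclideanSpace ℝ (Fin n))) (T : ℝ)
    (w : EuclideanSpace ℝ (Fin n) × ℝ → ℝ) : Prop :=
  MemLp (fun x => w (x, T)) ⊤ (volume.restrict Ω) ∧
  ∀ ψ, IsTestFunction Ω ψ →
    Tendsto (fun h : ℝ => h⁻¹ * ∫ z in Ω ×ˢ Set.Ioo (T - h) T, w z * ψ z.1) (𝓝[>] 0)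
      (𝓝 (∫ x in Ω, w (x, T) * ψ x))

/-- The left-hand side of the weak formulation of `∂ₜu = Δu - f`, `∂_ν u = 0`, on `Ω × (0, T)`,
where `G` is the weak spatial gradient of `u`. -/
noncomputable def neumannForm {n : ℕ} (Ω : Set (EuclideanSpace ℝ (Fin n))) (T : ℝ)
    (u : EuclideanSpace ℝ (Fin n) × ℝ → ℝ)
    (G : EuclideanSpace ℝ (Fin n) × ℝ → EuclideanSpace ℝ (Fin n))
    (f φ : EuclideanSpace ℝ (Fin n) × ℝ → ℝ) : ℝ :=
  (∫ z in spaceTimeCylinder Ω T,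
    (-(u z * timeDeriv φ z) + inner ℝ (G z) (spaceGrad φ z) + f z * φ z)) +
  ∫ x in Ω, (u (x, T) * φ (x, T) - u (x, 0) * φ (x, 0))

/-- `∂ₜu ≥ Δu - f`, `∂_ν u = 0` on `Ω × (0, T)` in the weak sense, tested with all nonnegative
`φ ∈ C^∞` up to the boundary. The integrability of `G` is what makes the integrals meaningful
for all these `φ`. -/
def IsNeumannSupersolution {n : ℕ} (Ω : Set (EuclideanSpace ℝ (Fin n))) (T : ℝ)
    (u f : EuclideanSpace ℝ (Fin n) × ℝ → ℝ) : Prop :=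
  HasInitialTrace Ω u ∧ HasFinalTrace Ω T u ∧
  MemLp f 2 (volume.restrict (spaceTimeCylinder Ω T)) ∧
  ∃ G, HasWeakSpaceGrad (spaceTimeCylinder Ω T) u G ∧ IntegrableOn G (spaceTimeCylinder Ω T) ∧
    ∀ φ, ContDiff ℝ ∞ φ → (∀ z ∈ closure (spaceTimeCylinder Ω T), 0 ≤ φ z) →
      0 ≤ neumannForm Ω T u G f φ

/-- `∂ₜu ≤ Δu - f`, `∂_ν u = 0` on `Ω × (0, T)` in the weak sense. -/
def IsNeumannSubsolution {n : ℕ} (Ω : Set (EuclideanSpace ℝ (Fin n))) (T : ℝ)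
    (u f : EuclideanSpace ℝ (Fin n) × ℝ → ℝ) : Prop :=
  HasInitialTrace Ω u ∧ HasFinalTrace Ω T u ∧
  MemLp f 2 (volume.restrict (spaceTimeCylinder Ω T)) ∧
  ∃ G, HasWeakSpaceGrad (spaceTimeCylinder Ω T) u G ∧ IntegrableOn G (spaceTimeCylinder Ω T) ∧
    ∀ φ, ContDiff ℝ ∞ φ → (∀ z ∈ closure (spaceTimeCylinder Ω T), 0 ≤ φ z) →
      neumannForm Ω T u G f φ ≤ 0

/-- `∂ₜv ≥ -f` on `A` in the weak sense. -/
def IsTimeSupersolution {n : ℕ} (A : Set (EuclideanSpace ℝ (Fin n) × ℝ))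
    (v f : EuclideanSpace ℝ (Fin n) × ℝ → ℝ) : Prop :=
  MemLp f 2 (volume.restrict A) ∧
  ∀ φ, IsTestFunction A φ → (∀ z, 0 ≤ φ z) →
    0 ≤ ∫ z in A, (-(v z * timeDeriv φ z) + f z * φ z)

/-- `∂ₜv ≤ -f` on `A` in the weak sense. -/
def IsTimeSubsolution {n : ℕ} (A : Set (EuclideanSpace ℝ (Fin n) × ℝ))
    (v f : EuclideanSpace ℝ (Fin n) × ℝ → ℝ) : Prop :=
  MemLp f 2 (volume.restrict A) ∧
  ∀ φ, IsTestFunction A φ → (∀ z, 0 ≤ φ z) →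
    ∫ z in A, (-(v z * timeDeriv φ z) + f z * φ z) ≤ 0

end UnbalancedRD

open UnbalancedRD

namespace UnbalancedRD

set_option linter.unusedSectionVars false

section Averages

variable {E H Y : Type*} [NormedAddCommGroup E] [NormedSpace ℝ E] [FiniteDimensional ℝ E]
  [MeasurableSpace E] [BorelSpace E] {μ : Measure E} [μ.IsAddHaarMeasure]
  [NormedAddCommGroup H] [NormedSpace ℝ H] [MeasurableSpace Y]

lemma eLpNorm_two_sq {α : Type*} [MeasurableSpace α] {m : Measure α} (f : α → H) :
    eLpNorm f 2 m ^ 2 = ∫⁻ a, ‖f a‖ₑ ^ 2 ∂m := by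
  have := eLpNorm_nnreal_pow_eq_lintegral (f := f) (μ := m) (p := 2) (by norm_num)
  simpa using this

lemma eLpNorm_translate {F : E → H} (hF : AEStronglyMeasurable F μ) (y : E) :
    eLpNorm (fun z => F (z + y)) 2 μ = eLpNorm F 2 μ :=
  eLpNorm_comp_measurePreserving hF (measurePreserving_add_right μ y)

lemma eLpNorm_translate_sub_le {F : E → H} (hF : AEStronglyMeasurable F μ) (y : E) :
    eLpNorm (fun z => F (z + y) - F z) 2 μ ≤ 2 * eLpNorm F 2 μ := by
  have h := eLpNorm_sub_le (p := 2)
    (hF.comp_measurePreserving (measurePreserving_add_right μ y)) hF (by norm_num)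
  refine h.trans_eq ?_
  rw [two_mul]; congr 1
  exact eLpNorm_translate hF y

lemma tendsto_eLpNorm_translate_sub {F : E → H} (hF : MemLp F 2 μ) :
    Tendsto (fun y => eLpNorm (fun z => F (z + y) - F z) 2 μ) (𝓝 0) (𝓝 0) := by
  have main : ∀ ε : ℝ, 0 < ε → ∀ᶠ y in 𝓝 (0 : E),
      eLpNorm (fun z => F (z + y) - F z) 2 μ ≤ ENNReal.ofReal (3 * ε) := by
    intro ε hε
    obtain ⟨g, hgc, hgs, hg⟩ := hF.exist_eLpNorm_sub_le (by simp) (by norm_num) hε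
    set K := Metric.cthickening 1 (tsupport g) with hK
    have hKc : IsCompact K := hgc.isCompact.cthickening
    obtain ⟨c, hc, hcK⟩ : ∃ c : ℝ, 0 < c ∧
        ENNReal.ofReal c * μ K ^ (1 / (2 : ENNReal).toReal) ≤ ENNReal.ofReal ε := by
      have hfin : μ K ^ (1 / (2 : ENNReal).toReal) ≠ ⊤ :=
        ENNReal.rpow_ne_top_of_nonneg (by simp) hKc.measure_lt_top.ne
      set m := (μ K ^ (1 / (2 : ENNReal).toReal)).toReal with hm
      have hm0 : 0 ≤ m := ENNReal.toReal_nonneg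
      refine ⟨ε / (m + 1), by positivity, ?_⟩
      rw [← ENNReal.ofReal_toReal hfin, ← ENNReal.ofReal_mul (by positivity), ← hm]
      apply ENNReal.ofReal_le_ofReal
      rw [div_mul_eq_mul_div, div_le_iff₀ (by positivity)]
      nlinarith
    have huc := hgc.uniformContinuous_of_continuous hgs.continuous
    obtain ⟨d, hd, hdc⟩ := Metric.uniformContinuous_iff.1 huc c hc
    filter_upwards [Metric.ball_mem_nhds (0 : E) (lt_min hd one_pos)] with y hy
    rw [mem_ball_zero_iff, lt_min_iff] at hy
    have h1 : eLpNorm ((fun z => g (z + y)) - g) 2 μ ≤ ENNReal.ofReal ε := by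
      refine (eLpNorm_sub_le_of_dist_bdd μ (by simp) hKc.measurableSet hc.le
        (fun x => (hdc ?_).le) ?_ ?_).trans hcK
      · simpa [dist_eq_norm] using hy.1
      · intro z hz
        refine Metric.mem_cthickening_of_dist_le z (z + y) 1 _ (subset_tsupport _ hz) ?_
        simpa [dist_eq_norm] using hy.2.le
      · exact (subset_tsupport g).trans (Metric.self_subset_cthickening _)
    have hgm : AEStronglyMeasurable g μ := hgs.continuous.aestronglyMeasurable
    have hFg := hF.1.sub hgm
    have h2 : eLpNorm (fun z => (F - g) (z + y)) 2 μ ≤ ENNReal.ofReal ε := by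
      rw [eLpNorm_translate hFg]; exact hg
    have hgy : AEStronglyMeasurable (fun z => g (z + y)) μ :=
      hgm.comp_measurePreserving (measurePreserving_add_right μ y)
    have hFgy : AEStronglyMeasurable (fun z => (F - g) (z + y)) μ :=
      hFg.comp_measurePreserving (measurePreserving_add_right μ y)
    have e : (fun z => F (z + y) - F z) =
        ((fun z => (F - g) (z + y)) + ((fun z => g (z + y)) - g)) - (F - g) := by
      ext z; simp
    rw [e]
    calc _ ≤ ENNReal.ofReal ε + ENNReal.ofReal ε + ENNReal.ofReal ε := by
          refine (eLpNorm_sub_le (hFgy.add (hgy.sub hgm)) hFg (by norm_num)).trans ?_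
          refine add_le_add ((eLpNorm_add_le hFgy (hgy.sub hgm) (by norm_num)).trans
            (add_le_add h2 h1)) hg
      _ = ENNReal.ofReal (3 * ε) := by
          rw [← ENNReal.ofReal_add hε.le hε.le, ← ENNReal.ofReal_add (by positivity) hε.le]
          ring_nf
  rw [ENNReal.tendsto_nhds_zero]
  intro ε hε
  by_cases htop : ε = ⊤
  · simp [htop]
  have hpos : 0 < ε.toReal := ENNReal.toReal_pos hε.ne' htop
  filter_upwards [main (ε.toReal / 3) (by positivity)] with y hy
  refine hy.trans ?_
  rw [mul_div_cancel₀ _ (by norm_num : (3 : ℝ) ≠ 0), ENNReal.ofReal_toReal htop]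

variable [CompleteSpace H] {ν : Measure Y} [IsProbabilityMeasure ν]

lemma enorm_sq_lintegral_le {f : Y → H} (hf : AEStronglyMeasurable f ν) :
    (∫⁻ y, ‖f y‖ₑ ∂ν) ^ 2 ≤ ∫⁻ y, ‖f y‖ₑ ^ 2 ∂ν := by
  rw [← eLpNorm_two_sq, ← eLpNorm_one_eq_lintegral_enorm]
  gcongr
  exact eLpNorm_le_eLpNorm_of_exponent_le (by norm_num) hf

lemma ae_memLp_translate {F : E → H} (hFm : StronglyMeasurable F) (hF : MemLp F 2 μ)
    {g : Y → E} (hg : Measurable g) :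
    ∀ᵐ z ∂μ, MemLp (fun y => F (z + g y)) 2 ν := by
  have hm : StronglyMeasurable (fun p : E × Y => F (p.1 + g p.2)) :=
    hFm.comp_measurable (measurable_fst.add (hg.comp measurable_snd))
  have hmm : Measurable (fun p : E × Y => ‖F (p.1 + g p.2)‖ₑ ^ 2) := hm.enorm.pow_const 2
  have h1 : ∫⁻ z, ∫⁻ y, ‖F (z + g y)‖ₑ ^ 2 ∂ν ∂μ < ⊤ := by
    rw [lintegral_lintegral_swap hmm.aemeasurable]
    have : ∀ y, ∫⁻ z, ‖F (z + g y)‖ₑ ^ 2 ∂μ = eLpNorm F 2 μ ^ 2 := by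
      intro y
      rw [← eLpNorm_translate hF.1 (g y), eLpNorm_two_sq]
    simp only [this, lintegral_const, measure_univ, mul_one]
    exact ENNReal.pow_lt_top hF.2
  filter_upwards [ae_lt_top' hmm.lintegral_prod_right'.aemeasurable h1.ne] with z hz
  refine ⟨(hm.comp_measurable measurable_prodMk_left).aestronglyMeasurable, ?_⟩
  by_contra hcon
  rw [not_lt, top_le_iff] at hcon
  have := eLpNorm_two_sq (m := ν) (fun y => F (z + g y))
  rw [hcon] at this
  simp only [← this] at hz
  simp at hz

lemma eLpNorm_average_sub_sq_le {F : E → H} (hFm : StronglyMeasurable F) (hF : MemLp F 2 μ)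
    {g : Y → E} (hg : Measurable g) :
    eLpNorm (fun z => (∫ y, F (z + g y) ∂ν) - F z) 2 μ ^ 2 ≤
      ∫⁻ y, eLpNorm (fun z => F (z + g y) - F z) 2 μ ^ 2 ∂ν := by
  have hm : StronglyMeasurable (fun p : E × Y => F (p.1 + g p.2)) :=
    hFm.comp_measurable (measurable_fst.add (hg.comp measurable_snd))
  have hm2 : StronglyMeasurable (fun p : E × Y => F (p.1 + g p.2) - F p.1) :=
    hm.sub (hFm.comp_measurable measurable_fst)
  have hmm : Measurable (fun p : E × Y => ‖F (p.1 + g p.2) - F p.1‖ₑ ^ 2) :=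
    hm2.enorm.pow_const 2
  simp only [eLpNorm_two_sq]
  rw [← lintegral_lintegral_swap hmm.aemeasurable]
  refine lintegral_mono_ae ?_
  filter_upwards [ae_memLp_translate (ν := ν) hFm hF hg] with z hz
  have hint : Integrable (fun y => F (z + g y)) ν := hz.integrable (by norm_num)
  have e : (∫ y, F (z + g y) ∂ν) - F z = ∫ y, (F (z + g y) - F z) ∂ν := by
    rw [integral_sub hint (integrable_const _)]; simp
  rw [e]
  refine le_trans ?_ (enorm_sq_lintegral_le
    (hm2.comp_measurable (measurable_prodMk_left (x := z))).aestronglyMeasurable)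
  gcongr
  exact enorm_integral_le_lintegral_enorm _

lemma eLpNorm_average_sub_le {F : E → H} (hFm : StronglyMeasurable F) (hF : MemLp F 2 μ)
    {g : Y → E} (hg : Measurable g) {c : ENNReal}
    (hc : ∀ᵐ y ∂ν, eLpNorm (fun z => F (z + g y) - F z) 2 μ ≤ c) :
    eLpNorm (fun z => (∫ y, F (z + g y) ∂ν) - F z) 2 μ ≤ c := by
  have h := eLpNorm_average_sub_sq_le (ν := ν) hFm hF hg
  have h2 : ∫⁻ y, eLpNorm (fun z => F (z + g y) - F z) 2 μ ^ 2 ∂ν ≤ c ^ 2 := by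
    calc _ ≤ ∫⁻ _, c ^ 2 ∂ν := lintegral_mono_ae (by filter_upwards [hc] with y hy; gcongr)
      _ = c ^ 2 := by simp
  exact (ENNReal.pow_le_pow_left_iff two_ne_zero).1 (h.trans h2)

lemma memLp_average {F : E → H} (hFm : StronglyMeasurable F) (hF : MemLp F 2 μ)
    {g : Y → E} (hg : Measurable g) :
    MemLp (fun z => ∫ y, F (z + g y) ∂ν) 2 μ := by
  have hm : StronglyMeasurable (fun p : E × Y => F (p.1 + g p.2)) :=
    hFm.comp_measurable (measurable_fst.add (hg.comp measurable_snd))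
  have h : MemLp (fun z => (∫ y, F (z + g y) ∂ν) - F z) 2 μ :=
    ⟨(hm.integral_prod_right'.sub hFm).aestronglyMeasurable,
      (eLpNorm_average_sub_le hFm hF hg (Eventually.of_forall fun y =>
        eLpNorm_translate_sub_le hF.1 (g y))).trans_lt (ENNReal.mul_lt_top (by simp) hF.2)⟩
  have := h.add hF
  refine this.ae_eq (Eventually.of_forall fun z => ?_)
  simp

end Averages

end UnbalancedRD

namespace UnbalancedRD

set_option linter.unusedSectionVars false

section AveragesFubini

variable {E H H' H'' Y : Type*} [NormedAddCommGroup E] [NormedSpace ℝ E] [FiniteDimensional ℝ E]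
  [MeasurableSpace E] [BorelSpace E] {μ : Measure E} [μ.IsAddHaarMeasure]
  [NormedAddCommGroup H] [NormedSpace ℝ H] [NormedAddCommGroup H'] [NormedSpace ℝ H']
  [NormedAddCommGroup H''] [NormedSpace ℝ H''] [MeasurableSpace Y]
  {ν : Measure Y} [IsProbabilityMeasure ν]

lemma integrable_translate_prod {F : E → H} (hFm : StronglyMeasurable F) (hF : Integrable F μ)
    {g : Y → E} (hg : Measurable g) :
    Integrable (fun p : E × Y => F (p.1 + g p.2)) (μ.prod ν) := by
  have hm : StronglyMeasurable (fun p : E × Y => F (p.1 + g p.2)) :=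
    hFm.comp_measurable (measurable_fst.add (hg.comp measurable_snd))
  rw [integrable_prod_iff' hm.aestronglyMeasurable]
  refine ⟨Eventually.of_forall fun y => hF.comp_add_right (g y), ?_⟩
  have : ∀ y, ∫ z, ‖F (z + g y)‖ ∂μ = ∫ z, ‖F z‖ ∂μ := fun y =>
    integral_add_right_eq_self (fun z => ‖F z‖) (g y)
  simp only [this]
  exact integrable_const _

lemma integrable_average {F : E → H} (hFm : StronglyMeasurable F) (hF : Integrable F μ)
    {g : Y → E} (hg : Measurable g) : Integrable (fun z => ∫ y, F (z + g y) ∂ν) μ :=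
  (integrable_translate_prod hFm hF hg).integral_prod_left

lemma integrable_bilin_translate_prod (L : H →L[ℝ] H' →L[ℝ] H'') {F : E → H}
    (hFm : StronglyMeasurable F) (hF : Integrable F μ) {g : Y → E} (hg : Measurable g)
    {b : E → H'} (hb : StronglyMeasurable b) {D : ℝ} (hD : ∀ z, ‖b z‖ ≤ D) :
    Integrable (fun p : E × Y => L (F (p.1 + g p.2)) (b p.1)) (μ.prod ν) := by
  have hi := integrable_translate_prod (ν := ν) hFm hF hg
  refine (hi.norm.const_mul (‖L‖ * D)).mono' ?_ (Eventually.of_forall fun p => ?_)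
  · exact L.aestronglyMeasurable_comp₂ hi.1
      (hb.comp_measurable measurable_fst).aestronglyMeasurable
  · calc _ ≤ ‖L‖ * ‖F (p.1 + g p.2)‖ * ‖b p.1‖ := L.le_opNorm₂ _ _
      _ ≤ ‖L‖ * ‖F (p.1 + g p.2)‖ * D := by gcongr; exact hD _
      _ = _ := by ring

variable [CompleteSpace H] [CompleteSpace H'']

lemma integral_bilin_average (L : H →L[ℝ] H' →L[ℝ] H'') {F : E → H}
    (hFm : StronglyMeasurable F) (hF : Integrable F μ) {g : Y → E} (hg : Measurable g)
    {b : E → H'} (hb : StronglyMeasurable b) {D : ℝ} (hD : ∀ z, ‖b z‖ ≤ D) :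
    ∫ z, L (∫ y, F (z + g y) ∂ν) (b z) ∂μ = ∫ y, ∫ z, L (F (z + g y)) (b z) ∂μ ∂ν := by
  rw [← integral_integral_swap (integrable_bilin_translate_prod L hFm hF hg hb hD)]
  refine integral_congr_ae ?_
  filter_upwards [(integrable_translate_prod (ν := ν) hFm hF hg).prod_right_ae] with z hz
  exact ((L.flip (b z)).integral_comp_comm hz).symm

end AveragesFubini

section ExpMeasure

open ProbabilityTheory Set

lemma integral_expMeasure {H : Type*} [NormedAddCommGroup H] [NormedSpace ℝ H] {l : ℝ} (hl : 0 < l)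
    (h : ℝ → H) :
    ∫ r, h r ∂expMeasure l = ∫ r in Ioi 0, (l * Real.exp (-(l * r))) • h r := by
  have h1 : ∫ r, h r ∂expMeasure l = ∫ r, (exponentialPDF l r).toReal • h r := by
    unfold expMeasure gammaMeasure
    exact integral_withDensity_eq_integral_toReal_smul
      (measurable_exponentialPDFReal l).ennreal_ofReal
      (Eventually.of_forall fun r => ENNReal.ofReal_lt_top) _
  rw [h1, ← integral_Ici_eq_integral_Ioi, ← integral_indicator measurableSet_Ici]
  congr 1
  ext r
  rw [exponentialPDF_eq, indicator_apply]
  by_cases hr : 0 ≤ r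
  · rw [if_pos hr, if_pos (mem_Ici.2 hr), ENNReal.toReal_ofReal (by positivity)]
  · rw [if_neg hr, if_neg (fun h => hr (mem_Ici.1 h))]; simp

lemma expMeasure_real_Ioi {l : ℝ} (hl : 0 < l) {d : ℝ} (hd : 0 ≤ d) :
    (expMeasure l) (Ioi d) = ENNReal.ofReal (Real.exp (-(l * d))) := by
  have := isProbabilityMeasure_expMeasure hl
  have h := cdf_expMeasure_eq hl d
  rw [cdf_eq_real, if_pos hd] at h
  have h2 : (expMeasure l).real (Ioi d) = Real.exp (-(l * d)) := by
    rw [← compl_Iic, measureReal_compl measurableSet_Iic, h]; simp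
  rw [← h2, measureReal_def, ENNReal.ofReal_toReal (measure_ne_top _ _)]

lemma ae_expMeasure_pos {l : ℝ} (hl : 0 < l) : ∀ᵐ r ∂expMeasure l, 0 < r := by
  have := isProbabilityMeasure_expMeasure hl
  rw [ae_iff]
  have h := expMeasure_real_Ioi hl le_rfl
  rw [mul_zero, neg_zero, Real.exp_zero, ENNReal.ofReal_one] at h
  have := prob_compl_eq_zero_iff (μ := expMeasure l) (measurableSet_Ioi (a := (0 : ℝ)))
  exact (this.2 h)

/-- The average of the values of `h` after time `t`, with exponentially decaying weight. -/
noncomputable def timeAverage (l : ℝ) (h : ℝ → ℝ) (t : ℝ) : ℝ := ∫ r, h (t + r) ∂expMeasure l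

variable {l M : ℝ} {h : ℝ → ℝ}

lemma abs_timeAverage_le (hl : 0 < l) (hM : ∀ t, |h t| ≤ M) (t : ℝ) : |timeAverage l h t| ≤ M := by
  have := isProbabilityMeasure_expMeasure hl
  have := norm_integral_le_of_norm_le_const (μ := expMeasure l) (f := fun r => h (t + r))
    (Eventually.of_forall fun r => (Real.norm_eq_abs _).trans_le (hM _))
  simpa [timeAverage] using this

lemma timeAverage_eq (hl : 0 < l) (h : ℝ → ℝ) (t : ℝ) :
    timeAverage l h t = Real.exp (l * t) * ∫ s in Ioi t, l * Real.exp (-(l * s)) * h s := by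
  rw [timeAverage, integral_expMeasure hl, ← integral_const_mul,
    ← integral_indicator measurableSet_Ioi, ← integral_indicator measurableSet_Ioi,
    ← integral_add_left_eq_self ((Ioi t).indicator _) t]
  congr 1
  ext r
  by_cases hr : 0 < r
  · rw [indicator_of_mem (mem_Ioi.2 hr), indicator_of_mem (by simpa using hr)]
    rw [show -(l * (t + r)) = -(l * t) + -(l * r) by ring, Real.exp_add,
      Real.exp_neg (l * t)]
    have := (Real.exp_pos (l * t)).ne'
    simp only [smul_eq_mul]
    field_simp
  · rw [indicator_of_notMem (by simpa using hr), indicator_of_notMem (by simpa using hr)]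

lemma integrableOn_exp_mul (hl : 0 < l) (hm : Measurable h) (hM : ∀ t, |h t| ≤ M) (t : ℝ) :
    IntegrableOn (fun s => l * Real.exp (-(l * s)) * h s) (Ioi t) := by
  have h1 : IntegrableOn (fun s => Real.exp (-l * s)) (Ioi t) := integrableOn_exp_mul_Ioi (by linarith) t
  refine ((h1.const_mul l).mul_const M).mono' ?_ (Eventually.of_forall fun s => ?_)
  · exact (by fun_prop : Measurable fun s => l * Real.exp (-(l * s)) * h s).aestronglyMeasurable
  · rw [Real.norm_eq_abs, abs_mul, abs_of_pos (by positivity : 0 < l * Real.exp (-(l * s))),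
      neg_mul]
    gcongr
    exact hM s

lemma timeAverage_eq' (hl : 0 < l) (hm : Measurable h) (hM : ∀ t, |h t| ≤ M) (a t : ℝ) :
    timeAverage l h t = Real.exp (l * t) * ((∫ s in Ioi a, l * Real.exp (-(l * s)) * h s) -
      ∫ s in a..t, l * Real.exp (-(l * s)) * h s) := by
  rw [timeAverage_eq hl, ← intervalIntegral.integral_interval_add_Ioi
    (integrableOn_exp_mul hl hm hM a) (integrableOn_exp_mul hl hm hM t)]
  ring

lemma locallyIntegrable_exp_mul (hl : 0 < l) (hm : Measurable h) (hM : ∀ t, |h t| ≤ M) :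
    LocallyIntegrable (fun s => l * Real.exp (-(l * s)) * h s) :=
  fun x => ⟨Ioi (x - 1), Ioi_mem_nhds (by linarith), integrableOn_exp_mul hl hm hM _⟩

lemma ae_hasDerivAt_timeAverage (hl : 0 < l) (hm : Measurable h) (hM : ∀ t, |h t| ≤ M) :
    ∀ᵐ t, HasDerivAt (timeAverage l h) (l * (timeAverage l h t - h t)) t := by
  filter_upwards [LocallyIntegrable.ae_hasDerivAt_integral
    (locallyIntegrable_exp_mul hl hm hM)] with t ht
  have h1 := ((hasDerivAt_id t).const_mul l).exp.mul ((ht 0).const_sub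
    (∫ s in Ioi 0, l * Real.exp (-(l * s)) * h s))
  have e : timeAverage l h = fun t => Real.exp (l * t) *
      ((∫ s in Ioi 0, l * Real.exp (-(l * s)) * h s) -
      ∫ s in (0 : ℝ)..t, l * Real.exp (-(l * s)) * h s) :=
    funext fun t => timeAverage_eq' hl hm hM 0 t
  rw [e]
  refine h1.congr_deriv ?_
  simp only [id, Real.exp_neg]
  have := (Real.exp_pos (l * t)).ne'
  field_simp
  ring

lemma absolutelyContinuous_timeAverage (hl : 0 < l) (hm : Measurable h) (hM : ∀ t, |h t| ≤ M)
    (a b : ℝ) : AbsolutelyContinuousOnInterval (timeAverage l h) a b := by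
  have e : timeAverage l h = (fun t => Real.exp (l * t)) * fun t =>
      (((∫ s in Ioi a, l * Real.exp (-(l * s)) * h s) -
      ∫ s in a..t, l * Real.exp (-(l * s)) * h s)) :=
    funext fun t => timeAverage_eq' hl hm hM a t
  rw [e]
  have h1 : AbsolutelyContinuousOnInterval (fun t => Real.exp (l * t)) a b :=
    ContDiffOn.absolutelyContinuousOnInterval (by fun_prop)
  have h2 : IntervalIntegrable (fun s => l * Real.exp (-(l * s)) * h s) volume a b :=
    intervalIntegrable_iff.2 ((LocallyIntegrable.integrableOn_isCompact
      (locallyIntegrable_exp_mul hl hm hM) isCompact_uIcc).mono_set uIoc_subset_uIcc)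
  have h3 := h2.absolutelyContinuousOnInterval_intervalIntegral (c := a) left_mem_uIcc
  have h4 : AbsolutelyContinuousOnInterval
    (fun _ : ℝ => ∫ s in Ioi a, l * Real.exp (-(l * s)) * h s) a b :=
    ContDiffOn.absolutelyContinuousOnInterval (by fun_prop)
  exact h1.mul (h4.sub h3)

lemma abs_timeAverage_sub_le (hl : 0 < l) (hm : Measurable h) (hM : ∀ t, |h t| ≤ M) (s t : ℝ) :
    |timeAverage l h t - timeAverage l h s| ≤ 2 * l * M * |t - s| := by
  rw [← (absolutelyContinuous_timeAverage hl hm hM s t).integral_deriv_eq_sub, ← Real.norm_eq_abs]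
  refine intervalIntegral.norm_integral_le_of_norm_le_const_ae ?_
  filter_upwards [ae_hasDerivAt_timeAverage hl hm hM] with x hx _
  rw [hx.deriv, Real.norm_eq_abs, abs_mul, abs_of_pos hl]
  have h1 := abs_timeAverage_le hl hM x
  have h2 := abs_sub (timeAverage l h x) (h x)
  nlinarith [hM x]

/-- Chain rule and integration by parts for a Lipschitz continuously differentiable function of a
time average. -/
lemma integral_timeAverage_chain (hl : 0 < l) (hm : Measurable h) (hM : ∀ t, |h t| ≤ M)
    {B β η : ℝ → ℝ} (hB : ∀ y, HasDerivAt B (β y) y) (hβ : ∀ y, |β y| ≤ 1) (hη : ContDiff ℝ ∞ η)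
    (a b : ℝ) :
    ∫ t in a..b, l * (timeAverage l h t - h t) * β (timeAverage l h t) * η t =
      B (timeAverage l h b) * η b - B (timeAverage l h a) * η a -
        ∫ t in a..b, B (timeAverage l h t) * deriv η t := by
  have hM0 : 0 ≤ M := (abs_nonneg _).trans (hM 0)
  have hBl : ∀ x y, |B x - B y| ≤ |x - y| := by
    intro x y
    have := (convex_univ (𝕜 := ℝ) (E := ℝ)).norm_image_sub_le_of_norm_hasDerivWithin_le
      (f := B) (C := 1) (fun x _ => (hB x).hasDerivWithinAt) (fun x _ => hβ x) (mem_univ y)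
      (mem_univ x)
    simpa using this
  have hac : AbsolutelyContinuousOnInterval (fun t => B (timeAverage l h t)) a b := by
    refine LipschitzOnWith.absolutelyContinuousOnInterval (K := ⟨2 * l * M, by positivity⟩)
      (LipschitzOnWith.of_dist_le_mul fun x _ y _ => ?_)
    rw [Real.dist_eq, Real.dist_eq]
    exact (hBl _ _).trans (abs_timeAverage_sub_le hl hm hM y x)
  have hηac : AbsolutelyContinuousOnInterval η a b :=
    ContDiffOn.absolutelyContinuousOnInterval (hη.of_le (by norm_num)).contDiffOn
  rw [hac.integral_mul_deriv_eq_deriv_mul hηac, sub_sub_cancel]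
  refine intervalIntegral.integral_congr_ae ?_
  filter_upwards [ae_hasDerivAt_timeAverage hl hm hM] with t ht _
  rw [HasDerivAt.deriv (f := fun t => B (timeAverage l h t)) ((hB _).comp t ht)]
  ring

end ExpMeasure

end UnbalancedRD

namespace UnbalancedRD

/-- The space `ℝⁿ`. -/
abbrev Space (n : ℕ) := EuclideanSpace ℝ (Fin n)

/-- Space-time `ℝⁿ × ℝ`. -/
abbrev SpaceTime (n : ℕ) := EuclideanSpace ℝ (Fin n) × ℝ

instance (n : ℕ) : (volume : Measure (SpaceTime n)).IsAddHaarMeasure :=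
  inferInstanceAs ((volume : Measure (Space n)).prod (volume : Measure ℝ)).IsAddHaarMeasure

section TestFunctions

variable {n : ℕ} {φ : SpaceTime n → ℝ}

lemma hasDerivAt_timeSlice (hφ : ContDiff ℝ ∞ φ) (x : Space n) (t : ℝ) :
    HasDerivAt (fun s => φ (x, s)) (fderiv ℝ φ (x, t) (0, 1)) t := by
  have h1 := (hφ.differentiable (by simp) (x, t)).hasFDerivAt
  have h2 : HasDerivAt (fun s : ℝ => (x, s)) ((0 : Space n), (1 : ℝ)) t :=
    (hasDerivAt_const t x).prodMk (hasDerivAt_id t)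
  exact h1.comp_hasDerivAt t h2

lemma timeDeriv_eq (hφ : ContDiff ℝ ∞ φ) (z : SpaceTime n) :
    timeDeriv φ z = fderiv ℝ φ z (0, 1) :=
  (hasDerivAt_timeSlice hφ z.1 z.2).deriv

lemma hasDerivAt_timeDeriv (hφ : ContDiff ℝ ∞ φ) (x : Space n) (t : ℝ) :
    HasDerivAt (fun s => φ (x, s)) (timeDeriv φ (x, t)) t := by
  rw [timeDeriv_eq hφ]; exact hasDerivAt_timeSlice hφ x t

lemma spaceGrad_eq (hφ : ContDiff ℝ ∞ φ) (z : SpaceTime n) :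
    spaceGrad φ z = (InnerProductSpace.toDual ℝ (Space n)).symm
      ((fderiv ℝ φ z).comp (ContinuousLinearMap.inl ℝ (Space n) ℝ)) := by
  have h1 := (hφ.differentiable (by simp) z).hasFDerivAt
  have h2 : HasFDerivAt (fun x : Space n => (x, z.2)) (ContinuousLinearMap.inl ℝ (Space n) ℝ) z.1 :=
    (hasFDerivAt_id z.1).prodMk (hasFDerivAt_const z.2 z.1)
  have h3 : HasFDerivAt (fun x : Space n => φ (x, z.2)) _ z.1 := h1.comp z.1 h2
  rw [spaceGrad, gradient, h3.fderiv]

lemma hasGradientAt_spaceGrad (hφ : ContDiff ℝ ∞ φ) (z : SpaceTime n) :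
    HasGradientAt (fun x => φ (x, z.2)) (spaceGrad φ z) z.1 := by
  have h1 := (hφ.differentiable (by simp) z).hasFDerivAt
  have h2 : HasFDerivAt (fun x : Space n => (x, z.2)) (ContinuousLinearMap.inl ℝ (Space n) ℝ) z.1 :=
    (hasFDerivAt_id z.1).prodMk (hasFDerivAt_const z.2 z.1)
  have h3 : HasFDerivAt (fun x : Space n => φ (x, z.2)) _ z.1 := h1.comp z.1 h2
  exact h3.differentiableAt.hasGradientAt

lemma continuous_timeDeriv (hφ : ContDiff ℝ ∞ φ) : Continuous (timeDeriv φ) := by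
  rw [funext (timeDeriv_eq hφ)]
  exact (hφ.continuous_fderiv (by simp)).clm_apply continuous_const

lemma continuous_spaceGrad (hφ : ContDiff ℝ ∞ φ) : Continuous (spaceGrad φ) := by
  rw [funext (spaceGrad_eq hφ)]
  exact (LinearIsometryEquiv.continuous _).comp
    ((hφ.continuous_fderiv (by simp)).clm_comp continuous_const)

lemma hasCompactSupport_timeDeriv (hφ : ContDiff ℝ ∞ φ) (hc : HasCompactSupport φ) :
    HasCompactSupport (timeDeriv φ) := by
  refine (hc.fderiv ℝ).mono fun z hz => ?_
  rw [Function.mem_support, timeDeriv_eq hφ] at hz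
  rw [Function.mem_support]
  intro h; simp [h] at hz

lemma hasCompactSupport_spaceGrad (hφ : ContDiff ℝ ∞ φ) (hc : HasCompactSupport φ) :
    HasCompactSupport (spaceGrad φ) := by
  refine (hc.fderiv ℝ).mono fun z hz => ?_
  rw [Function.mem_support, spaceGrad_eq hφ] at hz
  rw [Function.mem_support]
  intro h; simp [h] at hz

lemma spaceGrad_eq_zero_of_notMem (hφ : ContDiff ℝ ∞ φ) {z : SpaceTime n} (hz : z ∉ tsupport φ) :
    spaceGrad φ z = 0 := by
  rw [spaceGrad_eq hφ, Function.notMem_support.1 fun h => hz (support_fderiv_subset ℝ h)]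
  simp

lemma timeDeriv_translate (φ : SpaceTime n → ℝ) (r : ℝ) (z : SpaceTime n) :
    timeDeriv (fun z => φ (z - ((0 : Space n), r))) z = timeDeriv φ (z - ((0 : Space n), r)) := by
  simp only [timeDeriv, Prod.mk_sub_mk, sub_zero, Prod.fst_sub, Prod.snd_sub]
  exact deriv_comp_sub_const (f := fun t => φ (z.1, t)) (a := r) z.2

lemma spaceGrad_translate (φ : SpaceTime n → ℝ) (r : ℝ) (z : SpaceTime n) :
    spaceGrad (fun z => φ (z - ((0 : Space n), r))) z = spaceGrad φ (z - ((0 : Space n), r)) := by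
  simp [spaceGrad]

lemma exists_norm_le_of_compact {H : Type*} [NormedAddCommGroup H] {f : SpaceTime n → H}
    (hf : Continuous f) (hc : HasCompactSupport f) : ∃ D, 0 ≤ D ∧ ∀ z, ‖f z‖ ≤ D := by
  obtain ⟨D, hD⟩ := hf.bounded_above_of_compact_support hc
  exact ⟨D, (norm_nonneg _).trans (hD 0), hD⟩

lemma integrable_mul_of_compact {v : SpaceTime n → ℝ} (hv : Measurable v) {M : ℝ}
    (hM : ∀ z, |v z| ≤ M) {a : SpaceTime n → ℝ} (ha : Continuous a) (hc : HasCompactSupport a) :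
    Integrable (fun z => v z * a z) :=
  (ha.integrable_of_hasCompactSupport hc).bdd_mul (c := M) hv.aestronglyMeasurable
    (Eventually.of_forall fun z => (Real.norm_eq_abs _).trans_le (hM z))

lemma integrable_inner_of_compact {G : SpaceTime n → Space n} (hG : Integrable G)
    {b : SpaceTime n → Space n} (hb : Continuous b) (hc : HasCompactSupport b) :
    Integrable (fun z => inner ℝ (G z) (b z)) := by
  obtain ⟨D, hD0, hD⟩ := exists_norm_le_of_compact hb hc
  refine (hG.norm.mul_const D).mono' (hG.1.inner hb.aestronglyMeasurable)
    (Eventually.of_forall fun z => (norm_inner_le_norm _ _).trans ?_)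
  gcongr; exact hD z

end TestFunctions

section ExpAverage

open ProbabilityTheory Set

variable {n : ℕ} {H : Type*} [NormedAddCommGroup H] [NormedSpace ℝ H]

/-- The average of `F` over later times, with exponentially decaying weight of rate `l`. -/
noncomputable def expAverage (l : ℝ) (F : SpaceTime n → H) (z : SpaceTime n) : H :=
  ∫ r, F (z + ((0 : Space n), r)) ∂expMeasure l

lemma measurable_timeShift : Measurable (fun r : ℝ => ((0 : Space n), r)) := by fun_prop

lemma expAverage_eq_timeAverage (l : ℝ) (w : SpaceTime n → ℝ) (x : Space n) (t : ℝ) :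
    expAverage l w (x, t) = timeAverage l (fun s => w (x, s)) t := by
  simp [expAverage, timeAverage]

lemma tendsto_eLpNorm_expAverage_sub [CompleteSpace H] {F : SpaceTime n → H}
    (hFm : StronglyMeasurable F) (hF : MemLp F 2) :
    Tendsto (fun l => eLpNorm (fun z => expAverage l F z - F z) 2) atTop (𝓝 0) := by
  have key : ∀ ε : ENNReal, 0 < ε → ε ≠ ⊤ → ∃ d : ℝ, 0 < d ∧ ∀ l : ℝ, 0 < l →
      eLpNorm (fun z => expAverage l F z - F z) 2 ^ 2 ≤
        ε ^ 2 + (2 * eLpNorm F 2) ^ 2 * ENNReal.ofReal (Real.exp (-(l * d))) := by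
    intro ε hε htop
    have h1 := (tendsto_eLpNorm_translate_sub hF)
    rw [ENNReal.tendsto_nhds_zero] at h1
    have h2 := h1 ε hε
    obtain ⟨d, hd, hdε⟩ := Metric.eventually_nhds_iff.1 h2
    refine ⟨d / 2, by positivity, fun l hl => ?_⟩
    have := isProbabilityMeasure_expMeasure hl
    refine (eLpNorm_average_sub_sq_le (ν := expMeasure l) hFm hF measurable_timeShift).trans ?_
    have h3 : ∀ᵐ r ∂expMeasure l, eLpNorm (fun z => F (z + ((0 : Space n), r)) - F z) 2 ^ 2 ≤
        ε ^ 2 + (Ioi (d / 2)).indicator (fun _ => (2 * eLpNorm F 2) ^ 2) r := by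
      filter_upwards [ae_expMeasure_pos hl] with r hr
      by_cases hrd : d / 2 < r
      · rw [indicator_of_mem (mem_Ioi.2 hrd)]
        refine le_trans ?_ le_add_self
        gcongr
        exact eLpNorm_translate_sub_le hF.1 _
      · refine le_trans ?_ le_self_add
        gcongr
        apply hdε
        rw [dist_zero_right, Prod.norm_mk, norm_zero, Real.norm_eq_abs, abs_of_pos hr,
          max_eq_right hr.le]
        linarith
    refine (lintegral_mono_ae h3).trans ?_
    rw [lintegral_add_left measurable_const, lintegral_const, measure_univ, mul_one,
      lintegral_indicator measurableSet_Ioi, setLIntegral_const,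
      expMeasure_real_Ioi hl (by positivity)]
  have hsq : Tendsto (fun l => eLpNorm (fun z => expAverage l F z - F z) 2 ^ 2) atTop (𝓝 0) := by
    rw [ENNReal.tendsto_nhds_zero]
    intro ε hε
    by_cases htop : ε = ⊤
    · simp [htop]
    obtain ⟨e, he, hee⟩ : ∃ e : ENNReal, 0 < e ∧ e ^ 2 ≤ ε / 2 ∧ e ≠ ⊤ := by
      refine ⟨(ε / 2) ^ (2⁻¹ : ℝ), ENNReal.rpow_pos (ENNReal.half_pos hε.ne') ?_, le_of_eq ?_, ?_⟩
      · exact ENNReal.div_ne_top htop (by simp)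
      · rw [← ENNReal.rpow_natCast, ← ENNReal.rpow_mul]; norm_num
      · exact ENNReal.rpow_ne_top_of_nonneg (by norm_num) (ENNReal.div_ne_top htop (by simp))
    obtain ⟨d, hd, hbound⟩ := key e he hee.2
    have h4 : Tendsto (fun l : ℝ => (2 * eLpNorm F 2) ^ 2 *
        ENNReal.ofReal (Real.exp (-(l * d)))) atTop (𝓝 0) := by
      have h5 : Tendsto (fun l : ℝ => ENNReal.ofReal (Real.exp (-(l * d)))) atTop (𝓝 0) := ?_
      · simpa using ENNReal.Tendsto.const_mul h5 (Or.inr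
          (ENNReal.pow_ne_top (n := 2) (ENNReal.mul_ne_top (by simp : (2 : ENNReal) ≠ ⊤) hF.2.ne)))
      · rw [← ENNReal.ofReal_zero]
        refine ENNReal.tendsto_ofReal (Real.tendsto_exp_atBot.comp ?_)
        exact tendsto_neg_atTop_atBot.comp (tendsto_id.atTop_mul_const hd)
    rw [ENNReal.tendsto_nhds_zero] at h4
    filter_upwards [h4 (ε / 2) (ENNReal.half_pos hε.ne'), eventually_gt_atTop 0] with l hl hl0
    calc _ ≤ _ := hbound l hl0
      _ ≤ ε / 2 + ε / 2 := add_le_add hee.1 hl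
      _ = ε := ENNReal.add_halves ε
  rw [ENNReal.tendsto_nhds_zero] at hsq ⊢
  intro ε hε
  filter_upwards [hsq (ε ^ 2) (ENNReal.pow_pos hε 2)] with l hl
  exact (ENNReal.pow_le_pow_left_iff two_ne_zero).1 hl

lemma stronglyMeasurable_expAverage {l : ℝ} (hl : 0 < l) {F : SpaceTime n → H}
    (hF : StronglyMeasurable F) : StronglyMeasurable (expAverage l F) := by
  have := isProbabilityMeasure_expMeasure hl
  have hm : StronglyMeasurable (fun p : SpaceTime n × ℝ => F (p.1 + ((0 : Space n), p.2))) :=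
    hF.comp_measurable (measurable_fst.add (measurable_timeShift.comp measurable_snd))
  exact hm.integral_prod_right'

lemma abs_expAverage_le {l M : ℝ} (hl : 0 < l) {w : SpaceTime n → ℝ} (hM : ∀ z, |w z| ≤ M)
    (z : SpaceTime n) : |expAverage l w z| ≤ M := by
  rw [← Prod.mk.eta (p := z), expAverage_eq_timeAverage]
  exact abs_timeAverage_le hl (fun t => hM _) _

lemma integral_expMeasure_reflect_le {l : ℝ} (hl : 0 < l) {η : ℝ → ℝ} (hη : Continuous η)
    (hc : HasCompactSupport η) (h0 : ∀ t, 0 ≤ η t) {b T : ℝ} (hb : ∀ t, b ≤ t → η t = 0) :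
    ∫ r, η (T - r) ∂expMeasure l ≤ l * Real.exp (-(l * (T - b))) * ∫ t, η t := by
  have hi : Integrable (fun r => η (T - r)) :=
    (hη.integrable_of_hasCompactSupport hc).comp_sub_left T
  rw [integral_expMeasure hl]
  calc _ ≤ ∫ r in Ioi 0, l * Real.exp (-(l * (T - b))) * η (T - r) := by
        have hle : ∀ r, (l * Real.exp (-(l * r))) • η (T - r) ≤
            l * Real.exp (-(l * (T - b))) * η (T - r) := by
          intro r
          by_cases hr : b ≤ T - r
          · simp [hb _ hr]
          · rw [smul_eq_mul]
            gcongr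
            · exact h0 _
            · linarith
        refine integral_mono_of_nonneg (Eventually.of_forall fun r => ?_)
          (hi.const_mul _).integrableOn (Eventually.of_forall hle)
        exact smul_nonneg (by positivity) (h0 _)
    _ ≤ ∫ r, l * Real.exp (-(l * (T - b))) * η (T - r) :=
        setIntegral_le_integral (hi.const_mul _)
          (Eventually.of_forall fun r => mul_nonneg (by positivity) (h0 _))
    _ = _ := by
        rw [integral_const_mul, integral_sub_left_eq_self (fun t => η t)]

lemma integral_expAverage_mul_timeDeriv {l M : ℝ} (hl : 0 < l) {w : SpaceTime n → ℝ}
    (hw : Measurable w) (hM : ∀ z, |w z| ≤ M) {φ : SpaceTime n → ℝ} (hφ : ContDiff ℝ ∞ φ)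
    (hc : HasCompactSupport φ) :
    ∫ z, -(expAverage l w z * timeDeriv φ z) = ∫ z, l * (expAverage l w z - w z) * φ z := by
  have hVm : Measurable (expAverage l w) :=
    (stronglyMeasurable_expAverage hl hw.stronglyMeasurable).measurable
  have hVM := abs_expAverage_le hl hM
  have hi1 : Integrable (fun z => -(expAverage l w z * timeDeriv φ z)) :=
    (integrable_mul_of_compact hVm hVM (continuous_timeDeriv hφ)
      (hasCompactSupport_timeDeriv hφ hc)).neg
  have hi2 : Integrable (fun z => l * (expAverage l w z - w z) * φ z) := by
    refine integrable_mul_of_compact (M := l * (M + M)) (by fun_prop) (fun z => ?_)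
      hφ.continuous hc
    rw [abs_mul, abs_of_pos hl]
    gcongr
    exact (abs_sub _ _).trans (add_le_add (hVM z) (hM z))
  rw [Measure.volume_eq_prod, integral_prod _ hi1, integral_prod _ hi2]
  congr 1
  ext x
  obtain ⟨R, hR1, hR2⟩ : ∃ R : ℝ, (∀ z, R ≤ ‖z‖ → φ z = 0) ∧
      ∀ z, R ≤ ‖z‖ → timeDeriv φ z = 0 := by
    obtain ⟨R, hR⟩ := hc.isCompact.isBounded.subset_ball 0
    obtain ⟨R', hR'⟩ := (hasCompactSupport_timeDeriv hφ hc).isCompact.isBounded.subset_ball 0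
    refine ⟨max R R', fun z hz => ?_, fun z hz => ?_⟩
    · by_contra h
      have := mem_ball_zero_iff.1 (hR (subset_tsupport _ h))
      exact absurd ((le_max_left _ _).trans hz) (not_le.2 this)
    · by_contra h
      have := mem_ball_zero_iff.1 (hR' (subset_tsupport _ h))
      exact absurd ((le_max_right _ _).trans hz) (not_le.2 this)
  have hsub : ∀ {a : SpaceTime n → ℝ}, (∀ z, R ≤ ‖z‖ → a z = 0) → ∀ b : ℝ → ℝ,
      Function.support (fun t => b t * a (x, t)) ⊆ Ioc (-R) R := by
    intro a ha b t ht
    by_contra hcon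
    refine ht ?_
    have : R ≤ |t| := by
      rw [mem_Ioc, not_and_or, not_lt, not_le] at hcon
      rcases hcon with h | h
      · exact (le_neg.1 h).trans (neg_le_abs t)
      · exact h.le.trans (le_abs_self t)
    simp only [ha (x, t) (this.trans (le_max_right _ _)), mul_zero]
  have hchain := integral_timeAverage_chain hl (h := fun s => w (x, s)) (by fun_prop)
    (fun t => hM _) (B := fun y => y) (β := fun _ => 1) (fun y => hasDerivAt_id y) (by simp)
    (η := fun t => φ (x, t)) (hφ.comp (by fun_prop)) (-R) R
  have e1 : φ (x, R) = 0 := hR1 _ ((le_abs_self R).trans (le_max_right _ _))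
  have e2 : φ (x, -R) = 0 := hR1 _ ((neg_le_abs (-R)).trans' (by simp) |>.trans (le_max_right _ _))
  have htd : ∀ t, deriv (fun t => φ (x, t)) t = timeDeriv φ (x, t) := fun _ => rfl
  simp only [e1, e2, htd, mul_zero, sub_zero, zero_sub, mul_one] at hchain
  rw [intervalIntegral.integral_eq_integral_of_support_subset
      (hsub hR1 fun t => l * (timeAverage l (fun s => w (x, s)) t - w (x, t))),
    intervalIntegral.integral_eq_integral_of_support_subset
      (hsub hR2 fun t => timeAverage l (fun s => w (x, s)) t)] at hchain
  simp only [expAverage_eq_timeAverage]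
  rw [integral_neg, hchain]

end ExpAverage

end UnbalancedRD

namespace UnbalancedRD

open ProbabilityTheory Set

variable {n : ℕ}

lemma integral_add_sub {α : Type*} [MeasurableSpace α] {m : Measure α} {a b c : α → ℝ}
    (ha : Integrable a m) (hb : Integrable b m) (hc : Integrable c m) :
    ∫ z, (a z + b z - c z) ∂m = ∫ z, a z ∂m + ∫ z, b z ∂m - ∫ z, c z ∂m := by
  rw [integral_sub (f := fun z => a z + b z) (ha.add hb) hc, integral_add ha hb]

/-- A bounded function `w`, with gradient `G`, satisfying `∂ₜw ≤ Δw + f` on `Ω × (0, T)` with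
homogeneous Neumann condition (or just `∂ₜw ≤ f`, when `G = 0`) and nonpositive initial values in a
weak sense; all functions are extended by zero to the whole space-time. -/
structure IsZeroDataSubsolution (Ω : Set (Space n)) (T M : ℝ) (w f : SpaceTime n → ℝ)
    (G : SpaceTime n → Space n) : Prop where
  measurable : Measurable w
  measurable_source : Measurable f
  measurable_grad : Measurable G
  abs_le : ∀ z, |w z| ≤ M
  abs_source_le : ∀ z, |f z| ≤ M
  eq_zero : ∀ z ∉ spaceTimeCylinder Ω T, w z = 0
  source_eq_zero : ∀ z ∉ spaceTimeCylinder Ω T, f z = 0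
  grad_eq_zero : ∀ z ∉ spaceTimeCylinder Ω T, G z = 0
  integrable_grad : Integrable G
  memLp_grad : ∀ τ > 0, MemLp G 2 (volume.restrict {z | τ ≤ z.2})
  weak_le : ∀ φ, ContDiff ℝ ∞ φ → HasCompactSupport φ → (∀ z, 0 ≤ φ z) →
    ∫ z, (-(w z * timeDeriv φ z) + inner ℝ (G z) (spaceGrad φ z) - f z * φ z) ≤
      M * ∫ x in Ω, φ (x, T)
  grad_eq : (∀ z, G z = 0) ∨ ∀ φ, IsTestFunction (spaceTimeCylinder Ω T) φ →
    ∫ z, w z • spaceGrad φ z = -∫ z, φ z • G z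

namespace IsZeroDataSubsolution

variable {Ω : Set (Space n)} {T M : ℝ} {w f : SpaceTime n → ℝ} {G : SpaceTime n → Space n}

lemma nonneg (h : IsZeroDataSubsolution Ω T M w f G) : 0 ≤ M := (abs_nonneg _).trans (h.abs_le 0)

lemma integrable_of_bounded {Ω : Set (Space n)} {v : SpaceTime n → ℝ} (hΩo : IsOpen Ω)
    (hΩb : Bornology.IsBounded Ω) (hv : Measurable v) (hM : ∀ z, |v z| ≤ M)
    (h0 : ∀ z ∉ spaceTimeCylinder Ω T, v z = 0) : Integrable v := by
  have hfin : volume (spaceTimeCylinder Ω T) < ⊤ :=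
    (hΩb.prod (Metric.isBounded_Ioo 0 T)).measure_lt_top
  have hmeas : MeasurableSet (spaceTimeCylinder Ω T) := hΩo.measurableSet.prod measurableSet_Ioo
  have : IntegrableOn v (spaceTimeCylinder Ω T) :=
    Measure.integrableOn_of_bounded (M := M) hfin.ne hv.aestronglyMeasurable
      (Eventually.of_forall fun z => (Real.norm_eq_abs _).trans_le (hM z))
  exact this.integrable_of_forall_notMem_eq_zero h0

lemma averaged_weak_le (h : IsZeroDataSubsolution Ω T M w f G) (hΩo : IsOpen Ω)
    (hΩb : Bornology.IsBounded Ω) {l : ℝ} (hl : 0 < l) {φ : SpaceTime n → ℝ}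
    (hφ : ContDiff ℝ ∞ φ) (hc : HasCompactSupport φ) (h0 : ∀ z, 0 ≤ φ z) :
    ∫ z, (l * (expAverage l w z - w z) * φ z + inner ℝ (expAverage l G z) (spaceGrad φ z) -
      expAverage l f z * φ z) ≤ ∫ r, (M * ∫ x in Ω, φ (x, T - r)) ∂expMeasure l := by
  have := isProbabilityMeasure_expMeasure hl
  have hwi : Integrable w := integrable_of_bounded hΩo hΩb h.measurable h.abs_le h.eq_zero
  have hfi : Integrable f :=
    integrable_of_bounded hΩo hΩb h.measurable_source h.abs_source_le h.source_eq_zero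
  have hct := continuous_timeDeriv hφ
  have hcs := continuous_spaceGrad hφ
  have hkt := hasCompactSupport_timeDeriv hφ hc
  have hks := hasCompactSupport_spaceGrad hφ hc
  obtain ⟨D₁, -, hD₁⟩ := exists_norm_le_of_compact hct hkt
  obtain ⟨D₂, -, hD₂⟩ := exists_norm_le_of_compact hcs hks
  obtain ⟨D₃, -, hD₃⟩ := exists_norm_le_of_compact hφ.continuous hc
  have s₁ := hct.stronglyMeasurable
  have s₂ := hcs.stronglyMeasurable
  have s₃ := hφ.continuous.stronglyMeasurable
  have hT := measurable_timeShift (n := n)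
  have p₁ := integrable_bilin_translate_prod (ν := expMeasure l) (ContinuousLinearMap.mul ℝ ℝ)
    h.measurable.stronglyMeasurable hwi hT s₁ hD₁
  have p₂ : Integrable (fun p : SpaceTime n × ℝ =>
      inner ℝ (G (p.1 + ((0 : Space n), p.2))) (spaceGrad φ p.1)) _ := integrable_bilin_translate_prod (ν := expMeasure l) (innerSL ℝ)
    h.measurable_grad.stronglyMeasurable h.integrable_grad hT s₂ hD₂
  have p₃ := integrable_bilin_translate_prod (ν := expMeasure l) (ContinuousLinearMap.mul ℝ ℝ)
    h.measurable_source.stronglyMeasurable hfi hT s₃ hD₃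
  have f₁ : ∫ z, expAverage l w z * timeDeriv φ z = ∫ r, (∫ z,
      w (z + ((0 : Space n), r)) * timeDeriv φ z) ∂expMeasure l := integral_bilin_average (ν := expMeasure l) (ContinuousLinearMap.mul ℝ ℝ)
    h.measurable.stronglyMeasurable hwi hT s₁ hD₁
  have f₂ : ∫ z, inner ℝ (expAverage l G z) (spaceGrad φ z) = ∫ r, (∫ z, inner ℝ
      (G (z + ((0 : Space n), r))) (spaceGrad φ z)) ∂expMeasure l := integral_bilin_average (ν := expMeasure l) (innerSL ℝ)
    h.measurable_grad.stronglyMeasurable h.integrable_grad hT s₂ hD₂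
  have f₃ : ∫ z, expAverage l f z * φ z = ∫ r, (∫ z,
      f (z + ((0 : Space n), r)) * φ z) ∂expMeasure l := integral_bilin_average (ν := expMeasure l) (ContinuousLinearMap.mul ℝ ℝ)
    h.measurable_source.stronglyMeasurable hfi hT s₃ hD₃
  simp only [ContinuousLinearMap.mul_apply'] at p₁ p₃
  have hVm : Measurable (expAverage l w) :=
    (stronglyMeasurable_expAverage hl h.measurable.stronglyMeasurable).measurable
  have hfm : Measurable (expAverage l f) :=
    (stronglyMeasurable_expAverage hl h.measurable_source.stronglyMeasurable).measurable
  have hVM := abs_expAverage_le hl h.abs_le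
  have hfM := abs_expAverage_le hl h.abs_source_le
  have hGi : Integrable (expAverage l G) := integrable_average (ν := expMeasure l)
    h.measurable_grad.stronglyMeasurable h.integrable_grad hT
  have i₁ : Integrable (fun z => l * (expAverage l w z - w z) * φ z) := by
    have hm := h.measurable
    refine integrable_mul_of_compact (M := l * (M + M)) (by fun_prop) (fun z => ?_)
      hφ.continuous hc
    rw [abs_mul, abs_of_pos hl]
    gcongr
    exact (abs_sub _ _).trans (add_le_add (hVM z) (h.abs_le z))
  have i₂ := integrable_inner_of_compact hGi hcs hks
  have i₃ := integrable_mul_of_compact hfm hfM hφ.continuous hc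
  have q₁ : Integrable (fun r => -∫ z, w (z + ((0 : Space n), r)) * timeDeriv φ z)
    (expMeasure l) := p₁.integral_prod_right.neg
  have q₂ : Integrable (fun r => ∫ z, inner ℝ (G (z + ((0 : Space n), r))) (spaceGrad φ z))
    (expMeasure l) := p₂.integral_prod_right
  have q₃ : Integrable (fun r => ∫ z, f (z + ((0 : Space n), r)) * φ z)
    (expMeasure l) := p₃.integral_prod_right
  rw [integral_add_sub i₁ i₂ i₃,
    ← integral_expAverage_mul_timeDeriv hl h.measurable h.abs_le hφ hc, integral_neg,
    f₁, f₂, f₃, ← integral_neg, ← integral_add_sub q₁ q₂ q₃]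
  have hbd : Integrable (fun p : Space n × ℝ => φ (p.1, T - p.2))
      ((volume.restrict Ω).prod (expMeasure l)) := by
    have : IsFiniteMeasure (volume.restrict Ω) := ⟨by simpa using hΩb.measure_lt_top⟩
    refine Integrable.of_bound (C := D₃) ?_ (Eventually.of_forall fun p => hD₃ _)
    exact (hφ.continuous.comp (by fun_prop)).aestronglyMeasurable
  refine integral_mono ((q₁.add q₂).sub q₃) (hbd.integral_prod_right.const_mul M) fun r => ?_
  have hφr : ContDiff ℝ ∞ (fun z => φ (z - ((0 : Space n), r))) :=
    hφ.comp (contDiff_id.sub contDiff_const)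
  have hcr : HasCompactSupport (fun z => φ (z - ((0 : Space n), r))) := by
    have := hc.comp_homeomorph (Homeomorph.subRight ((0 : Space n), r))
    exact this
  have hr := h.weak_le _ hφr hcr (fun z => h0 _)
  rw [← integral_add_right_eq_self _ ((0 : Space n), r)] at hr
  simp only [timeDeriv_translate, spaceGrad_translate, add_sub_cancel_right] at hr
  have j₁ : Integrable (fun z => w (z + ((0 : Space n), r)) * timeDeriv φ z) :=
    integrable_mul_of_compact (by have := h.measurable; fun_prop) (fun z => h.abs_le _) hct hkt
  have j₂ := integrable_inner_of_compact (h.integrable_grad.comp_add_right ((0 : Space n), r))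
    hcs hks
  have j₃ : Integrable (fun z => f (z + ((0 : Space n), r)) * φ z) :=
    integrable_mul_of_compact (by have := h.measurable_source; fun_prop)
      (fun z => h.abs_source_le _) hφ.continuous hc
  have j₁' : Integrable (fun z => -(w (z + ((0 : Space n), r)) * timeDeriv φ z)) := j₁.neg
  rw [integral_add_sub j₁' j₂ j₃, integral_neg] at hr
  simpa using hr

lemma averaged_weak_le_of_le (h : IsZeroDataSubsolution Ω T M w f G) (hΩo : IsOpen Ω)
    (hΩb : Bornology.IsBounded Ω) {l : ℝ} (hl : 0 < l) {φ : SpaceTime n → ℝ}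
    (hφ : ContDiff ℝ ∞ φ) (hc : HasCompactSupport φ) (h0 : ∀ z, 0 ≤ φ z) {η : ℝ → ℝ}
    (hη : Continuous η) (hηc : HasCompactSupport η) (hφη : ∀ z, φ z ≤ η z.2) {b : ℝ}
    (hb : ∀ t, b ≤ t → η t = 0) :
    ∫ z, (l * (expAverage l w z - w z) * φ z + inner ℝ (expAverage l G z) (spaceGrad φ z) -
      expAverage l f z * φ z) ≤
      M * volume.real Ω * (l * Real.exp (-(l * (T - b))) * ∫ t, η t) := by
  have := isProbabilityMeasure_expMeasure hl
  have hη0 : ∀ t, 0 ≤ η t := fun t => (h0 (0, t)).trans (hφη (0, t))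
  have hM := h.nonneg
  refine (h.averaged_weak_le hΩo hΩb hl hφ hc h0).trans ?_
  obtain ⟨D, hD⟩ := hη.bounded_above_of_compact_support hηc
  have hi : Integrable (fun r => η (T - r)) (expMeasure l) :=
    Integrable.of_bound (C := D) (by fun_prop) (Eventually.of_forall fun r => hD _)
  have hΩfin : volume Ω < ⊤ := hΩb.measure_lt_top
  calc ∫ r, (M * ∫ x in Ω, φ (x, T - r)) ∂expMeasure l
      ≤ ∫ r, M * volume.real Ω * η (T - r) ∂expMeasure l := by
        refine integral_mono_of_nonneg (Eventually.of_forall fun r => ?_) (hi.const_mul _)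
          (Eventually.of_forall fun r => ?_)
        · exact mul_nonneg hM (setIntegral_nonneg hΩo.measurableSet fun x _ => h0 _)
        · have : ∫ x in Ω, φ (x, T - r) ≤ ∫ _ in Ω, η (T - r) := by
            refine integral_mono_of_nonneg (Eventually.of_forall fun x => h0 _) ?_
              (Eventually.of_forall fun x => hφη (x, T - r))
            exact integrableOn_const (C := η (T - r)) hΩfin.ne
          rw [setIntegral_const, smul_eq_mul] at this
          simp only [mul_assoc]
          gcongr
    _ = M * volume.real Ω * ∫ r, η (T - r) ∂expMeasure l := integral_const_mul _ _
    _ ≤ _ := by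
        gcongr
        exact integral_expMeasure_reflect_le hl hη hηc hη0 hb

end IsZeroDataSubsolution

open scoped Convolution

/-- A uniform interior cone property near every point of the closure of `Ω`. -/
def HasInteriorCones (Ω : Set (Space n)) : Prop :=
  ∀ x₀ ∈ closure Ω, ∃ (r : ℝ) (c : Space n) (δ₀ : ℝ), 0 < r ∧ 0 < δ₀ ∧
    ∀ δ, 0 < δ → δ < δ₀ → ∀ x ∈ Ω, dist x x₀ < r → Metric.closedBall (x + δ • c) δ ⊆ Ω

lemma IsBoundedLipschitzDomain.hasInteriorCones {Ω : Set (Space n)}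
    (hΩ : IsBoundedLipschitzDomain Ω) : HasInteriorCones Ω := by
  intro x₀ hx₀
  by_cases hmem : x₀ ∈ Ω
  · obtain ⟨ρ, hρ, hball⟩ := Metric.isOpen_iff.1 hΩ.isOpen x₀ hmem
    refine ⟨ρ / 2, 0, ρ / 2, by positivity, by positivity, fun δ hδ hδ0 x hx hd y hy => hball ?_⟩
    rw [smul_zero, add_zero, Metric.mem_closedBall] at hy
    rw [Metric.mem_ball]
    linarith [dist_triangle y x x₀]
  · have hfr : x₀ ∈ frontier Ω := by rw [hΩ.isOpen.frontier_eq]; exact ⟨hx₀, hmem⟩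
    obtain ⟨e, K, γ, r, he, hγ, hr, hep⟩ := hΩ.lipschitz_boundary x₀ hfr
    have hK : (0 : ℝ) ≤ K := K.2
    refine ⟨r / 2, (2 * (K : ℝ) + 2) • e, r / (2 * (2 * K + 3)), by positivity, by positivity,
      fun δ hδ hδ0 x hx hd y hy => ?_⟩
    rw [lt_div_iff₀ (by positivity)] at hδ0
    rw [Metric.mem_closedBall, dist_eq_norm] at hy
    set d := y - (x + δ • (2 * (K : ℝ) + 2) • e) with hd_def
    have hyd : y = x + (δ * (2 * K + 2)) • e + d := by rw [hd_def, mul_smul]; abel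
    have hee : inner ℝ e e = (1 : ℝ) := by rw [real_inner_self_eq_norm_sq, he]; norm_num
    have hed : |inner ℝ e d| ≤ δ := (abs_real_inner_le_norm e d).trans (by rw [he, one_mul]; exact hy)
    have hin : inner ℝ e y = inner ℝ e x + δ * (2 * K + 2) + inner ℝ e d := by
      rw [hyd, inner_add_right, inner_add_right, inner_smul_right, hee, mul_one]
    have hyx : ‖y - x‖ ≤ δ * (2 * K + 3) := by
      have : y - x = (δ * (2 * K + 2)) • e + d := by rw [hyd]; abel
      rw [this]
      refine (norm_add_le _ _).trans ?_
      rw [norm_smul, he, mul_one, Real.norm_eq_abs, abs_of_nonneg (by positivity)]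
      linarith
    have hxb : x ∈ Metric.ball x₀ r := by rw [Metric.mem_ball]; linarith
    have hyb : y ∈ Metric.ball x₀ r := by
      rw [Metric.mem_ball]
      have := dist_triangle y x x₀
      rw [dist_eq_norm y x] at this
      linarith
    rw [hep y hyb]
    have hx1 := (hep x hxb).1 hx
    have hl := hγ.dist_le_mul (y - inner ℝ e y • e) (x - inner ℝ e x • e)
    have hpr : dist (y - inner ℝ e y • e) (x - inner ℝ e x • e) ≤ 2 * δ := by
      have : y - inner ℝ e y • e - (x - inner ℝ e x • e) = d - inner ℝ e d • e := by
        rw [hin, hyd]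
        module
      rw [dist_eq_norm, this]
      refine (norm_sub_le _ _).trans ?_
      rw [norm_smul, he, mul_one, Real.norm_eq_abs]
      linarith
    rw [Real.dist_eq] at hl
    have h1 := (abs_le.1 (hl.trans (mul_le_mul_of_nonneg_left hpr hK))).2
    have h2 := (abs_le.1 hed).1
    linarith [hin]

section Mollification

variable {H : Type*} [NormedAddCommGroup H] [NormedSpace ℝ H]

lemma eLpNorm_mollify_sub_le [CompleteSpace H] {F : SpaceTime n → H} (hFm : StronglyMeasurable F)
    (hF : MemLp F 2) {κ : SpaceTime n → ℝ} (hκ : Continuous κ) (h0 : ∀ y, 0 ≤ κ y)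
    (hi : Integrable κ) (h1 : ∫ y, κ y = 1) {c : ENNReal}
    (hc : ∀ y, κ y ≠ 0 → eLpNorm (fun z => F (z - y) - F z) 2 ≤ c) :
    eLpNorm (fun z => (∫ y, κ (z - y) • F y) - F z) 2 ≤ c := by
  set ν : Measure (SpaceTime n) := volume.withDensity (fun y => ENNReal.ofReal (κ y)) with hν
  have : IsProbabilityMeasure ν := by
    refine ⟨?_⟩
    rw [hν, withDensity_apply _ MeasurableSet.univ, Measure.restrict_univ,
      ← ofReal_integral_eq_lintegral_ofReal hi (Eventually.of_forall h0), h1, ENNReal.ofReal_one]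
  have e : ∀ z, ∫ y, κ (z - y) • F y = ∫ y, F (z + -y) ∂ν := by
    intro z
    rw [hν, integral_withDensity_eq_integral_toReal_smul (by fun_prop)
      (Eventually.of_forall fun _ => ENNReal.ofReal_lt_top),
      ← integral_sub_left_eq_self _ volume z]
    congr 1
    ext y
    rw [ENNReal.toReal_ofReal (h0 _), sub_sub_cancel, sub_eq_add_neg z y]
  simp only [e]
  refine eLpNorm_average_sub_le hFm hF measurable_neg ?_
  rw [hν, ae_withDensity_iff (by fun_prop)]
  refine Eventually.of_forall fun y hy => ?_
  have := hc y (fun h => hy (by simp [h]))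
  simpa only [sub_eq_add_neg] using this

lemma hasFDerivAt_mollify {U : SpaceTime n → ℝ} (hU : LocallyIntegrable U) {κ : SpaceTime n → ℝ}
    (hκ : ContDiff ℝ ∞ κ) (hκc : HasCompactSupport κ) :
    ContDiff ℝ ∞ (fun z => ∫ y, κ (z - y) • U y) ∧
    ∀ z, spaceGrad (fun z => ∫ y, κ (z - y) • U y) z = ∫ y, U y • spaceGrad κ (z - y) := by
  have e : (fun z => ∫ y, κ (z - y) • U y) = U ⋆[ContinuousLinearMap.mul ℝ ℝ, volume] κ := by
    ext z
    simp [convolution_def, mul_comm]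
  have hsm : ContDiff ℝ ∞ (fun z => ∫ y, κ (z - y) • U y) := by
    rw [e]; exact hκc.contDiff_convolution_right _ hU hκ
  refine ⟨hsm, fun z => ?_⟩
  rw [spaceGrad_eq hsm]
  apply (InnerProductSpace.toDual ℝ (Space n)).injective
  rw [LinearIsometryEquiv.apply_symm_apply]
  have hgi : Integrable (fun y => U y • spaceGrad κ (z - y)) := by
    have hc1 : HasCompactSupport (fun y => spaceGrad κ (z - y)) :=
      (hasCompactSupport_spaceGrad hκ hκc).comp_homeomorph (Homeomorph.subLeft z)
    have hcont : Continuous (fun y => spaceGrad κ (z - y)) :=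
      (continuous_spaceGrad hκ).comp (by fun_prop)
    exact hU.integrable_smul_right_of_hasCompactSupport hcont hc1
  ext v
  have hd := hκc.hasFDerivAt_convolution_right (ContinuousLinearMap.mul ℝ ℝ) hU
    (hκ.of_le (by norm_num)) z
  rw [e, hd.fderiv]
  rw [ContinuousLinearMap.comp_apply, convolution_precompR_apply _ hU (hκc.fderiv ℝ)
    (hκ.continuous_fderiv (by simp)), convolution_def, InnerProductSpace.toDual_apply_apply,
    real_inner_comm, ← integral_inner hgi]
  congr 1
  ext y
  rw [spaceGrad_eq hκ, inner_smul_right, real_inner_comm, InnerProductSpace.toDual_symm_apply]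
  simp

end Mollification

/-- `U`, with spatial gradient `V`, is on `Ω × ℝ` a limit in `L²`, together with the gradients, of
functions in `C_c^∞(ℝⁿ × ℝ)`. -/
def IsSmoothLimit (Ω : Set (Space n)) (U : SpaceTime n → ℝ) (V : SpaceTime n → Space n) : Prop :=
  ∀ ε : ENNReal, 0 < ε → ∃ ψ : SpaceTime n → ℝ, ContDiff ℝ ∞ ψ ∧ HasCompactSupport ψ ∧
    eLpNorm (fun z => ψ z - U z) 2 (volume.restrict (Ω ×ˢ univ)) ≤ ε ∧
    eLpNorm (fun z => spaceGrad ψ z - V z) 2 (volume.restrict (Ω ×ˢ univ)) ≤ ε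

variable {Ω : Set (Space n)} {U U' : SpaceTime n → ℝ} {V V' : SpaceTime n → Space n}

lemma spaceGrad_add {φ ψ : SpaceTime n → ℝ} (hφ : ContDiff ℝ ∞ φ) (hψ : ContDiff ℝ ∞ ψ)
    (z : SpaceTime n) : spaceGrad (fun z => φ z + ψ z) z = spaceGrad φ z + spaceGrad ψ z := by
  have h1 := (hasGradientAt_spaceGrad hφ z).hasFDerivAt
  have h2 := (hasGradientAt_spaceGrad hψ z).hasFDerivAt
  refine HasGradientAt.gradient (f := fun x => φ (x, z.2) + ψ (x, z.2)) ?_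
  rw [hasGradientAt_iff_hasFDerivAt, map_add]
  exact h1.add h2

lemma spaceGrad_mul {φ ψ : SpaceTime n → ℝ} (hφ : ContDiff ℝ ∞ φ) (hψ : ContDiff ℝ ∞ ψ)
    (z : SpaceTime n) : spaceGrad (fun z => φ z * ψ z) z =
      φ z • spaceGrad ψ z + ψ z • spaceGrad φ z := by
  have h1 := (hasGradientAt_spaceGrad hφ z).hasFDerivAt
  have h2 := (hasGradientAt_spaceGrad hψ z).hasFDerivAt
  refine HasGradientAt.gradient (f := fun x => φ (x, z.2) * ψ (x, z.2)) ?_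
  rw [hasGradientAt_iff_hasFDerivAt, map_add, map_smul, map_smul]
  exact h1.mul h2

namespace IsSmoothLimit

lemma zero : IsSmoothLimit Ω (fun _ => 0) (fun _ => 0) := by
  intro ε _
  refine ⟨fun _ => 0, contDiff_const, HasCompactSupport.zero, by simp, ?_⟩
  have : spaceGrad (fun _ : SpaceTime n => (0 : ℝ)) = fun _ => 0 := by
    ext1 z; simp [spaceGrad]
  simp [this]

lemma add (h : IsSmoothLimit Ω U V) (h' : IsSmoothLimit Ω U' V')
    (hU : Measurable U) (hU' : Measurable U') (hV : Measurable V) (hV' : Measurable V') :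
    IsSmoothLimit Ω (fun z => U z + U' z) (fun z => V z + V' z) := by
  intro ε hε
  obtain ⟨ψ, s, c, e, g⟩ := h (ε / 2) (ENNReal.half_pos hε.ne')
  obtain ⟨ψ', s', c', e', g'⟩ := h' (ε / 2) (ENNReal.half_pos hε.ne')
  have m := s.continuous.measurable
  have m' := s'.continuous.measurable
  have k := (continuous_spaceGrad s).measurable
  have k' := (continuous_spaceGrad s').measurable
  refine ⟨fun z => ψ z + ψ' z, s.add s', c.add c', ?_, ?_⟩
  · have : (fun z => ψ z + ψ' z - (U z + U' z)) =
        (fun z => ψ z - U z) + fun z => ψ' z - U' z := by ext z; simp only [Pi.add_apply]; ring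
    rw [this, ← ENNReal.add_halves ε]
    exact (eLpNorm_add_le (m.sub hU).aestronglyMeasurable (m'.sub hU').aestronglyMeasurable
      (by norm_num)).trans (add_le_add e e')
  · have : (fun z => spaceGrad (fun z => ψ z + ψ' z) z - (V z + V' z)) =
        (fun z => spaceGrad ψ z - V z) + fun z => spaceGrad ψ' z - V' z := by
      ext1 z; simp only [Pi.add_apply, spaceGrad_add s s']; abel
    rw [this, ← ENNReal.add_halves ε]
    exact (eLpNorm_add_le (k.sub hV).aestronglyMeasurable (k'.sub hV').aestronglyMeasurable
      (by norm_num)).trans (add_le_add g g')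

lemma sum {ι : Type*} (s : Finset ι) {u : ι → SpaceTime n → ℝ} {v : ι → SpaceTime n → Space n}
    (h : ∀ i, IsSmoothLimit Ω (u i) (v i)) (hu : ∀ i, Measurable (u i))
    (hv : ∀ i, Measurable (v i)) :
    IsSmoothLimit Ω (fun z => ∑ i ∈ s, u i z) (fun z => ∑ i ∈ s, v i z) := by
  classical
  induction s using Finset.induction_on with
  | empty => simpa using zero
  | insert a s ha ih =>
    simp only [Finset.sum_insert ha]
    exact (h a).add ih (hu a) (by fun_prop) (hv a) (by fun_prop)

lemma congr (h : IsSmoothLimit Ω U V) (hΩ : MeasurableSet Ω)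
    (hU : ∀ z, z.1 ∈ Ω → U z = U' z) (hV : ∀ z, z.1 ∈ Ω → V z = V' z) :
    IsSmoothLimit Ω U' V' := by
  intro ε hε
  obtain ⟨ψ, s, c, e, g⟩ := h ε hε
  have hm : MeasurableSet (Ω ×ˢ (univ : Set ℝ)) := hΩ.prod MeasurableSet.univ
  refine ⟨ψ, s, c, ?_, ?_⟩
  · rwa [eLpNorm_congr_ae (g := fun z => ψ z - U z)]
    filter_upwards [ae_restrict_mem hm] with z hz
    rw [hU z hz.1]
  · rwa [eLpNorm_congr_ae (g := fun z => spaceGrad ψ z - V z)]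
    filter_upwards [ae_restrict_mem hm] with z hz
    rw [hV z hz.1]

/-- Smooth approximation of a function supported near a point with the interior cone property. -/
lemma of_local (hΩ : MeasurableSet Ω) {x₀ c : Space n} {r ρ δ₀ : ℝ} (hρ : ρ < r) (hδ₀ : 0 < δ₀)
    (hcone : ∀ δ, 0 < δ → δ < δ₀ → ∀ x ∈ Ω, dist x x₀ < r →
      Metric.closedBall (x + δ • c) δ ⊆ Ω)
    (hU : Measurable U) (hV : Measurable V) (hU2 : MemLp U 2) (hV2 : MemLp V 2)
    (hUc : HasCompactSupport U)
    (hU0 : ∀ z, ρ < dist z.1 x₀ → U z = 0) (hV0 : ∀ z, ρ < dist z.1 x₀ → V z = 0)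
    (hw : ∀ φ, IsTestFunction (Ω ×ˢ univ) φ → ∫ z, U z • spaceGrad φ z = -∫ z, φ z • V z) :
    IsSmoothLimit Ω U V := by
  intro ε hε
  have tU := tendsto_eLpNorm_translate_sub hU2
  have tV := tendsto_eLpNorm_translate_sub hV2
  rw [ENNReal.tendsto_nhds_zero] at tU tV
  obtain ⟨d, hd, hdε⟩ := Metric.eventually_nhds_iff.1 ((tU ε hε).and (tV ε hε))
  obtain ⟨δ, hδ, hδ1, hδ2⟩ : ∃ δ : ℝ, 0 < δ ∧ δ < δ₀ ∧ δ * (‖c‖ + 1) < min d (r - ρ) := by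
    have hm : 0 < min d (r - ρ) := lt_min hd (by linarith)
    refine ⟨min (δ₀ / 2) (min d (r - ρ) / (2 * (‖c‖ + 1))), by positivity, ?_, ?_⟩
    · exact (min_le_left _ _).trans_lt (by linarith)
    · refine (mul_le_mul_of_nonneg_right (min_le_right _ _) (by positivity)).trans_lt ?_
      rw [div_mul_eq_mul_div, div_lt_iff₀ (by positivity)]
      nlinarith [norm_nonneg c]
  set p : SpaceTime n := (-(δ • c), 0) with hp
  have hpn : ‖p‖ = δ * ‖c‖ := by
    rw [hp, Prod.norm_mk, norm_neg, norm_smul, norm_zero, Real.norm_eq_abs, abs_of_pos hδ]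
    exact max_eq_left (by positivity)
  let b : ContDiffBump p := ⟨δ / 2, δ, by positivity, by linarith⟩
  set κ : SpaceTime n → ℝ := b.normed volume with hκ_def
  have hκs : ContDiff ℝ ∞ κ := b.contDiff_normed
  have hκc : HasCompactSupport κ := b.hasCompactSupport_normed
  have hκ0 : ∀ y, 0 ≤ κ y := b.nonneg_normed
  have hκ1 : ∫ y, κ y = 1 := b.integral_normed
  have hκball : ∀ y, κ y ≠ 0 → dist y p < δ := by
    intro y hy
    have : y ∈ Function.support κ := hy
    rw [hκ_def, b.support_normed_eq] at this
    exact this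
  have hκts : tsupport κ ⊆ Metric.closedBall p δ := (b.tsupport_normed_eq (μ := volume)).subset
  have hsmall : ∀ y, κ y ≠ 0 → dist (-y) 0 < d := by
    intro y hy
    rw [dist_zero_right, norm_neg]
    have h1 : ‖y‖ ≤ ‖p‖ + dist y p := by
      rw [dist_eq_norm]; simpa using norm_add_le p (y - p)
    have := hκball y hy
    have := hδ2.trans_le (min_le_left _ _)
    linarith
  have hUl : LocallyIntegrable U := hU2.locallyIntegrable (by norm_num)
  obtain ⟨hsm, hgrad⟩ := hasFDerivAt_mollify hUl hκs hκc
  refine ⟨_, hsm, ?_, ?_, ?_⟩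
  · have := hκc.convolution (ContinuousLinearMap.mul ℝ ℝ) (μ := volume) hUc
    have e : (fun z => ∫ y, κ (z - y) • U y) =
        convolution κ U (ContinuousLinearMap.mul ℝ ℝ) volume := by
      funext z
      rw [convolution_eq_swap]
      simp
    rw [e]
    exact this
  · refine (eLpNorm_mono_measure _ Measure.restrict_le_self).trans ?_
    refine eLpNorm_mollify_sub_le hU.stronglyMeasurable hU2 hκs.continuous hκ0
      (hκs.continuous.integrable_of_hasCompactSupport hκc) hκ1 fun y hy => ?_
    simpa only [sub_eq_add_neg] using (hdε (hsmall y hy)).1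
  · have hm : MeasurableSet (Ω ×ˢ (univ : Set ℝ)) := hΩ.prod MeasurableSet.univ
    rw [eLpNorm_congr_ae (g := fun z => (∫ y, κ (z - y) • V y) - V z)]
    · refine (eLpNorm_mono_measure _ Measure.restrict_le_self).trans ?_
      refine eLpNorm_mollify_sub_le hV.stronglyMeasurable hV2 hκs.continuous hκ0
        (hκs.continuous.integrable_of_hasCompactSupport hκc) hκ1 fun y hy => ?_
      simpa only [sub_eq_add_neg] using (hdε (hsmall y hy)).2
    · filter_upwards [ae_restrict_mem hm] with z hz
      rw [hgrad z]
      congr 1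
      set φ : SpaceTime n → ℝ := fun y => κ (z - y) with hφ
      have hφs : ContDiff ℝ ∞ φ := hκs.comp (contDiff_const.sub contDiff_id)
      have hφc : HasCompactSupport φ := hκc.comp_homeomorph (Homeomorph.subLeft z)
      have hφg : ∀ y, spaceGrad φ y = -spaceGrad κ (z - y) := by
        intro y
        have h1 : HasFDerivAt φ _ y := ((hκs.differentiable (by simp) (z - y)).hasFDerivAt).comp y
          ((hasFDerivAt_id y).const_sub z)
        rw [spaceGrad_eq hφs, spaceGrad_eq hκs, h1.fderiv, ← map_neg]
        congr 1
        ext v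
        simp
      have hball : ∀ y, y ∈ tsupport φ → dist y.1 (z.1 + δ • c) ≤ δ := by
        intro y hy
        have h1 : z - y ∈ tsupport κ := by
          have := tsupport_comp_eq_preimage κ (Homeomorph.subLeft z)
          have h2 : tsupport φ = (Homeomorph.subLeft z) ⁻¹' tsupport κ := this
          rw [h2] at hy
          exact hy
        have h2 := Metric.mem_closedBall.1 (hκts h1)
        have h3 : dist (z - y).1 p.1 ≤ δ := (le_max_left _ _).trans h2
        rw [dist_eq_norm] at h3 ⊢
        have e : -(y.1 - (z.1 + δ • c)) = (z - y).1 - p.1 := by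
          simp only [hp, Prod.fst_sub]
          abel
        rw [← norm_neg, e]
        exact h3
      have hneg : ∫ y, U y • spaceGrad κ (z - y) = -∫ y, U y • spaceGrad φ y := by
        rw [← integral_neg]; congr 1; ext1 y; rw [hφg]; simp
      rw [hneg]
      by_cases hzr : dist z.1 x₀ < r
      · rw [hw φ ⟨hφs, hφc, fun y hy => ⟨?_, mem_univ _⟩⟩, neg_neg]
        exact hcone δ hδ hδ1 z.1 hz.1 hzr (hball y hy)
      · have hfar : ∀ y, y ∈ tsupport φ → ρ < dist y.1 x₀ := by
          intro y hy
          have h1 := hball y hy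
          have h2 : dist z.1 (z.1 + δ • c) = δ * ‖c‖ := by
            rw [dist_self_add_right, norm_smul, Real.norm_eq_abs, abs_of_pos hδ]
          have h3 := dist_triangle z.1 (z.1 + δ • c) y.1
          have h4 := dist_triangle z.1 y.1 x₀
          rw [dist_comm (z.1 + δ • c) y.1] at h3
          have := hδ2.trans_le (min_le_right _ _)
          linarith [not_lt.1 hzr]
        have e1 : ∀ y, U y • spaceGrad φ y = 0 := by
          intro y
          by_cases hy : y ∈ tsupport φ
          · rw [hU0 y (hfar y hy), zero_smul]
          · rw [spaceGrad_eq_zero_of_notMem hφs hy, smul_zero]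
        have e2 : ∀ y, φ y • V y = 0 := by
          intro y
          by_cases hy : y ∈ tsupport φ
          · rw [hV0 y (hfar y hy), smul_zero]
          · rw [image_eq_zero_of_notMem_tsupport hy, zero_smul]
        have e2' : ∀ y, κ (z - y) • V y = 0 := e2
        simp only [e1, e2', integral_zero, neg_zero]

end IsSmoothLimit

section SmoothApproximation

variable {n : ℕ} {Ω : Set (Space n)} {U : SpaceTime n → ℝ} {V : SpaceTime n → Space n}

lemma spaceGrad_finset_sum {ι : Type*} (s : Finset ι) {χ : ι → SpaceTime n → ℝ}
    (hχ : ∀ i, ContDiff ℝ ∞ (χ i)) (z : SpaceTime n) :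
    spaceGrad (fun z => ∑ i ∈ s, χ i z) z = ∑ i ∈ s, spaceGrad (χ i) z := by
  classical
  induction s using Finset.induction_on with
  | empty => simp [spaceGrad]
  | insert a s ha ih =>
    simp only [Finset.sum_insert ha]
    rw [spaceGrad_add (hχ a) (ContDiff.sum fun i _ => hχ i), ih]

lemma integral_mul_smul_spaceGrad {A : Set (SpaceTime n)} (hUl : LocallyIntegrable U)
    (hVl : LocallyIntegrable V)
    (hw : ∀ φ, IsTestFunction A φ → ∫ z, U z • spaceGrad φ z = -∫ z, φ z • V z)
    {χ : SpaceTime n → ℝ} (hχ : ContDiff ℝ ∞ χ) {φ : SpaceTime n → ℝ} (hφ : IsTestFunction A φ) :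
    ∫ z, (χ z * U z) • spaceGrad φ z = -∫ z, φ z • (χ z • V z + U z • spaceGrad χ z) := by
  have hφ' := hφ.contDiff
  have hφc := hφ.hasCompactSupport
  have hψ : IsTestFunction A (fun z => χ z * φ z) :=
    ⟨hχ.mul hφ', hφc.mul_left, (tsupport_mul_subset_right).trans hφ.tsupport_subset⟩
  have h1 := hw _ hψ
  have i1 : Integrable fun z => U z • (φ z • spaceGrad χ z) :=
    hUl.integrable_smul_right_of_hasCompactSupport
      (hφ'.continuous.smul (continuous_spaceGrad hχ)) hφc.smul_right
  have i2 : Integrable fun z => U z • spaceGrad (fun z => χ z * φ z) z :=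
    hUl.integrable_smul_right_of_hasCompactSupport (continuous_spaceGrad hψ.contDiff)
      (hasCompactSupport_spaceGrad hψ.contDiff hψ.hasCompactSupport)
  have i3 : Integrable fun z => (χ z * φ z) • V z :=
    hVl.integrable_smul_left_of_hasCompactSupport hψ.contDiff.continuous hψ.hasCompactSupport
  have e1 : ∀ z, (χ z * U z) • spaceGrad φ z =
      U z • spaceGrad (fun z => χ z * φ z) z - U z • (φ z • spaceGrad χ z) := by
    intro z
    rw [spaceGrad_mul hχ hφ']
    module
  have e2 : ∀ z, φ z • (χ z • V z + U z • spaceGrad χ z) =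
      (χ z * φ z) • V z + U z • (φ z • spaceGrad χ z) := by
    intro z; module
  simp only [e1, e2]
  rw [integral_sub i2 i1, integral_add i3 i1, h1]
  abel

lemma IsSmoothLimit.of_hasInteriorCones (hΩo : IsOpen Ω) (hΩb : Bornology.IsBounded Ω)
    (hcone : HasInteriorCones Ω) (hU : Measurable U) (hV : Measurable V) (hU2 : MemLp U 2)
    (hV2 : MemLp V 2) (hUc : HasCompactSupport U)
    (hw : ∀ φ, IsTestFunction (Ω ×ˢ univ) φ → ∫ z, U z • spaceGrad φ z = -∫ z, φ z • V z) :
    IsSmoothLimit Ω U V := by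
  choose! r c δ₀ hr hδ₀ hc using hcone
  have hK : IsCompact (closure Ω) := hΩb.isCompact_closure
  obtain ⟨t, ht⟩ := hK.elim_finite_subcover
    (fun p : closure Ω => Metric.ball (p : Space n) (r p / 2)) (fun _ => Metric.isOpen_ball)
    (fun x hx => mem_iUnion.2 ⟨⟨x, hx⟩, Metric.mem_ball_self (by have := hr x hx; positivity)⟩)
  obtain ⟨χ, hχ⟩ := SmoothPartitionOfUnity.exists_isSubordinate
    (modelWithCornersSelf ℝ (Space n)) isClosed_closure
    (fun p : t => Metric.ball (p : Space n) (r p / 2)) (fun _ => Metric.isOpen_ball)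
    (fun x hx => by
      obtain ⟨p, hp, hxp⟩ := mem_iUnion₂.1 (ht hx)
      exact mem_iUnion.2 ⟨⟨p, hp⟩, hxp⟩)
  have hsm : ∀ i : t, ContDiff ℝ ∞ (χ i) := fun i => (χ i).contMDiff.contDiff
  set X : t → SpaceTime n → ℝ := fun i z => χ i z.1 with hX
  have hXs : ∀ i, ContDiff ℝ ∞ (X i) := fun i => (hsm i).comp contDiff_fst
  have hXm : ∀ i, Measurable (X i) := fun i => (hXs i).continuous.measurable
  have hGm : ∀ i, Measurable (spaceGrad (X i)) := fun i => (continuous_spaceGrad (hXs i)).measurable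
  have hX0 : ∀ (i : t) (z : SpaceTime n), r i / 2 < dist z.1 (i : Space n) → z ∉ tsupport (X i) := by
    intro i z hz hmem
    have h1 : tsupport (X i) ⊆ Prod.fst ⁻¹' tsupport (χ i) :=
      closure_minimal (fun z hz => subset_tsupport _ hz)
        ((isClosed_tsupport _).preimage continuous_fst)
    have := hχ i (h1 hmem)
    rw [Metric.mem_ball] at this
    exact absurd this (not_lt.2 hz.le)
  have hpiece : ∀ i, IsSmoothLimit Ω (fun z => X i z * U z)
      (fun z => X i z • V z + U z • spaceGrad (X i) z) := by
    intro i
    have hi : (i : Space n) ∈ closure Ω := i.1.2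
    have m1 : Measurable fun z => X i z * U z := (hXm i).mul hU
    have m2 : Measurable fun z => X i z • V z := (hXm i).smul hV
    have m3 : Measurable fun z => U z • spaceGrad (X i) z := hU.smul (hGm i)
    have hX1 : ∀ z, |X i z| ≤ 1 := fun z => by
      rw [abs_of_nonneg (χ.nonneg i _)]; exact χ.le_one i _
    obtain ⟨D, hD⟩ := hUc.isCompact.exists_bound_of_continuousOn
      (continuous_spaceGrad (hXs i)).continuousOn
    refine IsSmoothLimit.of_local hΩo.measurableSet (x₀ := (i : Space n)) (c := c i) (r := r i)
      (ρ := r i / 2) (δ₀ := δ₀ i) (by linarith [hr i hi]) (hδ₀ i hi) (hc i hi) m1 (m2.add m3)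
      ?_ (MemLp.add ?_ ?_) hUc.mul_left ?_ ?_ ?_
    · refine hU2.of_le_mul (c := 1) m1.aestronglyMeasurable (Eventually.of_forall fun z => ?_)
      rw [norm_mul]
      exact mul_le_mul_of_nonneg_right (hX1 z) (norm_nonneg _)
    · refine hV2.of_le_mul (c := 1) m2.aestronglyMeasurable (Eventually.of_forall fun z => ?_)
      rw [norm_smul]
      exact mul_le_mul_of_nonneg_right (hX1 z) (norm_nonneg _)
    · refine hU2.of_le_mul (c := D) m3.aestronglyMeasurable (Eventually.of_forall fun z => ?_)
      by_cases hz : z ∈ tsupport U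
      · rw [norm_smul, mul_comm]
        exact mul_le_mul_of_nonneg_right (hD z hz) (norm_nonneg _)
      · simp [image_eq_zero_of_notMem_tsupport hz]
    · intro z hz
      rw [image_eq_zero_of_notMem_tsupport (hX0 i z hz), zero_mul]
    · intro z hz
      rw [image_eq_zero_of_notMem_tsupport (hX0 i z hz),
        spaceGrad_eq_zero_of_notMem (hXs i) (hX0 i z hz)]
      simp
    · exact fun φ hφ => integral_mul_smul_spaceGrad
        (hU2.locallyIntegrable (by norm_num)) (hV2.locallyIntegrable (by norm_num)) hw (hXs i) hφ
  have hsum := IsSmoothLimit.sum Finset.univ hpiece (fun i => (hXm i).mul hU)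
    (fun i => ((hXm i).smul hV).add (hU.smul (hGm i)))
  have hone : ∀ x ∈ Ω, ∑ i, χ i x = 1 := by
    intro x hx
    rw [← finsum_eq_sum_of_fintype]
    exact χ.sum_eq_one (subset_closure hx)
  refine hsum.congr hΩo.measurableSet ?_ ?_
  · intro z hz
    rw [← Finset.sum_mul, hone z.1 hz, one_mul]
  · intro z hz
    rw [Finset.sum_add_distrib, ← Finset.sum_smul, ← Finset.smul_sum, hone z.1 hz, one_smul,
      ← spaceGrad_finset_sum _ hXs]
    have : (fun x => ∑ i, X i (x, z.2)) =ᶠ[𝓝 z.1] fun _ => 1 := by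
      filter_upwards [hΩo.mem_nhds hz] with x hx using hone x hx
    rw [spaceGrad, gradient, this.fderiv_eq]
    simp

end SmoothApproximation

section Cutoff

/-- Smooth cutoffs in time, compactly supported in `(0, T)` and increasing to `1` there. -/
noncomputable def timeCutoff (T : ℝ) (k : ℕ) (t : ℝ) : ℝ :=
  Real.smoothTransition (k * t - 1) * Real.smoothTransition (k * (T - t) - 1)

lemma contDiff_timeCutoff (T : ℝ) (k : ℕ) : ContDiff ℝ ∞ (timeCutoff T k) :=
  (Real.smoothTransition.contDiff.comp (by fun_prop)).mul
    (Real.smoothTransition.contDiff.comp (by fun_prop))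

lemma timeCutoff_nonneg (T : ℝ) (k : ℕ) (t : ℝ) : 0 ≤ timeCutoff T k t :=
  mul_nonneg (Real.smoothTransition.nonneg _) (Real.smoothTransition.nonneg _)

lemma timeCutoff_le_one (T : ℝ) (k : ℕ) (t : ℝ) : timeCutoff T k t ≤ 1 :=
  mul_le_one₀ (Real.smoothTransition.le_one _) (Real.smoothTransition.nonneg _)
    (Real.smoothTransition.le_one _)

lemma tsupport_timeCutoff_subset (T : ℝ) (k : ℕ) : tsupport (timeCutoff T k) ⊆ Ioo 0 T := by
  have h : tsupport (timeCutoff T k) ⊆ {t | 1 ≤ k * t} ∩ {t | 1 ≤ k * (T - t)} := by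
    refine closure_minimal (fun t ht => ⟨?_, ?_⟩) ((isClosed_le (by fun_prop) (by fun_prop)).inter
      (isClosed_le (by fun_prop) (by fun_prop)))
    · by_contra hcon
      exact ht (mul_eq_zero_of_left (Real.smoothTransition.zero_of_nonpos
        (by simp only [mem_ofPred_eq, not_le] at hcon; linarith)) _)
    · by_contra hcon
      exact ht (mul_eq_zero_of_right _ (Real.smoothTransition.zero_of_nonpos
        (by simp only [mem_ofPred_eq, not_le] at hcon; linarith)))
  intro t ht
  obtain ⟨h1, h2⟩ := h ht
  have hk : (0 : ℝ) ≤ k := k.cast_nonneg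
  simp only [mem_ofPred_eq] at h1 h2
  constructor
  · by_contra hcon; nlinarith
  · by_contra hcon; nlinarith

lemma tendsto_timeCutoff {T t : ℝ} (ht : t ∈ Ioo 0 T) :
    Tendsto (fun k => timeCutoff T k t) atTop (𝓝 1) := by
  have h1 : ∀ᶠ k : ℕ in atTop, 2 ≤ (k : ℝ) * t :=
    (tendsto_natCast_atTop_atTop.atTop_mul_const ht.1).eventually_ge_atTop 2
  have h2 : ∀ᶠ k : ℕ in atTop, 2 ≤ (k : ℝ) * (T - t) :=
    (tendsto_natCast_atTop_atTop.atTop_mul_const (sub_pos.2 ht.2)).eventually_ge_atTop 2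
  refine tendsto_const_nhds.congr' ?_
  filter_upwards [h1, h2] with k hk1 hk2
  rw [timeCutoff, Real.smoothTransition.one_of_one_le (by linarith),
    Real.smoothTransition.one_of_one_le (by linarith), one_mul]

lemma exists_time_cutoff_eq_one {K : Set ℝ} (hK : IsCompact K) {a : ℝ} (hKa : K ⊆ Ioi a) :
    ∃ ζ : ℝ → ℝ, ContDiff ℝ ∞ ζ ∧ HasCompactSupport ζ ∧ tsupport ζ ⊆ Ioi a ∧ ∀ t ∈ K, ζ t = 1 := by
  obtain ⟨R, hR⟩ := hK.isBounded.subset_ball (0 : ℝ)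
  obtain ⟨b, hb, hKb⟩ : ∃ b, a < b ∧ K ⊆ Ici b := by
    by_cases hne : K.Nonempty
    · obtain ⟨b, hbK, hb⟩ := hK.exists_isLeast hne
      exact ⟨b, hKa hbK, fun t ht => hb ht⟩
    · rw [not_nonempty_iff_eq_empty] at hne
      exact ⟨a + 1, by linarith, by simp [hne]⟩
  set c := (a + b) / 2
  have hc : a < c ∧ c < b := ⟨by simp only [c]; linarith, by simp only [c]; linarith⟩
  have hbc : 0 < b - c := by linarith
  refine ⟨fun t => Real.smoothTransition ((t - c) / (b - c)) * Real.smoothTransition (R + 1 - t),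
    (Real.smoothTransition.contDiff.comp (by fun_prop)).mul
    (Real.smoothTransition.contDiff.comp (by fun_prop)), ?_, ?_, ?_⟩
  · refine HasCompactSupport.intro (isCompact_Icc (a := c) (b := R + 1)) fun t ht => ?_
    rw [mem_Icc, not_and_or, not_le, not_le] at ht
    rcases ht with ht | ht
    · exact mul_eq_zero_of_left (Real.smoothTransition.zero_of_nonpos
        (div_nonpos_of_nonpos_of_nonneg (by linarith) hbc.le)) _
    · exact mul_eq_zero_of_right _ (Real.smoothTransition.zero_of_nonpos (by linarith))
  · refine (closure_minimal (t := Ici c) (fun t ht => ?_) isClosed_Ici).trans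
      (Ici_subset_Ioi.2 hc.1)
    by_contra hcon
    rw [mem_Ici, not_le] at hcon
    exact ht (mul_eq_zero_of_left (Real.smoothTransition.zero_of_nonpos
        (div_nonpos_of_nonpos_of_nonneg (by linarith) hbc.le)) _)
  · intro t ht
    have h1 := hKb ht
    have h2 := hR ht
    rw [mem_ball_zero_iff, Real.norm_eq_abs, abs_lt] at h2
    rw [mem_Ici] at h1
    simp only
    rw [Real.smoothTransition.one_of_one_le, Real.smoothTransition.one_of_one_le (by linarith),
      one_mul]
    rw [le_div_iff₀ hbc]; linarith

lemma tsupport_comp_snd_subset (ζ : ℝ → ℝ) :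
    tsupport (fun z : SpaceTime n => ζ z.2) ⊆ Prod.snd ⁻¹' tsupport ζ :=
  closure_minimal (fun _ hz => subset_tsupport ζ hz)
    ((isClosed_tsupport _).preimage continuous_snd)

lemma spaceGrad_comp_snd (ζ : ℝ → ℝ) (z : SpaceTime n) :
    spaceGrad (fun z : SpaceTime n => ζ z.2) z = 0 := by
  simp [spaceGrad]

end Cutoff

namespace IsZeroDataSubsolution

variable {Ω : Set (Space n)} {T M l : ℝ} {w f : SpaceTime n → ℝ} {G : SpaceTime n → Space n}

lemma integrable (h : IsZeroDataSubsolution Ω T M w f G) (hΩo : IsOpen Ω)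
    (hΩb : Bornology.IsBounded Ω) : Integrable w :=
  integrable_of_bounded hΩo hΩb h.measurable h.abs_le h.eq_zero

lemma expAverage_eq_zero {H : Type*} [NormedAddCommGroup H] [NormedSpace ℝ H]
    {F : SpaceTime n → H} (hF : ∀ z ∉ spaceTimeCylinder Ω T, F z = 0) {z : SpaceTime n}
    (hz : z.1 ∉ Ω) : expAverage l F z = 0 := by
  have : ∀ r : ℝ, F (z + ((0 : Space n), r)) = 0 := fun r =>
    hF _ fun hmem => hz (by simpa using hmem.1)
  simp [expAverage, this]

lemma integral_smul_spaceGrad (h : IsZeroDataSubsolution Ω T M w f G) (hΩo : IsOpen Ω)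
    (hΩb : Bornology.IsBounded Ω)
    (hg : ∀ φ, IsTestFunction (spaceTimeCylinder Ω T) φ →
      ∫ z, w z • spaceGrad φ z = -∫ z, φ z • G z)
    {φ : SpaceTime n → ℝ} (hφ : IsTestFunction (Ω ×ˢ univ) φ) :
    ∫ z, w z • spaceGrad φ z = -∫ z, φ z • G z := by
  have hφ' := hφ.contDiff
  have hwi := h.integrable hΩo hΩb
  obtain ⟨D, -, hD⟩ := exists_norm_le_of_compact (continuous_spaceGrad hφ')
    (hasCompactSupport_spaceGrad hφ' hφ.hasCompactSupport)
  obtain ⟨D', -, hD'⟩ := exists_norm_le_of_compact hφ'.continuous hφ.hasCompactSupport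
  have hθ : ∀ k, ContDiff ℝ ∞ (fun z : SpaceTime n => timeCutoff T k z.2) := fun k =>
    (contDiff_timeCutoff T k).comp contDiff_snd
  have key : ∀ k : ℕ, ∫ z, timeCutoff T k z.2 • (w z • spaceGrad φ z) =
      -∫ z, timeCutoff T k z.2 • (φ z • G z) := by
    intro k
    have hψ : IsTestFunction (spaceTimeCylinder Ω T) (fun z => timeCutoff T k z.2 * φ z) := by
      refine ⟨(hθ k).mul hφ', hφ.hasCompactSupport.mul_left, fun z hz => ⟨?_, ?_⟩⟩
      · exact (hφ.tsupport_subset (tsupport_mul_subset_right hz)).1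
      · exact tsupport_timeCutoff_subset T k
          (tsupport_comp_snd_subset _ (tsupport_mul_subset_left hz))
    have h1 := hg _ hψ
    simp only [spaceGrad_mul (hθ k) hφ', spaceGrad_comp_snd, smul_zero, add_zero] at h1
    have e1 : ∀ z : SpaceTime n, timeCutoff T k z.2 • (w z • spaceGrad φ z) =
        w z • timeCutoff T k z.2 • spaceGrad φ z := fun z => smul_comm _ _ _
    have e2 : ∀ z : SpaceTime n, timeCutoff T k z.2 • (φ z • G z) =
        (timeCutoff T k z.2 * φ z) • G z := fun z => (mul_smul _ _ _).symm
    simp only [e1, e2]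
    exact h1
  have hlim : ∀ {F : SpaceTime n → Space n}, Integrable F →
      (∀ z ∉ spaceTimeCylinder Ω T, F z = 0) →
      Tendsto (fun k : ℕ => ∫ z, timeCutoff T k z.2 • F z) atTop (𝓝 (∫ z, F z)) := by
    intro F hF hF0
    refine tendsto_integral_of_dominated_convergence (fun z => ‖F z‖) (fun k => ?_) hF.norm
      (fun k => Eventually.of_forall fun z => ?_) (Eventually.of_forall fun z => ?_)
    · exact (hθ k).continuous.aestronglyMeasurable.smul hF.1
    · rw [norm_smul, Real.norm_eq_abs, abs_of_nonneg (timeCutoff_nonneg _ _ _)]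
      exact mul_le_of_le_one_left (norm_nonneg _) (timeCutoff_le_one _ _ _)
    · by_cases hz : z ∈ spaceTimeCylinder Ω T
      · simpa using (tendsto_timeCutoff hz.2).smul_const (F z)
      · simp [hF0 z hz]
  have i1 : Integrable fun z => w z • spaceGrad φ z := hwi.smul_bdd D
    (continuous_spaceGrad hφ').aestronglyMeasurable (Eventually.of_forall hD)
  have i2 : Integrable fun z => φ z • G z := h.integrable_grad.bdd_smul D'
    hφ'.continuous.aestronglyMeasurable (Eventually.of_forall hD')
  have t1 := hlim i1 fun z hz => by rw [h.eq_zero z hz, zero_smul]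
  have t2 := hlim i2 fun z hz => by rw [h.grad_eq_zero z hz, smul_zero]
  simp only [key] at t1
  exact tendsto_nhds_unique t1 t2.neg

lemma integral_expAverage_smul_spaceGrad (h : IsZeroDataSubsolution Ω T M w f G) (hΩo : IsOpen Ω)
    (hΩb : Bornology.IsBounded Ω) (hl : 0 < l)
    (hg : ∀ φ, IsTestFunction (spaceTimeCylinder Ω T) φ →
      ∫ z, w z • spaceGrad φ z = -∫ z, φ z • G z)
    {φ : SpaceTime n → ℝ} (hφ : IsTestFunction (Ω ×ˢ univ) φ) :
    ∫ z, expAverage l w z • spaceGrad φ z = -∫ z, φ z • expAverage l G z := by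
  have := isProbabilityMeasure_expMeasure hl
  have hφ' := hφ.contDiff
  have hφc := hφ.hasCompactSupport
  have hwi := h.integrable hΩo hΩb
  have hcs := continuous_spaceGrad hφ'
  obtain ⟨D, -, hD⟩ := exists_norm_le_of_compact hcs (hasCompactSupport_spaceGrad hφ' hφc)
  obtain ⟨D', -, hD'⟩ := exists_norm_le_of_compact hφ'.continuous hφc
  have f1 : ∫ z, expAverage l w z • spaceGrad φ z = ∫ r, (∫ z,
      w (z + ((0 : Space n), r)) • spaceGrad φ z) ∂expMeasure l :=
    integral_bilin_average (ν := expMeasure l) (ContinuousLinearMap.lsmul ℝ ℝ)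
      h.measurable.stronglyMeasurable hwi measurable_timeShift hcs.stronglyMeasurable hD
  have f2 : ∫ z, φ z • expAverage l G z = ∫ r, (∫ z,
      φ z • G (z + ((0 : Space n), r))) ∂expMeasure l :=
    integral_bilin_average (ν := expMeasure l) (ContinuousLinearMap.lsmul ℝ ℝ).flip
      h.measurable_grad.stronglyMeasurable h.integrable_grad measurable_timeShift
      hφ'.continuous.stronglyMeasurable hD'
  rw [f1, f2, ← integral_neg]
  congr 1
  ext1 r
  have hφr : IsTestFunction (Ω ×ˢ univ) (fun z => φ (z - ((0 : Space n), r))) := by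
    refine ⟨hφ'.comp (contDiff_id.sub contDiff_const),
      hφc.comp_homeomorph (Homeomorph.subRight ((0 : Space n), r)), fun z hz => ⟨?_, mem_univ _⟩⟩
    have h2 : tsupport (fun z => φ (z - ((0 : Space n), r))) =
      (Homeomorph.subRight ((0 : Space n), r)) ⁻¹' tsupport φ := 
        tsupport_comp_eq_preimage φ (Homeomorph.subRight ((0 : Space n), r))
    rw [h2] at hz
    have := (hφ.tsupport_subset hz).1
    simpa using this
  have hr := h.integral_smul_spaceGrad hΩo hΩb hg hφr
  rw [← integral_add_right_eq_self (fun z => w z • _) ((0 : Space n), r),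
    ← integral_add_right_eq_self (fun z => _ • G z) ((0 : Space n), r)] at hr
  simpa only [spaceGrad_translate, add_sub_cancel_right] using hr

lemma memLp_mul_expAverage_grad (h : IsZeroDataSubsolution Ω T M w f G) (hl : 0 < l) {ζ : ℝ → ℝ}
    (hζ : Continuous ζ) (hζc : HasCompactSupport ζ) (hζ0 : tsupport ζ ⊆ Ioi 0) :
    MemLp (fun z : SpaceTime n => ζ z.2 • expAverage l G z) 2 := by
  have := isProbabilityMeasure_expMeasure hl
  obtain ⟨τ, hτ, hsub⟩ : ∃ τ : ℝ, 0 < τ ∧ tsupport ζ ⊆ Ici τ := by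
    by_cases hne : (tsupport ζ).Nonempty
    · obtain ⟨b, hbK, hb⟩ := hζc.isCompact.exists_isLeast hne
      exact ⟨b, hζ0 hbK, fun t ht => hb ht⟩
    · rw [not_nonempty_iff_eq_empty] at hne
      exact ⟨1, by norm_num, by simp [hne]⟩
  have hmeas : MeasurableSet {z : SpaceTime n | τ ≤ z.2} :=
    measurableSet_le measurable_const measurable_snd
  set Gτ := {z : SpaceTime n | τ ≤ z.2}.indicator G with hGτ
  have hGm : StronglyMeasurable Gτ := (h.measurable_grad.indicator hmeas).stronglyMeasurable
  have hG2 : MemLp Gτ 2 := (memLp_indicator_iff_restrict hmeas).2 (h.memLp_grad τ hτ)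
  have hav : MemLp (expAverage l Gτ) 2 :=
    memLp_average (ν := expMeasure l) hGm hG2 measurable_timeShift
  obtain ⟨D, hD⟩ := hζ.bounded_above_of_compact_support hζc
  have e : (fun z : SpaceTime n => ζ z.2 • expAverage l G z) =
      fun z => ζ z.2 • expAverage l Gτ z := by
    ext1 z
    by_cases hz : z.2 ∈ tsupport ζ
    · congr 1
      refine integral_congr_ae ?_
      filter_upwards [ae_expMeasure_pos hl] with r hr
      have : z + ((0 : Space n), r) ∈ {z : SpaceTime n | τ ≤ z.2} := by
        have := hsub hz
        simp only [mem_Ici, mem_ofPred_eq, Prod.snd_add] at this ⊢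
        linarith
      rw [hGτ, indicator_of_mem this]
    · rw [image_eq_zero_of_notMem_tsupport hz, zero_smul, zero_smul]
  rw [e]
  refine hav.of_le_mul (c := D) ((hζ.comp continuous_snd).aestronglyMeasurable.smul hav.1)
    (Eventually.of_forall fun z => ?_)
  rw [norm_smul]
  exact mul_le_mul_of_nonneg_right (hD _) (norm_nonneg _)

lemma memLp_mul_expAverage (h : IsZeroDataSubsolution Ω T M w f G)
    (hΩb : Bornology.IsBounded Ω) (hl : 0 < l) {ζ : ℝ → ℝ}
    (hζ : Continuous ζ) (hζc : HasCompactSupport ζ) :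
    Measurable (fun z : SpaceTime n => ζ z.2 * expAverage l w z) ∧
    HasCompactSupport (fun z : SpaceTime n => ζ z.2 * expAverage l w z) ∧
    MemLp (fun z : SpaceTime n => ζ z.2 * expAverage l w z) 2 := by
  have hVm : Measurable (expAverage l w) :=
    (stronglyMeasurable_expAverage hl h.measurable.stronglyMeasurable).measurable
  have hm : Measurable (fun z : SpaceTime n => ζ z.2 * expAverage l w z) :=
    (hζ.measurable.comp measurable_snd).mul hVm
  have hK : IsCompact (closure Ω ×ˢ tsupport ζ) := hΩb.isCompact_closure.prod hζc.isCompact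
  have h0 : ∀ z ∉ closure Ω ×ˢ tsupport ζ, ζ z.2 * expAverage l w z = 0 := by
    intro z hz
    rw [mem_prod, not_and_or] at hz
    rcases hz with hz | hz
    · rw [expAverage_eq_zero h.eq_zero fun hmem => hz (subset_closure hmem), mul_zero]
    · rw [image_eq_zero_of_notMem_tsupport hz, zero_mul]
  have hc : HasCompactSupport (fun z : SpaceTime n => ζ z.2 * expAverage l w z) :=
    HasCompactSupport.intro hK h0
  obtain ⟨D, hD⟩ := hζ.bounded_above_of_compact_support hζc
  refine ⟨hm, hc, ?_⟩
  have hcomp : MemLp (fun z : SpaceTime n => ζ z.2 * expAverage l w z) 2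
      (volume.restrict (closure Ω ×ˢ tsupport ζ)) := by
    have : IsFiniteMeasure ((volume : Measure (SpaceTime n)).restrict (closure Ω ×ˢ tsupport ζ)) :=
      ⟨by simpa using hK.measure_lt_top⟩
    refine MemLp.of_bound hm.aestronglyMeasurable (D * M) (Eventually.of_forall fun z => ?_)
    rw [norm_mul]
    exact mul_le_mul (hD _) (abs_expAverage_le hl h.abs_le z) (norm_nonneg _)
      ((norm_nonneg _).trans (hD 0))
  rw [← memLp_indicator_iff_restrict hK.measurableSet] at hcomp
  have e : (fun z : SpaceTime n => ζ z.2 * expAverage l w z) =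
    (closure Ω ×ˢ tsupport ζ).indicator fun z => ζ z.2 * expAverage l w z := ?_
  · rw [e]; exact hcomp
  ext1 z
  by_cases hz : z ∈ (closure Ω ×ˢ tsupport ζ : Set (SpaceTime n))
  · rw [indicator_of_mem hz]
  · rw [indicator_of_notMem hz, h0 z hz]

lemma exists_smooth_approx (h : IsZeroDataSubsolution Ω T M w f G) (hΩo : IsOpen Ω)
    (hΩb : Bornology.IsBounded Ω) (hcone : HasInteriorCones Ω) (hl : 0 < l) {ζ : ℝ → ℝ}
    (hζ : ContDiff ℝ ∞ ζ) (hζc : HasCompactSupport ζ) (hζ0 : tsupport ζ ⊆ Ioi 0)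
    {ε : ENNReal} (hε : 0 < ε) :
    ∃ ψ : SpaceTime n → ℝ, ContDiff ℝ ∞ ψ ∧ HasCompactSupport ψ ∧
      eLpNorm (fun z => ψ z - ζ z.2 * expAverage l w z) 2 (volume.restrict (Ω ×ˢ univ)) ≤ ε ∧
      ((∀ z, G z = 0) ∨ eLpNorm (fun z => spaceGrad ψ z - ζ z.2 • expAverage l G z) 2
        (volume.restrict (Ω ×ˢ univ)) ≤ ε) := by
  have := isProbabilityMeasure_expMeasure hl
  obtain ⟨hm, hc, h2⟩ := h.memLp_mul_expAverage hΩb hl hζ.continuous hζc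
  rcases h.grad_eq with h0 | hg
  · by_cases htop : ε = ⊤
    · exact ⟨fun _ => 0, contDiff_const, HasCompactSupport.zero, by simp [htop], Or.inl h0⟩
    obtain ⟨ψ, hψc, hψ, hψε⟩ := h2.exist_eLpNorm_sub_le (by simp) (by norm_num)
      (ENNReal.toReal_pos hε.ne' htop)
    rw [ENNReal.ofReal_toReal htop, eLpNorm_sub_comm] at hψε
    exact ⟨ψ, hψ, hψc, (eLpNorm_mono_measure _ Measure.restrict_le_self).trans hψε, Or.inl h0⟩
  · have hζs : ContDiff ℝ ∞ (fun z : SpaceTime n => ζ z.2) := hζ.comp contDiff_snd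
    have hVm := (stronglyMeasurable_expAverage hl h.measurable.stronglyMeasurable).measurable
    have hGm := (stronglyMeasurable_expAverage hl h.measurable_grad.stronglyMeasurable).measurable
    have hVi : Integrable (expAverage l w) := integrable_average (ν := expMeasure l)
      h.measurable.stronglyMeasurable (h.integrable hΩo hΩb) measurable_timeShift
    have hGi : Integrable (expAverage l G) := integrable_average (ν := expMeasure l)
      h.measurable_grad.stronglyMeasurable h.integrable_grad measurable_timeShift
    have hHm : Measurable (fun z : SpaceTime n => ζ z.2 • expAverage l G z) :=
      hζs.continuous.measurable.smul hGm
    obtain ⟨ψ, h1, h2, h3, h4⟩ := IsSmoothLimit.of_hasInteriorCones hΩo hΩb hcone hm hHm h2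
      (h.memLp_mul_expAverage_grad hl hζ.continuous hζc hζ0) hc (fun φ hφ => by
        have := integral_mul_smul_spaceGrad hVi.locallyIntegrable hGi.locallyIntegrable
          (fun φ hφ => h.integral_expAverage_smul_spaceGrad hΩo hΩb hl hg hφ) hζs hφ
        simpa only [spaceGrad_comp_snd, smul_zero, add_zero] using this) ε hε
    exact ⟨ψ, h1, h2, h3, Or.inr h4⟩

end IsZeroDataSubsolution

section Ramp

/-- A smooth nondecreasing function with values in `[0, 1]`, vanishing on the negative half-line,
with derivative at most `L`. -/
structure IsRamp (β : ℝ → ℝ) (L : ℝ) : Prop where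
  contDiff : ContDiff ℝ ∞ β
  nonneg : ∀ y, 0 ≤ β y
  le_one : ∀ y, β y ≤ 1
  eq_zero : ∀ y ≤ 0, β y = 0
  deriv_nonneg : ∀ y, 0 ≤ deriv β y
  deriv_le : ∀ y, deriv β y ≤ L

/-- The primitive of `β` vanishing at the origin. -/
noncomputable def primitive (β : ℝ → ℝ) (y : ℝ) : ℝ := ∫ s in (0 : ℝ)..y, β s

namespace IsRamp

variable {β : ℝ → ℝ} {L : ℝ}

lemma monotone (hβ : IsRamp β L) : Monotone β :=
  monotone_of_deriv_nonneg (hβ.contDiff.differentiable (by simp)) hβ.deriv_nonneg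

lemma abs_le_one (hβ : IsRamp β L) (y : ℝ) : |β y| ≤ 1 := by
  rw [abs_of_nonneg (hβ.nonneg y)]
  exact hβ.le_one y

lemma lipschitz_nonneg (hβ : IsRamp β L) : 0 ≤ L := (hβ.deriv_nonneg 0).trans (hβ.deriv_le 0)

lemma abs_sub_le (hβ : IsRamp β L) (x y : ℝ) : |β x - β y| ≤ L * |x - y| := by
  have := Convex.norm_image_sub_le_of_norm_deriv_le (f := β) (s := univ) (x := y) (y := x) (C := L)
    (fun x _ => hβ.contDiff.differentiable (by simp) x) (fun x _ => by
      rw [Real.norm_eq_abs, abs_of_nonneg (hβ.deriv_nonneg x)]; exact hβ.deriv_le x) convex_univ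
      (mem_univ _) (mem_univ _)
  simpa using this

lemma hasDerivAt_primitive (hβ : IsRamp β L) (y : ℝ) : HasDerivAt (primitive β) (β y) y :=
  intervalIntegral.integral_hasDerivAt_right (hβ.contDiff.continuous.intervalIntegrable _ _)
    hβ.contDiff.continuous.aestronglyMeasurable.stronglyMeasurableAtFilter
    hβ.contDiff.continuous.continuousAt

lemma continuous_primitive (hβ : IsRamp β L) : Continuous (primitive β) :=
  continuous_iff_continuousAt.2 fun y => (hβ.hasDerivAt_primitive y).continuousAt

lemma primitive_of_nonpos (hβ : IsRamp β L) {y : ℝ} (hy : y ≤ 0) : primitive β y = 0 := by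
  rw [primitive, intervalIntegral.integral_symm, neg_eq_zero]
  refine intervalIntegral.integral_zero_ae (Eventually.of_forall fun s hs => ?_)
  rw [uIoc_of_le hy] at hs
  exact hβ.eq_zero s hs.2

lemma primitive_nonneg (hβ : IsRamp β L) (y : ℝ) : 0 ≤ primitive β y := by
  rcases le_total y 0 with hy | hy
  · rw [hβ.primitive_of_nonpos hy]
  · exact intervalIntegral.integral_nonneg hy fun s _ => hβ.nonneg s

lemma primitive_le_mul (hβ : IsRamp β L) (y : ℝ) : primitive β y ≤ y * β y := by
  rcases le_total y 0 with hy | hy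
  · rw [hβ.primitive_of_nonpos hy, hβ.eq_zero y hy, mul_zero]
  · have := intervalIntegral.integral_mono_on hy (hβ.contDiff.continuous.intervalIntegrable 0 y)
      ((continuous_const (y := β y)).intervalIntegrable (μ := volume) 0 y)
      (fun s hs => hβ.monotone hs.2)
    simpa [primitive] using this

lemma primitive_le_max (hβ : IsRamp β L) (y : ℝ) : primitive β y ≤ max y 0 := by
  rcases le_total y 0 with hy | hy
  · rw [hβ.primitive_of_nonpos hy]; exact le_max_right _ _
  · exact (hβ.primitive_le_mul y).trans
      ((mul_le_of_le_one_right hy (hβ.le_one y)).trans (le_max_left _ _))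

lemma primitive_sub_le (hβ : IsRamp β L) (x y : ℝ) :
    |primitive β x - primitive β y| ≤ |x - y| := by
  have := Convex.norm_image_sub_le_of_norm_deriv_le (f := primitive β) (s := univ) (x := y)
    (y := x) (C := 1)
    (fun x _ => (hβ.hasDerivAt_primitive x).differentiableAt) (fun x _ => by
      rw [(hβ.hasDerivAt_primitive x).deriv]; exact hβ.abs_le_one x) convex_univ
      (mem_univ _) (mem_univ _)
  simpa using this

end IsRamp

end Ramp

lemma integral_norm_mul_norm_le {α E₁ E₂ : Type*} [MeasurableSpace α] {μ : Measure α}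
    [NormedAddCommGroup E₁] [NormedAddCommGroup E₂] {a : α → E₁} {b : α → E₂} {ε : ℝ}
    (hε : 0 ≤ ε) (ha : MemLp a 2 μ) (hb : AEStronglyMeasurable b μ)
    (hbε : eLpNorm b 2 μ ≤ ENNReal.ofReal ε) :
    Integrable (fun z => ‖a z‖ * ‖b z‖) μ ∧
      ∫ z, ‖a z‖ * ‖b z‖ ∂μ ≤ (eLpNorm a 2 μ).toReal * ε := by
  have hb2 : MemLp b 2 μ := ⟨hb, hbε.trans_lt ENNReal.ofReal_lt_top⟩
  have hi : Integrable (fun z => ‖a z‖ * ‖b z‖) μ := ha.norm.integrable_mul hb2.norm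
  refine ⟨hi, ?_⟩
  have h1 := eLpNorm_smul_le_mul_eLpNorm (p := 2) (q := 2) (r := 1) hb.norm ha.1.norm
  rw [eLpNorm_norm, eLpNorm_norm, eLpNorm_one_eq_lintegral_enorm] at h1
  have h2 : ∫ z, ‖a z‖ * ‖b z‖ ∂μ = (∫⁻ z, ‖‖a z‖ * ‖b z‖‖ₑ ∂μ).toReal := by
    rw [← integral_norm_eq_lintegral_enorm hi.1]
    simp
  rw [h2, ← ENNReal.toReal_ofReal hε, ← ENNReal.toReal_mul]
  refine ENNReal.toReal_mono (ENNReal.mul_ne_top ha.2.ne ENNReal.ofReal_ne_top) ?_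
  exact h1.trans (by gcongr)

lemma integrable_of_support_prod {Ω : Set (Space n)} (hΩb : Bornology.IsBounded Ω) {η : ℝ → ℝ}
    (hη : Continuous η) (hηc : HasCompactSupport η) {g : SpaceTime n → ℝ} (hg : Measurable g)
    {D : ℝ} (hD : ∀ z, |g z| ≤ D) (h0 : ∀ z : SpaceTime n, z.1 ∉ Ω → g z = 0) :
    Integrable (fun z => g z * η z.2) := by
  obtain ⟨D', hD'⟩ := hη.bounded_above_of_compact_support hηc
  have hm : Measurable (fun z : SpaceTime n => g z * η z.2) :=
    hg.mul (hη.measurable.comp measurable_snd)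
  have hfin : volume (closure Ω ×ˢ tsupport η) < ⊤ :=
    (hΩb.isCompact_closure.prod hηc.isCompact).measure_lt_top
  have : IntegrableOn (fun z => g z * η z.2) (closure Ω ×ˢ tsupport η) :=
    Measure.integrableOn_of_bounded (M := D * D') hfin.ne hm.aestronglyMeasurable
      (Eventually.of_forall fun z => by
        rw [norm_mul]
        exact mul_le_mul (hD _) (hD' _) (norm_nonneg _) ((abs_nonneg _).trans (hD 0)))
  refine this.integrable_of_forall_notMem_eq_zero fun z hz => ?_
  rw [mem_prod, not_and_or] at hz
  rcases hz with hz | hz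
  · rw [h0 z fun hmem => hz (subset_closure hmem), zero_mul]
  · rw [image_eq_zero_of_notMem_tsupport hz, mul_zero]

lemma spaceGrad_comp_mul {β η : ℝ → ℝ} (hβ : ContDiff ℝ ∞ β)
    {ψ : SpaceTime n → ℝ} (hψ : ContDiff ℝ ∞ ψ) (z : SpaceTime n) :
    spaceGrad (fun z => β (ψ z) * η z.2) z = (η z.2 * deriv β (ψ z)) • spaceGrad ψ z := by
  have h1 := (hasGradientAt_spaceGrad hψ z).hasFDerivAt
  have h2 : HasDerivAt β (deriv β (ψ z)) (ψ (z.1, z.2)) :=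
    (hβ.differentiable (by simp) _).hasDerivAt
  have h3 := (h2.comp_hasFDerivAt z.1 h1).mul_const (η z.2)
  refine HasGradientAt.gradient (f := fun x => β (ψ (x, z.2)) * η z.2) ?_
  rw [hasGradientAt_iff_hasFDerivAt, map_smul, mul_smul]
  exact h3

namespace IsZeroDataSubsolution

variable {Ω : Set (Space n)} {T M l : ℝ} {w f : SpaceTime n → ℝ} {G : SpaceTime n → Space n}

lemma renormalized_le_add (h : IsZeroDataSubsolution Ω T M w f G) (hΩo : IsOpen Ω)
    (hΩb : Bornology.IsBounded Ω) (hcone : HasInteriorCones Ω) (hl : 0 < l) {β : ℝ → ℝ} {L : ℝ}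
    (hβ : IsRamp β L) {η : ℝ → ℝ} (hη : ContDiff ℝ ∞ η) (hηc : HasCompactSupport η)
    (hη0 : ∀ t, 0 ≤ η t) (hηs : tsupport η ⊆ Ioi 0) {b : ℝ} (hb : ∀ t, b ≤ t → η t = 0) :
    ∃ C, ∀ ε > 0, ∫ z, (l * (expAverage l w z - w z) - expAverage l f z) *
        β (expAverage l w z) * η z.2 ≤
      M * volume.real Ω * (l * Real.exp (-(l * (T - b))) * ∫ t, η t) + C * ε := by
  have := isProbabilityMeasure_expMeasure hl
  obtain ⟨ζ, hζ, hζc, hζs, hζ1⟩ := exists_time_cutoff_eq_one hηc.isCompact hηs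
  set V := expAverage l w with hV
  set Gl := expAverage l G with hGl
  set fl := expAverage l f with hfl
  have hM := h.nonneg
  have hL := hβ.lipschitz_nonneg
  have hVm : Measurable V :=
    (stronglyMeasurable_expAverage hl h.measurable.stronglyMeasurable).measurable
  have hGm : Measurable Gl :=
    (stronglyMeasurable_expAverage hl h.measurable_grad.stronglyMeasurable).measurable
  have hfm : Measurable fl :=
    (stronglyMeasurable_expAverage hl h.measurable_source.stronglyMeasurable).measurable
  have hVM := abs_expAverage_le hl h.abs_le
  have hfM := abs_expAverage_le hl h.abs_source_le
  have hV0 : ∀ z : SpaceTime n, z.1 ∉ Ω → V z = 0 := fun z hz => expAverage_eq_zero h.eq_zero hz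
  have hf0 : ∀ z : SpaceTime n, z.1 ∉ Ω → fl z = 0 := fun z hz =>
    expAverage_eq_zero h.source_eq_zero hz
  have hG0 : ∀ z : SpaceTime n, z.1 ∉ Ω → Gl z = 0 := fun z hz =>
    expAverage_eq_zero h.grad_eq_zero hz
  have hw0 : ∀ z : SpaceTime n, z.1 ∉ Ω → w z = 0 := fun z hz =>
    h.eq_zero z fun hmem => hz hmem.1
  have hGi : Integrable Gl := integrable_average (ν := expMeasure l)
    h.measurable_grad.stronglyMeasurable h.integrable_grad measurable_timeShift
  set S : Set (SpaceTime n) := Ω ×ˢ univ with hS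
  have hSm : MeasurableSet S := hΩo.measurableSet.prod MeasurableSet.univ
  have hcm : Measurable (fun z : SpaceTime n => (l * (V z - w z) - fl z)) := by
    have := h.measurable; fun_prop
  have hcM : ∀ z, |l * (V z - w z) - fl z| ≤ l * (M + M) + M := fun z => by
    refine (abs_sub _ _).trans (add_le_add ?_ (hfM z))
    rw [abs_mul, abs_of_pos hl]
    gcongr
    exact (abs_sub _ _).trans (add_le_add (hVM z) (h.abs_le z))
  set a : SpaceTime n → ℝ := fun z => (l * (M + M) + M) * η z.2 with ha
  have haM : MemLp a 2 (volume.restrict S) := by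
    have hi : Integrable (fun z : SpaceTime n =>
        (l * (M + M) + M) ^ 2 * Ω.indicator 1 z.1 * (η z.2 * η z.2)) := by
      refine integrable_of_support_prod hΩb (η := fun t => η t * η t)
        (hη.continuous.mul hη.continuous) hηc.mul_left
        (D := (l * (M + M) + M) ^ 2) (((measurable_one.indicator hΩo.measurableSet).comp
          measurable_fst).const_mul _) (fun z => ?_) (fun z hz => by simp [hz])
      by_cases hz : z.1 ∈ Ω
      · simp [hz]
      · simp [hz, sq_nonneg]
    have ham : Measurable a := (hη.continuous.measurable.comp measurable_snd).const_mul _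
    refine (memLp_two_iff_integrable_sq ham.aestronglyMeasurable).2
      ((hi.integrableOn (s := S)).congr ?_)
    filter_upwards [ae_restrict_mem hSm] with z hz
    simp only [indicator_of_mem hz.1, ha, Pi.one_apply]
    ring
  have hGM : MemLp (fun z => η z.2 • Gl z) 2 (volume.restrict S) :=
    (h.memLp_mul_expAverage_grad hl hη.continuous hηc hηs).restrict S
  refine ⟨L * ((eLpNorm a 2 (volume.restrict S)).toReal +
    (eLpNorm (fun z => η z.2 • Gl z) 2 (volume.restrict S)).toReal), fun ε hε => ?_⟩
  obtain ⟨ψ, hψ, hψc, hψ1, hψ2⟩ := h.exists_smooth_approx hΩo hΩb hcone hl hζ hζc hζs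
    (ENNReal.ofReal_pos.2 hε)
  have hψg : AEStronglyMeasurable (fun z => spaceGrad ψ z - ζ z.2 • Gl z) (volume.restrict S) :=
    ((continuous_spaceGrad hψ).measurable.sub
      ((hζ.continuous.measurable.comp measurable_snd).smul hGm)).aestronglyMeasurable
  have hψv : AEStronglyMeasurable (fun z => ψ z - ζ z.2 * V z) (volume.restrict S) :=
    (hψ.continuous.measurable.sub
      ((hζ.continuous.measurable.comp measurable_snd).mul hVm)).aestronglyMeasurable
  obtain ⟨e1, e1'⟩ := integral_norm_mul_norm_le hε.le haM hψv hψ1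
  obtain ⟨e2, e2'⟩ : Integrable (fun z => ‖η z.2 • Gl z‖ * ‖spaceGrad ψ z - ζ z.2 • Gl z‖)
      (volume.restrict S) ∧ ∫ z in S, ‖η z.2 • Gl z‖ * ‖spaceGrad ψ z - ζ z.2 • Gl z‖ ≤
        (eLpNorm (fun z => η z.2 • Gl z) 2 (volume.restrict S)).toReal * ε := by
    rcases hψ2 with hG | hG
    · have : ∀ z, Gl z = 0 := fun z => by simp [hGl, expAverage, hG]
      simp [this]
    · exact integral_norm_mul_norm_le hε.le hGM hψg hG
  set φ : SpaceTime n → ℝ := fun z => β (ψ z) * η z.2 with hφdef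
  have hφ : ContDiff ℝ ∞ φ := (hβ.contDiff.comp hψ).mul (hη.comp contDiff_snd)
  have hφc : HasCompactSupport φ := (hψc.comp_left (g := β) (hβ.eq_zero 0 le_rfl)).mul_right
  have hav := h.averaged_weak_le_of_le hΩo hΩb hl hφ hφc
    (fun z => mul_nonneg (hβ.nonneg _) (hη0 _)) hη.continuous hηc
    (fun z => mul_le_of_le_one_left (hη0 _) (hβ.le_one _)) hb
  have i1 : Integrable (fun z => l * (V z - w z) * φ z) := by
    have hm := h.measurable
    refine integrable_mul_of_compact (M := l * (M + M)) (by fun_prop) (fun z => ?_)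
      hφ.continuous hφc
    rw [abs_mul, abs_of_pos hl]
    gcongr
    exact (abs_sub _ _).trans (add_le_add (hVM z) (h.abs_le z))
  have i2 := integrable_inner_of_compact hGi (continuous_spaceGrad hφ)
    (hasCompactSupport_spaceGrad hφ hφc)
  have i3 := integrable_mul_of_compact hfm hfM hφ.continuous hφc
  have hg2 : Integrable (fun z => l * (V z - w z) * φ z + inner ℝ (Gl z) (spaceGrad φ z) -
      fl z * φ z) := (i1.add i2).sub i3
  have hg1 : Integrable (fun z => (l * (V z - w z) - fl z) * β (V z) * η z.2) := by
    refine integrable_of_support_prod hΩb hη.continuous hηc (D := l * (M + M) + M)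
      (hcm.mul (hβ.contDiff.continuous.measurable.comp hVm)) (fun z => ?_) (fun z hz => ?_)
    · rw [abs_mul]
      exact (mul_le_of_le_one_right (abs_nonneg _) (hβ.abs_le_one _)).trans (hcM z)
    · rw [hV0 z hz, hβ.eq_zero 0 le_rfl, mul_zero]
  have hpt : ∀ z ∈ S, (l * (V z - w z) - fl z) * β (V z) * η z.2 ≤
      (l * (V z - w z) * φ z + inner ℝ (Gl z) (spaceGrad φ z) - fl z * φ z) +
      L * (‖a z‖ * ‖ψ z - ζ z.2 * V z‖ +
        ‖η z.2 • Gl z‖ * ‖spaceGrad ψ z - ζ z.2 • Gl z‖) := by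
    intro z _
    by_cases hz : z.2 ∈ tsupport η
    · have hζz := hζ1 _ hz
      rw [spaceGrad_comp_mul hβ.contDiff hψ, hζz, one_mul, one_smul]
      have t1 : (l * (V z - w z) - fl z) * (β (V z) - β (ψ z)) * η z.2 ≤
          L * (‖a z‖ * ‖ψ z - V z‖) := by
        refine (le_abs_self _).trans ?_
        rw [abs_mul, abs_mul, ha, norm_mul, Real.norm_eq_abs, Real.norm_eq_abs, Real.norm_eq_abs,
          abs_of_nonneg (a := l * (M + M) + M) (by positivity), abs_sub_comm (ψ z)]
        calc _ ≤ (l * (M + M) + M) * (L * |V z - ψ z|) * |η z.2| := by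
              gcongr
              · exact hcM z
              · exact hβ.abs_sub_le _ _
          _ = _ := by ring
      have t2 : -(L * (‖η z.2 • Gl z‖ * ‖spaceGrad ψ z - Gl z‖)) ≤
          inner ℝ (Gl z) ((η z.2 * deriv β (ψ z)) • spaceGrad ψ z) := by
        have s1 : inner ℝ (Gl z) ((η z.2 * deriv β (ψ z)) • spaceGrad ψ z) =
            deriv β (ψ z) * inner ℝ (η z.2 • Gl z) (spaceGrad ψ z - Gl z) +
              η z.2 * deriv β (ψ z) * inner ℝ (Gl z) (Gl z) := by
          rw [inner_sub_right, real_inner_smul_left, real_inner_smul_left, real_inner_smul_right]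
          ring
        have s2 : 0 ≤ η z.2 * deriv β (ψ z) * inner ℝ (Gl z) (Gl z) :=
          mul_nonneg (mul_nonneg (hη0 _) (hβ.deriv_nonneg _)) real_inner_self_nonneg
        have s3 := abs_real_inner_le_norm (η z.2 • Gl z) (spaceGrad ψ z - Gl z)
        have s4 : |deriv β (ψ z) * inner ℝ (η z.2 • Gl z) (spaceGrad ψ z - Gl z)| ≤
            L * (‖η z.2 • Gl z‖ * ‖spaceGrad ψ z - Gl z‖) := by
          rw [abs_mul, abs_of_nonneg (hβ.deriv_nonneg _)]
          exact mul_le_mul (hβ.deriv_le _) s3 (abs_nonneg _) hL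
        have s5 := neg_abs_le (deriv β (ψ z) * inner ℝ (η z.2 • Gl z) (spaceGrad ψ z - Gl z))
        linarith
      simp only [hφdef]
      linarith
    · have hz0 := image_eq_zero_of_notMem_tsupport hz
      simp [spaceGrad_comp_mul hβ.contDiff hψ, hz0, hφdef, ha]
  have hS1 : ∫ z, (l * (V z - w z) - fl z) * β (V z) * η z.2 =
      ∫ z in S, (l * (V z - w z) - fl z) * β (V z) * η z.2 := by
    refine (setIntegral_eq_integral_of_forall_compl_eq_zero fun z hz => ?_).symm
    have hz' : z.1 ∉ Ω := fun hm => hz ⟨hm, mem_univ _⟩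
    rw [hV0 z hz', hβ.eq_zero 0 le_rfl, mul_zero, zero_mul]
  have hS2 : ∫ z, (l * (V z - w z) * φ z + inner ℝ (Gl z) (spaceGrad φ z) - fl z * φ z) =
      ∫ z in S, (l * (V z - w z) * φ z + inner ℝ (Gl z) (spaceGrad φ z) - fl z * φ z) := by
    refine (setIntegral_eq_integral_of_forall_compl_eq_zero fun z hz => ?_).symm
    have hz' : z.1 ∉ Ω := fun hm => hz ⟨hm, mem_univ _⟩
    simp [hV0 z hz', hw0 z hz', hG0 z hz', hf0 z hz']
  rw [hS1]
  calc _ ≤ _ := setIntegral_mono_on hg1.integrableOn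
        (hg2.integrableOn.add ((e1.add e2).const_mul L)) hSm hpt
    _ = (∫ z in S, (l * (V z - w z) * φ z + inner ℝ (Gl z) (spaceGrad φ z) - fl z * φ z)) +
        L * ((∫ z in S, ‖a z‖ * ‖ψ z - ζ z.2 * V z‖) +
          ∫ z in S, ‖η z.2 • Gl z‖ * ‖spaceGrad ψ z - ζ z.2 • Gl z‖) := by
        rw [← integral_add e1 e2, ← integral_const_mul]
        exact integral_add hg2.integrableOn ((e1.add e2).const_mul L)
    _ ≤ _ := by
        rw [← hS2, mul_assoc L, add_mul]
        gcongr

lemma renormalized_le (h : IsZeroDataSubsolution Ω T M w f G) (hΩo : IsOpen Ω)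
    (hΩb : Bornology.IsBounded Ω) (hcone : HasInteriorCones Ω) (hl : 0 < l) {β : ℝ → ℝ} {L : ℝ}
    (hβ : IsRamp β L) {η : ℝ → ℝ} (hη : ContDiff ℝ ∞ η) (hηc : HasCompactSupport η)
    (hη0 : ∀ t, 0 ≤ η t) (hηs : tsupport η ⊆ Ioi 0) {b : ℝ} (hb : ∀ t, b ≤ t → η t = 0) :
    ∫ z, (l * (expAverage l w z - w z) - expAverage l f z) * β (expAverage l w z) * η z.2 ≤
      M * volume.real Ω * (l * Real.exp (-(l * (T - b))) * ∫ t, η t) := by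
  obtain ⟨C, hC⟩ := h.renormalized_le_add hΩo hΩb hcone hl hβ hη hηc hη0 hηs hb
  have ht : Tendsto (fun ε : ℝ => M * volume.real Ω * (l * Real.exp (-(l * (T - b))) * ∫ t, η t) +
      C * ε) (𝓝[>] 0) (𝓝 (M * volume.real Ω * (l * Real.exp (-(l * (T - b))) * ∫ t, η t) +
      C * 0)) := (tendsto_const_nhds.add (tendsto_id.const_mul C)).mono_left nhdsWithin_le_nhds
  rw [mul_zero, add_zero] at ht
  exact ge_of_tendsto ht (eventually_mem_nhdsWithin.mono fun ε hε => hC ε hε)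

end IsZeroDataSubsolution

section InitialBump

/-- A smooth compactly supported function equal to `1` for `|t| ≤ h` and to `0` for `|t| ≥ 2h`. -/
noncomputable def initialStep (h t : ℝ) : ℝ :=
  Real.smoothTransition (2 - t / h) * Real.smoothTransition (2 + t / h)

/-- A smooth probability density supported in `[h, 2h]`, minus the derivative of `initialStep h`
for positive times. -/
noncomputable def initialBump (h t : ℝ) : ℝ := deriv Real.smoothTransition (2 - t / h) / h

lemma contDiff_smoothTransition : ContDiff ℝ ∞ Real.smoothTransition :=
  Real.smoothTransition.contDiff

lemma contDiff_initialStep (h : ℝ) : ContDiff ℝ ∞ (initialStep h) :=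
  (contDiff_smoothTransition.comp (by fun_prop)).mul (contDiff_smoothTransition.comp (by fun_prop))

lemma contDiff_initialBump (h : ℝ) : ContDiff ℝ ∞ (initialBump h) :=
  (contDiff_smoothTransition.deriv'.comp
    (contDiff_const.sub (contDiff_id.div_const h))).div_const h

lemma initialStep_nonneg (h t : ℝ) : 0 ≤ initialStep h t :=
  mul_nonneg (Real.smoothTransition.nonneg _) (Real.smoothTransition.nonneg _)

lemma initialStep_le_one (h t : ℝ) : initialStep h t ≤ 1 :=
  mul_le_one₀ (Real.smoothTransition.le_one _) (Real.smoothTransition.nonneg _)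
    (Real.smoothTransition.le_one _)

lemma deriv_smoothTransition_nonneg (y : ℝ) : 0 ≤ deriv Real.smoothTransition y :=
  Real.smoothTransition.monotone.deriv_nonneg

lemma deriv_smoothTransition_eq_zero {y : ℝ} (hy : y ∉ Icc (0 : ℝ) 1) :
    deriv Real.smoothTransition y = 0 := by
  rw [mem_Icc, not_and_or, not_le, not_le] at hy
  rcases hy with hy | hy
  · have : Real.smoothTransition =ᶠ[𝓝 y] fun _ => 0 := by
      filter_upwards [gt_mem_nhds hy] with x hx
      exact Real.smoothTransition.zero_of_nonpos hx.le
    rw [this.deriv_eq, deriv_const]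
  · have : Real.smoothTransition =ᶠ[𝓝 y] fun _ => 1 := by
      filter_upwards [lt_mem_nhds hy] with x hx
      exact Real.smoothTransition.one_of_one_le hx.le
    rw [this.deriv_eq, deriv_const]

variable {h : ℝ}

lemma initialStep_eq_zero (hh : 0 < h) {t : ℝ} (ht : 2 * h ≤ |t|) : initialStep h t = 0 := by
  rcases le_abs.1 ht with ht | ht
  · refine mul_eq_zero_of_left (Real.smoothTransition.zero_of_nonpos ?_) _
    rw [sub_nonpos, le_div_iff₀ hh]; exact ht
  · refine mul_eq_zero_of_right _ (Real.smoothTransition.zero_of_nonpos ?_)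
    have : t / h ≤ -2 := by rw [div_le_iff₀ hh]; linarith
    linarith

lemma hasCompactSupport_initialStep (hh : 0 < h) : HasCompactSupport (initialStep h) := by
  refine HasCompactSupport.intro (isCompact_Icc (a := -(2 * h)) (b := 2 * h)) fun t ht => ?_
  refine initialStep_eq_zero hh ?_
  by_contra hcon
  rw [not_le, abs_lt] at hcon
  exact ht ⟨hcon.1.le, hcon.2.le⟩

lemma initialBump_nonneg (hh : 0 < h) (t : ℝ) : 0 ≤ initialBump h t :=
  div_nonneg (deriv_smoothTransition_nonneg _) hh.le

lemma initialBump_eq_zero (hh : 0 < h) {t : ℝ} (ht : t ∉ Icc h (2 * h)) : initialBump h t = 0 := by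
  rw [initialBump, deriv_smoothTransition_eq_zero, zero_div]
  rintro ⟨h1, h2⟩
  refine ht ⟨?_, ?_⟩
  · have : 1 ≤ t / h := by linarith
    rwa [le_div_iff₀ hh, one_mul] at this
  · have : t / h ≤ 2 := by linarith
    rwa [div_le_iff₀ hh] at this

lemma hasCompactSupport_initialBump (hh : 0 < h) : HasCompactSupport (initialBump h) :=
  HasCompactSupport.intro isCompact_Icc fun _ ht => initialBump_eq_zero hh ht

lemma tsupport_initialBump_subset (hh : 0 < h) : tsupport (initialBump h) ⊆ Icc h (2 * h) :=
  closure_minimal (fun _ ht => by_contra fun hcon => ht (initialBump_eq_zero hh hcon)) isClosed_Icc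

lemma hasDerivAt_initialStep (hh : 0 < h) {t : ℝ} (ht : 0 < t) :
    HasDerivAt (initialStep h) (-initialBump h t) t := by
  have h1 : HasDerivAt (fun t => Real.smoothTransition (2 - t / h))
      (deriv Real.smoothTransition (2 - t / h) * (-(1 / h))) t := by
    refine HasDerivAt.comp t (contDiff_smoothTransition.differentiable (by simp) _).hasDerivAt ?_
    exact ((hasDerivAt_id t).div_const h).const_sub 2
  have h2 : initialStep h =ᶠ[𝓝 t] fun t => Real.smoothTransition (2 - t / h) := by
    filter_upwards [lt_mem_nhds ht] with s hs
    have : 0 ≤ s / h := by positivity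
    rw [initialStep, Real.smoothTransition.one_of_one_le (x := 2 + s / h) (by linarith), mul_one]
  refine (h1.congr_of_eventuallyEq h2).congr_deriv ?_
  rw [initialBump]; ring

lemma integral_initialBump (hh : 0 < h) : ∫ t, initialBump h t = 1 := by
  have h1 : ∫ t, initialBump h t = ∫ t in h..2 * h, initialBump h t := by
    rw [intervalIntegral.integral_of_le (by linarith), ← integral_Icc_eq_integral_Ioc]
    exact (setIntegral_eq_integral_of_forall_compl_eq_zero fun t ht => initialBump_eq_zero hh ht).symm
  rw [h1]
  have h2 := intervalIntegral.integral_eq_sub_of_hasDerivAt (f := fun t => -initialStep h t)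
    (f' := initialBump h) (a := h) (b := 2 * h) (fun t ht => by
      rw [uIcc_of_le (by linarith)] at ht
      exact (hasDerivAt_initialStep hh (hh.trans_le ht.1)).neg.congr_deriv (neg_neg _))
    ((contDiff_initialBump h).continuous.intervalIntegrable _ _)
  rw [h2, initialStep_eq_zero hh (le_abs_self _), initialStep, div_self hh.ne',
    Real.smoothTransition.one_of_one_le (by norm_num),
    Real.smoothTransition.one_of_one_le (by norm_num)]
  norm_num

end InitialBump

lemma integral_mul_initialBump {h : ℝ} (hh : 0 < h) (g : Space n → ℝ) :
    ∫ z : SpaceTime n, g z.1 * initialBump h z.2 = ∫ x, g x := by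
  rw [Measure.volume_eq_prod, integral_prod_mul, integral_initialBump hh, mul_one]

lemma integrable_of_bounded_of_support {Ω : Set (Space n)} (hΩb : Bornology.IsBounded Ω)
    {g : Space n → ℝ} (hg : Measurable g) {D : ℝ} (hD : ∀ x, |g x| ≤ D)
    (h0 : ∀ x ∉ Ω, g x = 0) : Integrable g := by
  have : IntegrableOn g Ω := Measure.integrableOn_of_bounded (M := D) hΩb.measure_lt_top.ne
    hg.aestronglyMeasurable (Eventually.of_forall hD)
  exact this.integrable_of_forall_notMem_eq_zero h0

lemma timeDeriv_mul_comp_snd {ψ : Space n → ℝ} {η : ℝ → ℝ} {d : ℝ} {z : SpaceTime n}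
    (hη : HasDerivAt η d z.2) : timeDeriv (fun z : SpaceTime n => ψ z.1 * η z.2) z = ψ z.1 * d :=
  (hη.const_mul (ψ z.1)).deriv

namespace IsZeroDataSubsolution

variable {Ω : Set (Space n)} {T M l : ℝ} {w f : SpaceTime n → ℝ} {G : SpaceTime n → Space n}

lemma exists_initial_bound (h : IsZeroDataSubsolution Ω T M w f G) (hΩo : IsOpen Ω)
    (hΩb : Bornology.IsBounded Ω) (hT : 0 < T) {ψ : Space n → ℝ} (hψ : ContDiff ℝ ∞ ψ)
    (hψc : HasCompactSupport ψ) (hψ0 : ∀ x, 0 ≤ ψ x) :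
    ∃ r : ℝ → ℝ, Tendsto r (𝓝[>] 0) (𝓝 0) ∧
      ∀ s, 0 < s → 2 * s < T → ∫ z, w z * ψ z.1 * initialBump s z.2 ≤ r s := by
  have hM := h.nonneg
  have hQm : MeasurableSet (spaceTimeCylinder Ω T) := hΩo.measurableSet.prod measurableSet_Ioo
  have hφ : ContDiff ℝ ∞ (fun z : SpaceTime n => ψ z.1) := hψ.comp contDiff_fst
  obtain ⟨D₁, hD₁⟩ := hψ.continuous.bounded_above_of_compact_support hψc
  have hφ1 : ContDiff ℝ ∞ (fun z : SpaceTime n => ψ z.1 * initialStep 1 z.2) :=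
    hφ.mul ((contDiff_initialStep 1).comp contDiff_snd)
  have hgr : ∀ (s : ℝ) (z : SpaceTime n), spaceGrad (fun z => ψ z.1 * initialStep s z.2) z =
      initialStep s z.2 • spaceGrad (fun z => ψ z.1) z := fun s z => by
    have := spaceGrad_mul hφ (ψ := fun z : SpaceTime n => initialStep s z.2)
      ((contDiff_initialStep s).comp contDiff_snd) z
    rw [this, spaceGrad_comp_snd, smul_zero, zero_add]
  obtain ⟨D₂, hD₂⟩ : ∃ D₂, ∀ z : SpaceTime n, ‖spaceGrad (fun z => ψ z.1) z‖ ≤ D₂ := by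
    have hc1 : HasCompactSupport (fun z : SpaceTime n => ψ z.1 * initialStep 1 z.2) := by
      refine HasCompactSupport.intro
        (hψc.isCompact.prod (hasCompactSupport_initialStep one_pos).isCompact) fun z hz => ?_
      rw [mem_prod, not_and_or] at hz
      rcases hz with hz | hz
      · rw [image_eq_zero_of_notMem_tsupport hz, zero_mul]
      · rw [image_eq_zero_of_notMem_tsupport hz, mul_zero]
    obtain ⟨D, -, hD⟩ := exists_norm_le_of_compact (continuous_spaceGrad hφ1)
      (hasCompactSupport_spaceGrad hφ1 hc1)
    refine ⟨D, fun z => ?_⟩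
    have := hD (z.1, 0)
    rw [hgr] at this
    simpa [initialStep, Real.smoothTransition.one_of_one_le, spaceGrad] using this
  set g : SpaceTime n → ℝ := fun z => D₂ * ‖G z‖ + M * D₁ *
    (spaceTimeCylinder Ω T).indicator (fun _ => 1) z with hg
  have hgi : Integrable g := by
    refine (h.integrable_grad.norm.const_mul D₂).add (Integrable.const_mul ?_ _)
    exact (integrable_indicator_iff hQm).2
      (integrableOn_const (hΩb.prod (Metric.isBounded_Ioo 0 T)).measure_lt_top.ne)
  have hD₁0 : 0 ≤ D₁ := (norm_nonneg _).trans (hD₁ 0)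
  have hD₂0 : 0 ≤ D₂ := (norm_nonneg _).trans (hD₂ 0)
  have hg0 : ∀ z, 0 ≤ g z := fun z => by
    have : 0 ≤ (spaceTimeCylinder Ω T).indicator (fun _ => (1 : ℝ)) z :=
      indicator_nonneg (fun _ _ => zero_le_one) _
    positivity
  have hgz : ∀ z : SpaceTime n, z.2 ≤ 0 → g z = 0 := fun z hz => by
    have : z ∉ spaceTimeCylinder Ω T := fun hm => hm.2.1.not_ge hz
    simp [hg, h.grad_eq_zero z this, this]
  have hms : ∀ s : ℝ, MeasurableSet {z : SpaceTime n | z.2 < 2 * s} := fun s =>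
    measurableSet_lt measurable_snd measurable_const
  refine ⟨fun s => ∫ z, {z : SpaceTime n | z.2 < 2 * s}.indicator g z, ?_, fun s hs hsT => ?_⟩
  · have := tendsto_integral_filter_of_dominated_convergence (μ := volume) (l := 𝓝[>] (0 : ℝ))
      (F := fun s z => {z : SpaceTime n | z.2 < 2 * s}.indicator g z) (f := fun _ => 0) g
      (Eventually.of_forall fun s => (hgi.indicator (hms s)).1)
      (Eventually.of_forall fun s => Eventually.of_forall fun z => ?_) hgi
      (Eventually.of_forall fun z => ?_)
    · simpa using this
    · rw [norm_indicator_eq_indicator_norm]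
      refine (indicator_le_self' (fun _ _ => norm_nonneg _) z).trans ?_
      rw [Real.norm_eq_abs, abs_of_nonneg (hg0 z)]
    · rcases le_or_gt z.2 0 with hz | hz
      · have : ∀ s : ℝ, {z : SpaceTime n | z.2 < 2 * s}.indicator g z = 0 := fun s => by
          by_cases hm : z ∈ {z : SpaceTime n | z.2 < 2 * s}
          · rw [indicator_of_mem hm, hgz z hz]
          · rw [indicator_of_notMem hm]
        simp [this]
      · refine tendsto_const_nhds.congr' ?_
        have : ∀ᶠ s : ℝ in 𝓝[>] 0, s < z.2 / 2 :=
          mem_nhdsWithin_of_mem_nhds (gt_mem_nhds (by positivity))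
        filter_upwards [this] with s hs
        rw [indicator_of_notMem]
        rw [mem_ofPred_eq]; linarith
  · set φ : SpaceTime n → ℝ := fun z => ψ z.1 * initialStep s z.2 with hφd
    have hφs : ContDiff ℝ ∞ φ := hφ.mul ((contDiff_initialStep s).comp contDiff_snd)
    have hφc : HasCompactSupport φ := by
      refine HasCompactSupport.intro
        (hψc.isCompact.prod (hasCompactSupport_initialStep hs).isCompact) fun z hz => ?_
      rw [mem_prod, not_and_or] at hz
      rcases hz with hz | hz
      · rw [hφd]; simp [image_eq_zero_of_notMem_tsupport hz]
      · rw [hφd]; simp [image_eq_zero_of_notMem_tsupport hz]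
    have hwk := h.weak_le φ hφs hφc fun z => mul_nonneg (hψ0 _) (initialStep_nonneg _ _)
    have hfin : ∀ x : Space n, φ (x, T) = 0 := fun x => by
      simp only [hφd]
      rw [initialStep_eq_zero hs (by rw [abs_of_pos hT]; exact hsT.le), mul_zero]
    simp only [hfin, integral_zero, mul_zero] at hwk
    have i1 : Integrable (fun z => -(w z * timeDeriv φ z)) :=
      (integrable_mul_of_compact h.measurable h.abs_le (continuous_timeDeriv hφs)
      (hasCompactSupport_timeDeriv hφs hφc)).neg
    have i2 := integrable_inner_of_compact h.integrable_grad (continuous_spaceGrad hφs)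
      (hasCompactSupport_spaceGrad hφs hφc)
    have i3 := integrable_mul_of_compact h.measurable_source h.abs_source_le hφs.continuous hφc
    have i4 := hgi.indicator (hms s)
    have hi := (i1.add i2).sub i3
    have i5 : Integrable (fun z => w z * ψ z.1 * initialBump s z.2) := by
      refine integrable_of_support_prod hΩb (contDiff_initialBump s).continuous
        (hasCompactSupport_initialBump hs) (D := M * D₁)
        (h.measurable.mul (hψ.continuous.measurable.comp measurable_fst)) (fun z => ?_)
        (fun z hz => ?_)
      · rw [abs_mul]
        exact mul_le_mul (h.abs_le z) (hD₁ _) (abs_nonneg _) hM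
      · rw [h.eq_zero z fun hm => hz hm.1, zero_mul]
    have hle := integral_mono i5 (hi.add i4) fun z => ?_
    · have heq := integral_add hi i4
      have : ∫ z, ((fun z => -(w z * timeDeriv φ z)) + (fun z => inner ℝ (G z) (spaceGrad φ z)) -
        fun z => f z * φ z) z = ∫ z, (-(w z * timeDeriv φ z) + inner ℝ (G z) (spaceGrad φ z) -
        f z * φ z) := rfl
      have h3 := hle.trans_eq heq
      rw [this] at h3
      linarith
    · simp only [Pi.add_apply, Pi.sub_apply]
      by_cases hz : z ∈ spaceTimeCylinder Ω T
      · have htd : timeDeriv φ z = ψ z.1 * (-initialBump s z.2) :=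
          timeDeriv_mul_comp_snd (hasDerivAt_initialStep hs hz.2.1)
        have hz1 : -(w z * timeDeriv φ z) = w z * ψ z.1 * initialBump s z.2 := by
          rw [htd]; ring
        rw [hz1, hgr]
        by_cases hz2 : z ∈ {z : SpaceTime n | z.2 < 2 * s}
        · rw [indicator_of_mem hz2]
          have h1 : |inner ℝ (G z) (initialStep s z.2 • spaceGrad (fun z => ψ z.1) z)| ≤
              D₂ * ‖G z‖ := by
            refine (abs_real_inner_le_norm _ _).trans ?_
            rw [mul_comm, norm_smul]
            gcongr
            rw [Real.norm_eq_abs, abs_of_nonneg (initialStep_nonneg _ _)]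
            exact (mul_le_of_le_one_left (norm_nonneg _) (initialStep_le_one _ _)).trans (hD₂ z)
          have h2 : |f z * φ z| ≤ M * D₁ := by
            rw [abs_mul]
            refine mul_le_mul (h.abs_source_le z) ?_ (abs_nonneg _) hM
            rw [hφd, abs_mul, abs_of_nonneg (initialStep_nonneg _ _)]
            exact (mul_le_of_le_one_right (abs_nonneg _) (initialStep_le_one _ _)).trans (hD₁ _)
          have h3 := neg_abs_le (inner ℝ (G z) (initialStep s z.2 • spaceGrad (fun z => ψ z.1) z))
          have h4 := le_abs_self (f z * φ z)
          have h5 : g z = D₂ * ‖G z‖ + M * D₁ := by simp [hg, hz]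
          linarith
        · have h0 : initialStep s z.2 = 0 := by
            rw [mem_ofPred_eq, not_lt] at hz2
            exact initialStep_eq_zero hs (hz2.trans (le_abs_self _))
          rw [indicator_of_notMem hz2]
          simp [hφd, h0]
      · rw [h.eq_zero z hz, h.source_eq_zero z hz, h.grad_eq_zero z hz]
        have : 0 ≤ {z : SpaceTime n | z.2 < 2 * s}.indicator g z :=
          indicator_nonneg (fun _ _ => hg0 _) _
        simpa using this

end IsZeroDataSubsolution

namespace IsZeroDataSubsolution

variable {Ω : Set (Space n)} {T M l : ℝ} {w f : SpaceTime n → ℝ} {G : SpaceTime n → Space n}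

lemma integral_primitive_initial_le_add (h : IsZeroDataSubsolution Ω T M w f G) (hΩo : IsOpen Ω)
    (hΩb : Bornology.IsBounded Ω) (hcone : HasInteriorCones Ω) (hT : 0 < T) (hl : 0 < l)
    {β : ℝ → ℝ} {L : ℝ} (hβ : IsRamp β L) {ε : ℝ} (hε : 0 < ε) :
    ∫ x, primitive β (expAverage l w (x, 0)) ≤
      M * volume.real Ω * (l⁻¹ + Real.exp (-(l * T))) + M * L * ε := by
  have := isProbabilityMeasure_expMeasure hl
  set V := expAverage l w with hV
  set fl := expAverage l f with hfl
  have hM := h.nonneg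
  have hL := hβ.lipschitz_nonneg
  have hVm : Measurable V :=
    (stronglyMeasurable_expAverage hl h.measurable.stronglyMeasurable).measurable
  have hfm : Measurable fl :=
    (stronglyMeasurable_expAverage hl h.measurable_source.stronglyMeasurable).measurable
  have hVM := abs_expAverage_le hl h.abs_le
  have hfM := abs_expAverage_le hl h.abs_source_le
  have hV0 : ∀ z : SpaceTime n, z.1 ∉ Ω → V z = 0 := fun z hz => expAverage_eq_zero h.eq_zero hz
  have hf0 : ∀ z : SpaceTime n, z.1 ∉ Ω → fl z = 0 := fun z hz =>
    expAverage_eq_zero h.source_eq_zero hz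
  have hw0 : ∀ z : SpaceTime n, z.1 ∉ Ω → w z = 0 := fun z hz =>
    h.eq_zero z fun hmem => hz hmem.1
  have hβm : Measurable β := hβ.contDiff.continuous.measurable
  have hBm : Measurable (primitive β) := hβ.continuous_primitive.measurable
  set V₀ : Space n → ℝ := fun x => V (x, 0) with hV₀
  have hV₀m : Measurable V₀ := hVm.comp (by fun_prop)
  have hV₀i : Integrable V₀ := integrable_of_bounded_of_support hΩb hV₀m (fun x => hVM (x, 0))
    fun x hx => hV0 (x, 0) hx
  have hBi : Integrable (fun x => primitive β (V₀ x)) := by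
    refine integrable_of_bounded_of_support hΩb (hBm.comp hV₀m) (D := M) (fun x => ?_)
      fun x hx => ?_
    · rw [abs_of_nonneg (hβ.primitive_nonneg _)]
      exact (hβ.primitive_le_max _).trans (max_le ((le_abs_self _).trans (hVM (x, 0))) hM)
    · rw [hV₀]; simp only; rw [hV0 (x, 0) hx, hβ.primitive_of_nonpos le_rfl]
  have h1i : Integrable (Ω.indicator (fun _ => (1 : ℝ))) :=
    (integrable_indicator_iff hΩo.measurableSet).2 (integrableOn_const hΩb.measure_lt_top.ne)
  have h1v : ∫ x, Ω.indicator (fun _ => (1 : ℝ)) x = volume.real Ω := by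
    rw [integral_indicator hΩo.measurableSet, setIntegral_const, smul_eq_mul, mul_one]
  obtain ⟨ψ₀, hψ₀c, hψ₀, hψε⟩ := (memLp_one_iff_integrable.2 hV₀i).exist_eLpNorm_sub_le
    ENNReal.one_ne_top le_rfl hε
  have hψ₀i : Integrable ψ₀ := hψ₀.continuous.integrable_of_hasCompactSupport hψ₀c
  have hdi : Integrable (fun x => |V₀ x - ψ₀ x|) := (hV₀i.sub hψ₀i).abs
  have hdε : ∫ x, |V₀ x - ψ₀ x| ≤ ε := by
    have := integral_norm_eq_lintegral_enorm (hV₀i.sub hψ₀i).1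
    simp only [Pi.sub_apply, Real.norm_eq_abs] at this
    rw [this]
    rw [eLpNorm_one_eq_lintegral_enorm] at hψε
    exact ENNReal.toReal_le_of_le_ofReal hε.le hψε
  set ψ : Space n → ℝ := fun x => β (ψ₀ x) with hψd
  have hψ : ContDiff ℝ ∞ ψ := hβ.contDiff.comp hψ₀
  have hψc : HasCompactSupport ψ := hψ₀c.comp_left (g := β) (hβ.eq_zero 0 le_rfl)
  obtain ⟨r, hr, hrle⟩ := h.exists_initial_bound hΩo hΩb hT hψ hψc fun x => hβ.nonneg _
  have hcm : Measurable (fun z : SpaceTime n => (l * (V z - w z) - fl z)) := by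
    have := h.measurable; fun_prop
  have hcM : ∀ z, |l * (V z - w z) - fl z| ≤ l * (M + M) + M := fun z => by
    refine (abs_sub _ _).trans (add_le_add ?_ (hfM z))
    rw [abs_mul, abs_of_pos hl]
    gcongr
    exact (abs_sub _ _).trans (add_le_add (hVM z) (h.abs_le z))
  have hVlip : ∀ x t, 0 ≤ t → |V (x, t) - V (x, 0)| ≤ 2 * l * M * t := fun x t ht => by
    rw [hV, expAverage_eq_timeAverage, expAverage_eq_timeAverage]
    have := abs_timeAverage_sub_le (h := fun s => w (x, s)) hl
      (h.measurable.comp measurable_prodMk_left) (fun t => h.abs_le (x, t)) 0 t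
    rwa [sub_zero, abs_of_nonneg ht] at this
  set κ := (1 + M * L) * (4 * l * M) with hκ
  have hs : ∀ s, 0 < s → 2 * s < T → ∫ x, primitive β (V₀ x) ≤
      l⁻¹ * (M * volume.real Ω * (l * Real.exp (-(l * (T - 2 * s))))) + r s +
        (κ * s + M / l) * volume.real Ω + M * L * ε := by
    intro s hs hsT
    have hp := contDiff_initialBump s
    have hpc := hasCompactSupport_initialBump hs
    have hp0 := initialBump_nonneg hs
    have hp1 := integral_initialBump hs
    have hpi : Integrable (initialBump s) := hp.continuous.integrable_of_hasCompactSupport hpc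
    have a1 := h.renormalized_le hΩo hΩb hcone hl hβ hp hpc hp0
      ((tsupport_initialBump_subset hs).trans fun t ht => hs.trans_le ht.1) (b := 2 * s)
      (fun t ht => by
        rcases ht.eq_or_lt with ht | ht
        · subst ht
          rw [initialBump, mul_div_cancel_right₀ _ hs.ne', sub_self]
          have : deriv Real.smoothTransition 0 = 0 := by
            refine IsLocalMin.deriv_eq_zero (Eventually.of_forall fun x => ?_)
            rw [Real.smoothTransition.zero]
            exact Real.smoothTransition.nonneg x
          rw [this, zero_div]
        · exact initialBump_eq_zero hs fun hm => ht.not_ge hm.2)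
    rw [hp1, mul_one] at a1
    have a2 := hrle s hs hsT
    have i1 : Integrable (fun z => (l * (V z - w z) - fl z) * β (V z) * initialBump s z.2) := by
      refine integrable_of_support_prod hΩb hp.continuous hpc (D := l * (M + M) + M)
        (hcm.mul (hβm.comp hVm)) (fun z => ?_) (fun z hz => ?_)
      · rw [abs_mul]
        exact (mul_le_of_le_one_right (abs_nonneg _) (hβ.abs_le_one _)).trans (hcM z)
      · rw [hV0 z hz, hβ.eq_zero 0 le_rfl, mul_zero]
    have i2 : Integrable (fun z => w z * ψ z.1 * initialBump s z.2) := by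
      refine integrable_of_support_prod hΩb hp.continuous hpc (D := M)
        (h.measurable.mul (hψ.continuous.measurable.comp measurable_fst)) (fun z => ?_)
        (fun z hz => ?_)
      · rw [abs_mul]
        exact (mul_le_of_le_one_right (abs_nonneg _) (hβ.abs_le_one _)).trans (h.abs_le z)
      · rw [hw0 z hz, zero_mul]
    have i3 : Integrable (fun z : SpaceTime n =>
        Ω.indicator (fun _ => (1 : ℝ)) z.1 * initialBump s z.2) := h1i.mul_prod hpi
    have i4 : Integrable (fun z : SpaceTime n => |V₀ z.1 - ψ₀ z.1| * initialBump s z.2) :=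
      hdi.mul_prod hpi
    have i0 : Integrable (fun z : SpaceTime n => primitive β (V₀ z.1) * initialBump s z.2) :=
      hBi.mul_prod hpi
    have hpt : ∀ z : SpaceTime n, primitive β (V₀ z.1) * initialBump s z.2 ≤
        l⁻¹ * ((l * (V z - w z) - fl z) * β (V z) * initialBump s z.2) +
        w z * ψ z.1 * initialBump s z.2 +
        (κ * s + M / l) * (Ω.indicator (fun _ => (1 : ℝ)) z.1 * initialBump s z.2) +
        M * L * (|V₀ z.1 - ψ₀ z.1| * initialBump s z.2) := by
      rintro ⟨x, t⟩
      by_cases ht : t ∈ Icc s (2 * s)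
      swap
      · simp [initialBump_eq_zero hs ht]
      have ht0 : 0 ≤ t := hs.le.trans ht.1
      have key : primitive β (V₀ x) ≤ l⁻¹ * ((l * (V (x, t) - w (x, t)) - fl (x, t)) *
          β (V (x, t))) + w (x, t) * ψ x + (κ * s + M / l) * Ω.indicator (fun _ => (1 : ℝ)) x +
          M * L * |V₀ x - ψ₀ x| := by
        by_cases hx : x ∈ Ω
        · rw [indicator_of_mem hx, mul_one]
          have b0 : |V (x, t) - V₀ x| ≤ 4 * l * M * s := by
            refine (hVlip x t ht0).trans ?_
            have := mul_le_mul_of_nonneg_left ht.2 (by positivity : 0 ≤ 2 * l * M)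
            linarith
          have b1 := (_root_.abs_le.1 (hβ.primitive_sub_le (V (x, t)) (V₀ x))).1
          have b2 := hβ.primitive_le_mul (V (x, t))
          have b3 : w (x, t) * (β (V (x, t)) - ψ x) ≤
              M * (L * (4 * l * M * s) + L * |V₀ x - ψ₀ x|) := by
            refine (le_abs_self _).trans ?_
            rw [abs_mul]
            refine mul_le_mul (h.abs_le _) ?_ (abs_nonneg _) hM
            have e : β (V (x, t)) - ψ x = (β (V (x, t)) - β (V₀ x)) + (β (V₀ x) - β (ψ₀ x)) := by
              simp only [hψd]; ring
            rw [e]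
            refine (abs_add_le _ _).trans (add_le_add ?_ (hβ.abs_sub_le _ _))
            exact (hβ.abs_sub_le _ _).trans (by gcongr)
          have b4 : fl (x, t) * β (V (x, t)) ≤ M := by
            refine (le_abs_self _).trans ?_
            rw [abs_mul]
            exact (mul_le_of_le_one_right (abs_nonneg _) (hβ.abs_le_one _)).trans (hfM _)
          have b5 : l⁻¹ * ((l * (V (x, t) - w (x, t)) - fl (x, t)) * β (V (x, t))) =
              V (x, t) * β (V (x, t)) - w (x, t) * β (V (x, t)) -
                fl (x, t) * β (V (x, t)) / l := by
            field_simp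
          have b6 : fl (x, t) * β (V (x, t)) / l ≤ M / l := by gcongr
          rw [b5, hκ]
          linarith
        · have e1 : V₀ x = 0 := hV0 (x, 0) hx
          rw [e1, hV0 (x, t) hx, hβ.primitive_of_nonpos le_rfl, hβ.eq_zero 0 le_rfl,
            hw0 (x, t) hx, indicator_of_notMem hx]
          simp only [mul_zero, zero_mul, add_zero, zero_add]
          positivity
      have := mul_le_mul_of_nonneg_right key (hp0 t)
      simp only
      linarith
    have hmono := integral_mono i0 ((((i1.const_mul l⁻¹).add i2).add
      (i3.const_mul (κ * s + M / l))).add (i4.const_mul (M * L))) hpt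
    have hsum := integral_add (((i1.const_mul l⁻¹).add i2).add
      (i3.const_mul (κ * s + M / l))) (i4.const_mul (M * L))
    have hsum2 := integral_add ((i1.const_mul l⁻¹).add i2) (i3.const_mul (κ * s + M / l))
    have hsum3 := integral_add (i1.const_mul l⁻¹) i2
    simp only [Pi.add_apply] at hsum hsum2 hsum3 hmono
    rw [hsum, hsum2, hsum3, integral_const_mul, integral_const_mul, integral_const_mul,
      integral_mul_initialBump hs (fun x => primitive β (V₀ x)),
      integral_mul_initialBump hs (fun x => |V₀ x - ψ₀ x|),
      integral_mul_initialBump hs, h1v] at hmono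
    refine hmono.trans ?_
    gcongr
  have hlim : Tendsto (fun s : ℝ => l⁻¹ * (M * volume.real Ω * (l * Real.exp (-(l * (T - 2 * s)))))
      + r s + (κ * s + M / l) * volume.real Ω + M * L * ε) (𝓝[>] 0)
      (𝓝 (l⁻¹ * (M * volume.real Ω * (l * Real.exp (-(l * (T - 2 * 0))))) + 0 +
        (κ * 0 + M / l) * volume.real Ω + M * L * ε)) := by
    refine Tendsto.add (Tendsto.add (Tendsto.add ?_ hr) ?_) tendsto_const_nhds
    · exact ((Continuous.tendsto (by fun_prop) 0).mono_left nhdsWithin_le_nhds)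
    · exact ((Continuous.tendsto (by fun_prop) 0).mono_left nhdsWithin_le_nhds)
  have hev : ∀ᶠ s : ℝ in 𝓝[>] 0, 0 < s ∧ 2 * s < T := by
    refine eventually_mem_nhdsWithin.and (mem_nhdsWithin_of_mem_nhds ?_)
    filter_upwards [gt_mem_nhds (half_pos hT)] with s hs
    linarith
  refine (ge_of_tendsto hlim (hev.mono fun s h => hs s h.1 h.2)).trans (le_of_eq ?_)
  rw [mul_zero, sub_zero]
  field_simp
  ring

lemma integral_primitive_initial_le (h : IsZeroDataSubsolution Ω T M w f G) (hΩo : IsOpen Ω)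
    (hΩb : Bornology.IsBounded Ω) (hcone : HasInteriorCones Ω) (hT : 0 < T) (hl : 0 < l)
    {β : ℝ → ℝ} {L : ℝ} (hβ : IsRamp β L) :
    ∫ x, primitive β (expAverage l w (x, 0)) ≤
      M * volume.real Ω * (l⁻¹ + Real.exp (-(l * T))) := by
  have ht : Tendsto (fun ε : ℝ => M * volume.real Ω * (l⁻¹ + Real.exp (-(l * T))) + M * L * ε)
      (𝓝[>] 0) (𝓝 (M * volume.real Ω * (l⁻¹ + Real.exp (-(l * T))) + M * L * 0)) :=
    (tendsto_const_nhds.add (tendsto_id.const_mul _)).mono_left nhdsWithin_le_nhds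
  rw [mul_zero, add_zero] at ht
  exact ge_of_tendsto ht (eventually_mem_nhdsWithin.mono fun ε hε =>
    h.integral_primitive_initial_le_add hΩo hΩb hcone hT hl hβ hε)

end IsZeroDataSubsolution

lemma memLp_indicator_mul {Ω : Set (Space n)} (hΩo : IsOpen Ω) (hΩb : Bornology.IsBounded Ω)
    {η : ℝ → ℝ} (hη : Continuous η) (hηc : HasCompactSupport η) :
    MemLp (fun z : SpaceTime n => Ω.indicator (fun _ => (1 : ℝ)) z.1 * η z.2) 2 := by
  have hm : Measurable (fun z : SpaceTime n => Ω.indicator (fun _ => (1 : ℝ)) z.1) :=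
    (measurable_const.indicator hΩo.measurableSet).comp measurable_fst
  refine (memLp_two_iff_integrable_sq
    (hm.mul (hη.measurable.comp measurable_snd)).aestronglyMeasurable).2 ?_
  have : Integrable (fun z : SpaceTime n => Ω.indicator (fun _ => (1 : ℝ)) z.1 *
      (η z.2 * η z.2)) := by
    refine integrable_of_support_prod hΩb (η := fun t => η t * η t) (hη.mul hη) hηc.mul_left
      (D := 1) hm (fun z => ?_) (fun z hz => by simp [hz])
    by_cases hz : z.1 ∈ Ω <;> simp [hz]
  refine this.congr (Eventually.of_forall fun z => ?_)
  by_cases hz : z.1 ∈ Ω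
  · simp [hz, sq]
  · simp [hz]

lemma tendsto_integral_mul_expAverage_sub {F : SpaceTime n → ℝ} (hF : Measurable F)
    (hF2 : MemLp F 2) {a : SpaceTime n → ℝ} (ha : MemLp a 2) :
    Tendsto (fun l => ∫ z, ‖a z‖ * ‖expAverage l F z - F z‖) atTop (𝓝 0) ∧
      ∀ᶠ l in atTop, Integrable (fun z => ‖a z‖ * ‖expAverage l F z - F z‖) := by
  have ht := tendsto_eLpNorm_expAverage_sub hF.stronglyMeasurable hF2
  have key : ∀ d : SpaceTime n → ℝ, Measurable d → eLpNorm d 2 < ⊤ →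
      Integrable (fun z => ‖a z‖ * ‖d z‖) ∧
        ∫ z, ‖a z‖ * ‖d z‖ ≤ (eLpNorm a 2).toReal * (eLpNorm d 2).toReal := by
    intro d hd hd2
    have hN : eLpNorm d 2 ≤ ENNReal.ofReal (eLpNorm d 2).toReal := by
      rw [ENNReal.ofReal_toReal hd2.ne]
    have hN0 : 0 ≤ (eLpNorm d 2).toReal := ENNReal.toReal_nonneg
    generalize (eLpNorm d 2).toReal = N at hN hN0 ⊢
    exact integral_norm_mul_norm_le hN0 ha hd.aestronglyMeasurable hN
  have hb : ∀ᶠ l in atTop, Integrable (fun z => ‖a z‖ * ‖expAverage l F z - F z‖) ∧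
      ∫ z, ‖a z‖ * ‖expAverage l F z - F z‖ ≤ (eLpNorm a 2).toReal *
        (eLpNorm (fun z => expAverage l F z - F z) 2).toReal := by
    have hlt : ∀ᶠ l in atTop, eLpNorm (fun z => expAverage l F z - F z) 2 < ⊤ :=
      (tendsto_order.1 ht).2 ⊤ ENNReal.zero_lt_top
    filter_upwards [hlt, eventually_gt_atTop (0 : ℝ)] with l h1 hl
    have hVm : Measurable (expAverage l F) :=
      (stronglyMeasurable_expAverage hl hF.stronglyMeasurable).measurable
    exact key (fun z => expAverage l F z - F z) (hVm.sub hF) h1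
  refine ⟨?_, hb.mono fun l h => h.1⟩
  have ht2 : Tendsto (fun l => (eLpNorm a 2).toReal *
      (eLpNorm (fun z => expAverage l F z - F z) 2).toReal) atTop (𝓝 0) := by
    have h0 := ((ENNReal.tendsto_toReal ENNReal.zero_ne_top).comp ht).const_mul
      (eLpNorm a 2).toReal
    rw [ENNReal.toReal_zero, mul_zero] at h0
    exact h0
  exact tendsto_of_tendsto_of_tendsto_of_le_of_le' tendsto_const_nhds ht2
    (Eventually.of_forall fun l => by positivity) (hb.mono fun l h => h.2)

namespace IsZeroDataSubsolution

variable {Ω : Set (Space n)} {T M l : ℝ} {w f : SpaceTime n → ℝ} {G : SpaceTime n → Space n}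

lemma renormalized_le_setIntegral (h : IsZeroDataSubsolution Ω T M w f G) (hΩo : IsOpen Ω)
    (hΩb : Bornology.IsBounded Ω) (hcone : HasInteriorCones Ω) (hl : 0 < l) {β : ℝ → ℝ} {L : ℝ}
    (hβ : IsRamp β L) {η : ℝ → ℝ} (hη : ContDiff ℝ ∞ η) (hηc : HasCompactSupport η)
    (hη0 : ∀ t, 0 ≤ η t) {b : ℝ} (hb : ∀ t, b ≤ t → η t = 0) :
    ∫ z in {z : SpaceTime n | 0 < z.2}, (l * (expAverage l w z - w z) - expAverage l f z) *
        β (expAverage l w z) * η z.2 ≤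
      M * volume.real Ω * (l * Real.exp (-(l * (T - b))) * ∫ t, η t) := by
  have := isProbabilityMeasure_expMeasure hl
  have hM := h.nonneg
  have hVm : Measurable (expAverage l w) :=
    (stronglyMeasurable_expAverage hl h.measurable.stronglyMeasurable).measurable
  have hfm : Measurable (expAverage l f) :=
    (stronglyMeasurable_expAverage hl h.measurable_source.stronglyMeasurable).measurable
  have hPm : MeasurableSet {z : SpaceTime n | 0 < z.2} :=
    measurableSet_lt measurable_const measurable_snd
  have hi : Integrable (fun z => (l * (expAverage l w z - w z) - expAverage l f z) *
      β (expAverage l w z) * η z.2) := by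
    refine integrable_of_support_prod hΩb hη.continuous hηc (D := l * (M + M) + M)
      ?_ (fun z => ?_) (fun z hz => ?_)
    · have h1 := h.measurable
      have h2 := hβ.contDiff.continuous.measurable
      fun_prop
    · rw [abs_mul]
      refine (mul_le_of_le_one_right (abs_nonneg _) (hβ.abs_le_one _)).trans ?_
      refine (abs_sub _ _).trans (add_le_add ?_ (abs_expAverage_le hl h.abs_source_le z))
      rw [abs_mul, abs_of_pos hl]
      gcongr
      exact (abs_sub _ _).trans (add_le_add (abs_expAverage_le hl h.abs_le z) (h.abs_le z))
    · rw [expAverage_eq_zero h.eq_zero hz, hβ.eq_zero 0 le_rfl, mul_zero]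
  set g : SpaceTime n → ℝ := fun z => (l * (expAverage l w z - w z) - expAverage l f z) *
      β (expAverage l w z) * η z.2 with hg
  set σ : ℕ → ℝ → ℝ := fun k t => Real.smoothTransition (k * t - 1) with hσ
  have hσs : ∀ k, ContDiff ℝ ∞ (σ k) := fun k => contDiff_smoothTransition.comp (by fun_prop)
  have hσ0 : ∀ (k : ℕ) {t : ℝ}, t ≤ 0 → σ k t = 0 := fun k t ht =>
    Real.smoothTransition.zero_of_nonpos
      (by have := mul_nonpos_of_nonneg_of_nonpos (k.cast_nonneg (α := ℝ)) ht; linarith)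
  have hη_int := hη.continuous.integrable_of_hasCompactSupport (μ := volume) hηc
  have hk : ∀ k : ℕ, ∫ z, g z * σ k z.2 ≤
      M * volume.real Ω * (l * Real.exp (-(l * (T - b))) * ∫ t, η t) := by
    intro k
    have hsub : tsupport (fun t => η t * σ k t) ⊆ Ioi 0 := by
      refine tsupport_mul_subset_right.trans ?_
      have h1 : tsupport (σ k) ⊆ {t : ℝ | 1 ≤ k * t} := by
        refine closure_minimal (fun t ht => ?_) (isClosed_le (by fun_prop) (by fun_prop))
        by_contra hcon
        rw [mem_ofPred_eq, not_le] at hcon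
        exact ht (Real.smoothTransition.zero_of_nonpos (by linarith))
      intro t ht
      have h2 := h1 ht
      rw [mem_ofPred_eq] at h2
      by_contra hcon
      rw [mem_Ioi, not_lt] at hcon
      have := mul_nonpos_of_nonneg_of_nonpos (k.cast_nonneg (α := ℝ)) hcon
      linarith
    have h1 := h.renormalized_le hΩo hΩb hcone hl hβ (hη.mul (hσs k)) hηc.mul_right
      (fun t => mul_nonneg (hη0 t) (Real.smoothTransition.nonneg _)) hsub (b := b)
      (fun t ht => by rw [hb t ht, zero_mul])
    have e : ∀ z : SpaceTime n, (l * (expAverage l w z - w z) - expAverage l f z) *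
        β (expAverage l w z) * (η z.2 * σ k z.2) = g z * σ k z.2 := fun z => by rw [hg]; ring
    simp only [e] at h1
    refine h1.trans ?_
    gcongr ?_ * (?_ * ?_)
    refine integral_mono_of_nonneg
      (Eventually.of_forall fun t => mul_nonneg (hη0 t) (Real.smoothTransition.nonneg _)) hη_int
      (Eventually.of_forall fun t => ?_)
    exact mul_le_of_le_one_right (hη0 t) (Real.smoothTransition.le_one _)
  have hlim : Tendsto (fun k : ℕ => ∫ z, g z * σ k z.2) atTop
      (𝓝 (∫ z, {z : SpaceTime n | 0 < z.2}.indicator g z)) := by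
    refine tendsto_integral_of_dominated_convergence (fun z => ‖g z‖) (fun k => ?_) hi.norm
      (fun k => Eventually.of_forall fun z => ?_) (Eventually.of_forall fun z => ?_)
    · exact hi.1.mul ((hσs k).continuous.comp continuous_snd).aestronglyMeasurable
    · rw [norm_mul]
      refine mul_le_of_le_one_right (norm_nonneg _) ?_
      rw [Real.norm_eq_abs, abs_of_nonneg (Real.smoothTransition.nonneg _)]
      exact Real.smoothTransition.le_one _
    · by_cases hz : 0 < z.2
      · rw [indicator_of_mem (by exact hz)]
        have h1 : ∀ᶠ k : ℕ in atTop, 2 ≤ (k : ℝ) * z.2 :=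
          (tendsto_natCast_atTop_atTop.atTop_mul_const hz).eventually_ge_atTop 2
        refine tendsto_const_nhds.congr' ?_
        filter_upwards [h1] with k hk
        rw [hσ]
        simp only
        rw [Real.smoothTransition.one_of_one_le (by linarith), mul_one]
      · rw [indicator_of_notMem (by exact hz)]
        simp [hσ0 _ (not_lt.1 hz)]
  rw [integral_indicator hPm] at hlim
  exact le_of_tendsto' hlim hk

lemma setIntegral_chain (h : IsZeroDataSubsolution Ω T M w f G)
    (hΩb : Bornology.IsBounded Ω) (hT : 0 < T) (hl : 0 < l) {β : ℝ → ℝ} {L : ℝ}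
    (hβ : IsRamp β L) {η : ℝ → ℝ} (hη : ContDiff ℝ ∞ η) (hηc : HasCompactSupport η)
    (hb : ∀ t, T ≤ t → η t = 0) (hb' : ∀ t, T ≤ t → deriv η t = 0) :
    ∫ z in {z : SpaceTime n | 0 < z.2}, l * (expAverage l w z - w z) *
        β (expAverage l w z) * η z.2 =
      -(η 0 * ∫ x, primitive β (expAverage l w (x, 0))) -
        ∫ z in {z : SpaceTime n | 0 < z.2}, primitive β (expAverage l w z) * deriv η z.2 := by
  have := isProbabilityMeasure_expMeasure hl
  have hM := h.nonneg
  set V := expAverage l w with hV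
  have hVm : Measurable V :=
    (stronglyMeasurable_expAverage hl h.measurable.stronglyMeasurable).measurable
  have hVM := abs_expAverage_le hl h.abs_le
  have hV0 : ∀ z : SpaceTime n, z.1 ∉ Ω → V z = 0 := fun z hz => expAverage_eq_zero h.eq_zero hz
  have hBm : Measurable (primitive β) := hβ.continuous_primitive.measurable
  have hBM : ∀ z, |primitive β (V z)| ≤ M := fun z => by
    rw [abs_of_nonneg (hβ.primitive_nonneg _)]
    exact (hβ.primitive_le_max _).trans (max_le ((le_abs_self _).trans (hVM z)) hM)
  have hB0 : ∀ z : SpaceTime n, z.1 ∉ Ω → primitive β (V z) = 0 := fun z hz => by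
    rw [hV0 z hz, hβ.primitive_of_nonpos le_rfl]
  have i1 : Integrable (fun z => l * (V z - w z) * β (V z) * η z.2) := by
    refine integrable_of_support_prod hΩb hη.continuous hηc (D := l * (M + M))
      ?_ (fun z => ?_) (fun z hz => ?_)
    · have h1 := h.measurable
      have h2 := hβ.contDiff.continuous.measurable
      fun_prop
    · rw [abs_mul]
      refine (mul_le_of_le_one_right (abs_nonneg _) (hβ.abs_le_one _)).trans ?_
      rw [abs_mul, abs_of_pos hl]
      gcongr
      exact (abs_sub _ _).trans (add_le_add (hVM z) (h.abs_le z))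
    · rw [hV0 z hz, hβ.eq_zero 0 le_rfl, mul_zero]
  have i2 : Integrable (fun z => primitive β (V z) * deriv η z.2) :=
    integrable_of_support_prod hΩb (hη.continuous_deriv (by simp)) hηc.deriv (D := M)
      (hBm.comp hVm) hBM hB0
  have i3 : Integrable (fun x => primitive β (V (x, 0))) :=
    integrable_of_bounded_of_support hΩb (hBm.comp (hVm.comp (by fun_prop)))
      (fun x => hBM (x, 0)) fun x hx => hB0 (x, 0) hx
  have hset : ({z : SpaceTime n | 0 < z.2}) = univ ×ˢ Ioi (0 : ℝ) := by
    ext z; simp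
  have hfub : ∀ F : SpaceTime n → ℝ, Integrable F → (∀ z : SpaceTime n, T ≤ z.2 → F z = 0) →
      ∫ z in {z : SpaceTime n | 0 < z.2}, F z = ∫ x, (∫ t in (0 : ℝ)..T, F (x, t)) := by
    intro F hF hF0
    rw [hset, Measure.volume_eq_prod, setIntegral_prod _ (by
      rw [← Measure.volume_eq_prod]; exact hF.integrableOn), setIntegral_univ]
    refine integral_congr_ae (Eventually.of_forall fun x => ?_)
    simp only
    rw [intervalIntegral.integral_of_le hT.le]
    refine setIntegral_eq_of_subset_of_forall_sdiff_eq_zero measurableSet_Ioi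
      (fun t ht => ht.1) fun t ht => hF0 _ ?_
    by_contra hcon
    exact ht.2 ⟨ht.1, (not_le.1 hcon).le⟩
  have i2' : Integrable (fun x => ∫ t in (0 : ℝ)..T, primitive β (V (x, t)) * deriv η t) := by
    have : Integrable (fun z : SpaceTime n => primitive β (V z) * deriv η z.2)
        ((volume : Measure (Space n)).prod (volume.restrict (Ioc 0 T))) := by
      have h1 := i2.integrableOn (s := univ ×ˢ Ioc (0 : ℝ) T)
      rw [IntegrableOn, Measure.volume_eq_prod, ← Measure.prod_restrict, Measure.restrict_univ] at h1
      exact h1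
    refine this.integral_prod_left.congr (Eventually.of_forall fun x => ?_)
    simp only
    rw [intervalIntegral.integral_of_le hT.le]
  have i3' : Integrable (fun x => -(η 0 * primitive β (V (x, 0)))) := (i3.const_mul (η 0)).neg
  rw [hfub _ i1 fun z hz => by rw [hb _ hz, mul_zero],
    hfub _ i2 fun z hz => by rw [hb' _ hz, mul_zero], ← integral_const_mul, ← integral_neg,
    ← integral_sub i3' i2']
  refine integral_congr_ae (Eventually.of_forall fun x => ?_)
  have := integral_timeAverage_chain (h := fun s => w (x, s)) hl
    (h.measurable.comp measurable_prodMk_left) (fun t => h.abs_le (x, t))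
    hβ.hasDerivAt_primitive hβ.abs_le_one hη 0 T
  simp only [hV, expAverage_eq_timeAverage]
  rw [this, hb T le_rfl]
  ring

lemma memLp_two_of_bounded (hΩo : IsOpen Ω) (hΩb : Bornology.IsBounded Ω) {F : SpaceTime n → ℝ}
    (hF : Measurable F) (hM : ∀ z, |F z| ≤ M) (h0 : ∀ z ∉ spaceTimeCylinder Ω T, F z = 0) :
    MemLp F 2 := by
  refine (memLp_two_iff_integrable_sq hF.aestronglyMeasurable).2 ?_
  refine integrable_of_bounded (M := M * M) hΩo hΩb (hF.pow_const 2) (fun z => ?_) fun z hz => by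
    rw [h0 z hz]; norm_num
  rw [sq, abs_mul]
  exact mul_le_mul (hM z) (hM z) (abs_nonneg _) ((abs_nonneg _).trans (hM z))

/-- The renormalized inequality `∂ₜB(w) ≤ f β(w)`, integrated over `Ω`, with zero initial data. -/
lemma integral_primitive_mul_deriv_le (h : IsZeroDataSubsolution Ω T M w f G) (hΩo : IsOpen Ω)
    (hΩb : Bornology.IsBounded Ω) (hcone : HasInteriorCones Ω) (hT : 0 < T) {β : ℝ → ℝ} {L : ℝ}
    (hβ : IsRamp β L) {η : ℝ → ℝ} (hη : ContDiff ℝ ∞ η) (hηc : HasCompactSupport η)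
    (hη0 : ∀ t, 0 ≤ η t) {b : ℝ} (hbT : b < T) (hb : ∀ t, b ≤ t → η t = 0) :
    -∫ z, primitive β (w z) * deriv η z.2 ≤ ∫ z, f z * β (w z) * η z.2 := by
  have hM := h.nonneg
  have hL := hβ.lipschitz_nonneg
  have hbT' : ∀ t, T ≤ t → η t = 0 := fun t ht => hb t (hbT.le.trans ht)
  have hbd : ∀ t, T ≤ t → deriv η t = 0 := fun t ht => by
    have : η =ᶠ[𝓝 t] fun _ => 0 := by
      filter_upwards [lt_mem_nhds (hbT.trans_le ht)] with s hs using hb s hs.le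
    rw [this.deriv_eq, deriv_const]
  have hβm : Measurable β := hβ.contDiff.continuous.measurable
  have hBm : Measurable (primitive β) := hβ.continuous_primitive.measurable
  set P : Set (SpaceTime n) := {z | 0 < z.2} with hP
  have hPm : MeasurableSet P := measurableSet_lt measurable_const measurable_snd
  have hdc : Continuous (deriv η) := hη.continuous_deriv (by simp)
  set a : SpaceTime n → ℝ := fun z => Ω.indicator (fun _ => (1 : ℝ)) z.1 * η z.2 with ha
  set a' : SpaceTime n → ℝ := fun z => Ω.indicator (fun _ => (1 : ℝ)) z.1 * deriv η z.2 with ha'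
  have haM : MemLp a 2 := memLp_indicator_mul hΩo hΩb hη.continuous hηc
  have haM' : MemLp a' 2 := memLp_indicator_mul hΩo hΩb hdc hηc.deriv
  have hw2 := memLp_two_of_bounded hΩo hΩb h.measurable h.abs_le h.eq_zero
  have hf2 := memLp_two_of_bounded hΩo hΩb h.measurable_source h.abs_source_le h.source_eq_zero
  obtain ⟨t1, j1⟩ := tendsto_integral_mul_expAverage_sub h.measurable hw2 haM'
  obtain ⟨t2, j2⟩ := tendsto_integral_mul_expAverage_sub h.measurable_source hf2 haM
  obtain ⟨t3, j3⟩ := tendsto_integral_mul_expAverage_sub h.measurable hw2 haM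
  have hBw : ∀ z, |primitive β (w z)| ≤ M := fun z => by
    rw [abs_of_nonneg (hβ.primitive_nonneg _)]
    exact (hβ.primitive_le_max _).trans (max_le ((le_abs_self _).trans (h.abs_le z)) hM)
  have hw0 : ∀ z : SpaceTime n, z.1 ∉ Ω → w z = 0 := fun z hz =>
    h.eq_zero z fun hmem => hz hmem.1
  have k1 : Integrable (fun z => primitive β (w z) * deriv η z.2) :=
    integrable_of_support_prod hΩb hdc hηc.deriv (hBm.comp h.measurable) hBw fun z hz => by
      rw [hw0 z hz, hβ.primitive_of_nonpos le_rfl]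
  have k2 : Integrable (fun z => f z * β (w z) * η z.2) := by
    refine integrable_of_support_prod hΩb hη.continuous hηc (D := M)
      (h.measurable_source.mul (hβm.comp h.measurable)) (fun z => ?_) fun z hz => by
      rw [hw0 z hz, hβ.eq_zero 0 le_rfl, mul_zero]
    rw [abs_mul]
    exact (mul_le_of_le_one_right (abs_nonneg _) (hβ.abs_le_one _)).trans (h.abs_source_le z)
  have hP1 : ∫ z, primitive β (w z) * deriv η z.2 = ∫ z in P, primitive β (w z) * deriv η z.2 := by
    refine (setIntegral_eq_integral_of_forall_compl_eq_zero fun z hz => ?_).symm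
    rw [h.eq_zero z fun hm => hz hm.2.1, hβ.primitive_of_nonpos le_rfl, zero_mul]
  have hP2 : ∫ z, f z * β (w z) * η z.2 = ∫ z in P, f z * β (w z) * η z.2 := by
    refine (setIntegral_eq_integral_of_forall_compl_eq_zero fun z hz => ?_).symm
    rw [h.eq_zero z fun hm => hz hm.2.1, hβ.eq_zero 0 le_rfl, mul_zero, zero_mul]
  rw [hP1, hP2]
  have hmain : ∀ᶠ l : ℝ in atTop, -∫ z in P, primitive β (w z) * deriv η z.2 ≤
      (∫ z in P, f z * β (w z) * η z.2) +
      ((∫ z, ‖a' z‖ * ‖expAverage l w z - w z‖) + (∫ z, ‖a z‖ * ‖expAverage l f z - f z‖) +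
        M * L * (∫ z, ‖a z‖ * ‖expAverage l w z - w z‖) +
        η 0 * (M * volume.real Ω * (l⁻¹ + Real.exp (-(l * T)))) +
        M * volume.real Ω * (l * Real.exp (-(l * (T - b))) * ∫ t, η t)) := by
    filter_upwards [j1, j2, j3, eventually_gt_atTop 0] with l j1 j2 j3 hl
    have := isProbabilityMeasure_expMeasure hl
    set V := expAverage l w with hV
    set fl := expAverage l f with hfl
    have hVm : Measurable V :=
      (stronglyMeasurable_expAverage hl h.measurable.stronglyMeasurable).measurable
    have hfm : Measurable fl :=
      (stronglyMeasurable_expAverage hl h.measurable_source.stronglyMeasurable).measurable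
    have hVM := abs_expAverage_le hl h.abs_le
    have hfM := abs_expAverage_le hl h.abs_source_le
    have hV0 : ∀ z : SpaceTime n, z.1 ∉ Ω → V z = 0 := fun z hz => expAverage_eq_zero h.eq_zero hz
    have c1 := h.renormalized_le_setIntegral hΩo hΩb hcone hl hβ hη hηc hη0 hb
    have c2 := h.setIntegral_chain hΩb hT hl hβ hη hηc hbT' hbd
    have c3 := mul_le_mul_of_nonneg_left
      (h.integral_primitive_initial_le hΩo hΩb hcone hT hl hβ) (hη0 0)
    have k3 : Integrable (fun z => primitive β (V z) * deriv η z.2) := by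
      refine integrable_of_support_prod hΩb hdc hηc.deriv (D := M) (hBm.comp hVm) (fun z => ?_)
        fun z hz => by rw [hV0 z hz, hβ.primitive_of_nonpos le_rfl]
      rw [abs_of_nonneg (hβ.primitive_nonneg _)]
      exact (hβ.primitive_le_max _).trans (max_le ((le_abs_self _).trans (hVM z)) hM)
    have k4 : Integrable (fun z => fl z * β (V z) * η z.2) := by
      refine integrable_of_support_prod hΩb hη.continuous hηc (D := M)
        (hfm.mul (hβm.comp hVm)) (fun z => ?_) fun z hz => by
        rw [hV0 z hz, hβ.eq_zero 0 le_rfl, mul_zero]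
      rw [abs_mul]
      exact (mul_le_of_le_one_right (abs_nonneg _) (hβ.abs_le_one _)).trans (hfM z)
    have k5 : Integrable (fun z => l * (V z - w z) * β (V z) * η z.2) := by
      refine integrable_of_support_prod hΩb hη.continuous hηc (D := l * (M + M))
        ?_ (fun z => ?_) (fun z hz => ?_)
      · have h1 := h.measurable
        fun_prop
      · rw [abs_mul]
        refine (mul_le_of_le_one_right (abs_nonneg _) (hβ.abs_le_one _)).trans ?_
        rw [abs_mul, abs_of_pos hl]
        gcongr
        exact (abs_sub _ _).trans (add_le_add (hVM z) (h.abs_le z))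
      · rw [hV0 z hz, hβ.eq_zero 0 le_rfl, mul_zero]
    have c1' : (∫ z in P, l * (V z - w z) * β (V z) * η z.2) - ∫ z in P, fl z * β (V z) * η z.2 ≤
        M * volume.real Ω * (l * Real.exp (-(l * (T - b))) * ∫ t, η t) := by
      rw [← integral_sub k5.integrableOn k4.integrableOn]
      refine le_trans (le_of_eq ?_) c1
      congr 1
      ext1 z
      ring
    have d1 : -(∫ z in P, primitive β (w z) * deriv η z.2) +
        ∫ z in P, primitive β (V z) * deriv η z.2 ≤ ∫ z, ‖a' z‖ * ‖V z - w z‖ := by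
      rw [neg_add_eq_sub, ← integral_sub k3.integrableOn k1.integrableOn]
      refine (setIntegral_mono (k3.sub k1).integrableOn j1.integrableOn fun z => ?_).trans
        (setIntegral_le_integral j1 (Eventually.of_forall fun z => by positivity))
      by_cases hz : z.1 ∈ Ω
      · have e : a' z = deriv η z.2 := by simp [ha', hz]
        rw [e]
        simp only [Pi.sub_apply]
        rw [← sub_mul]
        refine (le_abs_self _).trans ?_
        rw [abs_mul, mul_comm, Real.norm_eq_abs, Real.norm_eq_abs]
        exact mul_le_mul_of_nonneg_left (hβ.primitive_sub_le _ _) (abs_nonneg _)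
      · simp only [Pi.sub_apply]
        rw [hV0 z hz, hw0 z hz, sub_self]
        positivity
    have d2 : (∫ z in P, fl z * β (V z) * η z.2) - (∫ z in P, f z * β (w z) * η z.2) ≤
        (∫ z, ‖a z‖ * ‖fl z - f z‖) + M * L * (∫ z, ‖a z‖ * ‖V z - w z‖) := by
      rw [← integral_sub k4.integrableOn k2.integrableOn, ← integral_const_mul,
        ← integral_add j2 (j3.const_mul _)]
      refine (setIntegral_mono (k4.sub k2).integrableOn (j2.add (j3.const_mul _)).integrableOn
        fun z => ?_).trans (setIntegral_le_integral (j2.add (j3.const_mul (M * L)))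
          (Eventually.of_forall fun z => ?_))
      · simp only [Pi.sub_apply, Pi.add_apply]
        by_cases hz : z.1 ∈ Ω
        · have e : a z = η z.2 := by simp [ha, hz]
          rw [e]
          have e2 : fl z * β (V z) * η z.2 - f z * β (w z) * η z.2 =
            η z.2 * ((fl z - f z) * β (V z)) + η z.2 * (f z * (β (V z) - β (w z))) := by ring
          rw [e2, Real.norm_eq_abs, Real.norm_eq_abs, Real.norm_eq_abs, abs_of_nonneg (hη0 _)]
          have s1 : (fl z - f z) * β (V z) ≤ |fl z - f z| := by
            refine (le_abs_self _).trans ?_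
            rw [abs_mul]
            exact mul_le_of_le_one_right (abs_nonneg _) (hβ.abs_le_one _)
          have s2 : f z * (β (V z) - β (w z)) ≤ M * (L * |V z - w z|) := by
            refine (le_abs_self _).trans ?_
            rw [abs_mul]
            exact mul_le_mul (h.abs_source_le z) (hβ.abs_sub_le _ _) (abs_nonneg _) hM
          have s3 := mul_le_mul_of_nonneg_left s1 (hη0 z.2)
          have s4 := mul_le_mul_of_nonneg_left s2 (hη0 z.2)
          linarith
        · rw [hV0 z hz, hw0 z hz, hβ.eq_zero 0 le_rfl]
          simp only [mul_zero, zero_mul, sub_self]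
          positivity
      · simp only [Pi.add_apply, Pi.zero_apply]
        positivity
    rw [c2] at c1'
    linarith
  have tl : Tendsto (fun l : ℝ => l⁻¹ + Real.exp (-(l * T))) atTop (𝓝 0) := by
    have h2 : Tendsto (fun l : ℝ => Real.exp (-(l * T))) atTop (𝓝 0) :=
      Real.tendsto_exp_neg_atTop_nhds_zero.comp (tendsto_id.atTop_mul_const hT)
    simpa using tendsto_inv_atTop_zero.add h2
  have tb : Tendsto (fun l : ℝ => l * Real.exp (-(l * (T - b)))) atTop (𝓝 0) := by
    have := tendsto_rpow_mul_exp_neg_mul_atTop_nhds_zero 1 (T - b) (sub_pos.2 hbT)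
    refine this.congr fun l => ?_
    rw [Real.rpow_one, neg_mul, mul_comm (T - b)]
  have hlim : Tendsto (fun l : ℝ => (∫ z in P, f z * β (w z) * η z.2) +
      ((∫ z, ‖a' z‖ * ‖expAverage l w z - w z‖) + (∫ z, ‖a z‖ * ‖expAverage l f z - f z‖) +
        M * L * (∫ z, ‖a z‖ * ‖expAverage l w z - w z‖) +
        η 0 * (M * volume.real Ω * (l⁻¹ + Real.exp (-(l * T)))) +
        M * volume.real Ω * (l * Real.exp (-(l * (T - b))) * ∫ t, η t))) atTop
      (𝓝 ((∫ z in P, f z * β (w z) * η z.2) + (0 + 0 + M * L * 0 +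
        η 0 * (M * volume.real Ω * 0) + M * volume.real Ω * (0 * ∫ t, η t)))) :=
    tendsto_const_nhds.add ((((t1.add t2).add (t3.const_mul _)).add
      ((tl.const_mul _).const_mul _)).add ((tb.mul_const _).const_mul _))
  simp only [mul_zero, zero_mul, add_zero] at hlim
  exact ge_of_tendsto hlim hmain

end IsZeroDataSubsolution

section Ramp

lemma exists_isRamp : ∃ L, ∀ k : ℕ, IsRamp (fun y => Real.smoothTransition (k * y)) (k * L) := by
  have hc : HasCompactSupport (deriv Real.smoothTransition) :=
    HasCompactSupport.intro isCompact_Icc fun y hy => deriv_smoothTransition_eq_zero hy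
  obtain ⟨L, hL⟩ := (contDiff_smoothTransition.continuous_deriv
    (by simp)).bounded_above_of_compact_support hc
  have hd : ∀ (k : ℕ) (y : ℝ), deriv (fun y => Real.smoothTransition (k * y)) y =
      k * deriv Real.smoothTransition (k * y) := fun k y => by
    have h1 : HasDerivAt (fun y => Real.smoothTransition (k * y))
        (deriv Real.smoothTransition (k * y) * (k * 1)) y :=
      HasDerivAt.comp y (contDiff_smoothTransition.differentiable (by simp) _).hasDerivAt
        ((hasDerivAt_id y).const_mul (k : ℝ))
    rw [h1.deriv]; ring
  refine ⟨L, fun k => ⟨contDiff_smoothTransition.comp (by fun_prop), fun y =>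
    Real.smoothTransition.nonneg _, fun y => Real.smoothTransition.le_one _, fun y hy =>
    Real.smoothTransition.zero_of_nonpos
      (mul_nonpos_of_nonneg_of_nonpos k.cast_nonneg hy), fun y => ?_, fun y => ?_⟩⟩
  · rw [hd]
    exact mul_nonneg k.cast_nonneg (deriv_smoothTransition_nonneg _)
  · rw [hd]
    exact mul_le_mul_of_nonneg_left ((le_abs_self _).trans (hL _)) k.cast_nonneg

lemma tendsto_smoothTransition_nat_mul {y : ℝ} (hy : 0 < y) :
    Tendsto (fun k : ℕ => Real.smoothTransition (k * y)) atTop (𝓝 1) := by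
  have h1 : ∀ᶠ k : ℕ in atTop, 1 ≤ (k : ℝ) * y :=
    (tendsto_natCast_atTop_atTop.atTop_mul_const hy).eventually_ge_atTop 1
  exact tendsto_const_nhds.congr' (h1.mono fun k hk =>
    (Real.smoothTransition.one_of_one_le hk).symm)

lemma tendsto_primitive_smoothTransition (y : ℝ) :
    Tendsto (fun k : ℕ => primitive (fun y => Real.smoothTransition (k * y)) y) atTop
      (𝓝 (max y 0)) := by
  obtain ⟨L, hL⟩ := exists_isRamp
  rcases le_total y 0 with hy | hy
  · simp only [fun k => (hL k).primitive_of_nonpos hy, max_eq_right hy]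
    exact tendsto_const_nhds
  · have h1 : Tendsto (fun k : ℕ => ∫ s in (0 : ℝ)..y, Real.smoothTransition (k * s)) atTop
        (𝓝 (∫ s in (0 : ℝ)..y, (1 : ℝ))) := by
      refine intervalIntegral.tendsto_integral_filter_of_dominated_convergence (fun _ => 1)
        (Eventually.of_forall fun k => (hL k).contDiff.continuous.aestronglyMeasurable)
        (Eventually.of_forall fun k => Eventually.of_forall fun s _ => (hL k).abs_le_one s)
        intervalIntegrable_const (Eventually.of_forall fun s hs => ?_)
      rw [uIoc_of_le hy] at hs
      exact tendsto_smoothTransition_nat_mul hs.1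
    rw [max_eq_left hy]
    simp only [intervalIntegral.integral_const, sub_zero, smul_eq_mul, mul_one] at h1
    exact h1

end Ramp

namespace IsZeroDataSubsolution

variable {Ω : Set (Space n)} {T M C : ℝ} {w f : SpaceTime n → ℝ} {G : SpaceTime n → Space n}

lemma integral_pos_part_mul_deriv_le (h : IsZeroDataSubsolution Ω T M w f G) (hΩo : IsOpen Ω)
    (hΩb : Bornology.IsBounded Ω) (hcone : HasInteriorCones Ω) (hT : 0 < T)
    {g : SpaceTime n → ℝ} (hg : Integrable g) (hg0 : ∀ z, 0 ≤ g z)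
    (hfg : ∀ z, 0 < w z → f z ≤ g z) {η : ℝ → ℝ} (hη : ContDiff ℝ ∞ η) (hηc : HasCompactSupport η)
    (hη0 : ∀ t, 0 ≤ η t) {b : ℝ} (hbT : b < T) (hb : ∀ t, b ≤ t → η t = 0) :
    -∫ z, max (w z) 0 * deriv η z.2 ≤ ∫ z, g z * η z.2 := by
  obtain ⟨L, hL⟩ := exists_isRamp
  have hwi := h.integrable hΩo hΩb
  have hdc : Continuous (deriv η) := hη.continuous_deriv (by simp)
  obtain ⟨D, hD⟩ := hdc.bounded_above_of_compact_support hηc.deriv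
  obtain ⟨D', hD'⟩ := hη.continuous.bounded_above_of_compact_support hηc
  have hlim : Tendsto (fun k : ℕ => ∫ z, primitive (fun y => Real.smoothTransition (k * y)) (w z) *
      deriv η z.2) atTop (𝓝 (∫ z, max (w z) 0 * deriv η z.2)) := by
    refine tendsto_integral_of_dominated_convergence (fun z => ‖w z‖ * D) (fun k => ?_)
      (hwi.norm.mul_const D) (fun k => Eventually.of_forall fun z => ?_)
      (Eventually.of_forall fun z => (tendsto_primitive_smoothTransition (w z)).mul_const _)
    · exact (((hL k).continuous_primitive.measurable.comp h.measurable).mul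
        (hdc.measurable.comp measurable_snd)).aestronglyMeasurable
    · rw [norm_mul]
      refine mul_le_mul ?_ (hD _) (norm_nonneg _) (norm_nonneg _)
      rw [Real.norm_eq_abs, abs_of_nonneg ((hL k).primitive_nonneg _)]
      exact ((hL k).primitive_le_max _).trans (max_le (le_abs_self _) (abs_nonneg _))
  have hgi : Integrable (fun z => g z * η z.2) := by
    refine hg.mul_bdd (hη.continuous.comp continuous_snd).aestronglyMeasurable
      (Eventually.of_forall fun z => hD' _)
  refine le_of_tendsto' hlim.neg fun k => (h.integral_primitive_mul_deriv_le hΩo hΩb hcone hT (hL k)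
    hη hηc hη0 hbT hb).trans (integral_mono ?_ hgi fun z => ?_)
  · have hfi : Integrable f :=
      integrable_of_bounded hΩo hΩb h.measurable_source h.abs_source_le h.source_eq_zero
    have h1 : Integrable (fun z => f z * Real.smoothTransition (k * w z)) :=
      hfi.mul_bdd ((hL k).contDiff.continuous.measurable.comp h.measurable).aestronglyMeasurable
        (Eventually.of_forall fun z => (hL k).abs_le_one _)
    exact h1.mul_bdd (hη.continuous.comp continuous_snd).aestronglyMeasurable
      (Eventually.of_forall fun z => hD' _)
  · refine mul_le_mul_of_nonneg_right ?_ (hη0 _)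
    rcases le_or_gt (w z) 0 with hz | hz
    · have := (hL k).eq_zero _ hz
      rw [this, mul_zero]
      exact hg0 z
    · exact (mul_le_mul_of_nonneg_right (hfg z hz) ((hL k).nonneg _)).trans
        (mul_le_of_le_one_right (hg0 z) ((hL k).le_one _))

end IsZeroDataSubsolution

lemma exists_decreasing_weight (C : ℝ) (b : ℝ) :
    ∃ η : ℝ → ℝ, ContDiff ℝ ∞ η ∧ HasCompactSupport η ∧ (∀ t, 0 ≤ η t) ∧
      (∀ t, b ≤ t → η t = 0) ∧ (∀ t, 0 < t → t < b → 0 < η t) ∧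
      ∀ t, 0 < t → C * η t ≤ -deriv η t := by
  refine ⟨fun t => Real.exp (-(C * t)) * Real.smoothTransition (b - t) *
    Real.smoothTransition (2 + t), ?_, ?_, ?_, ?_, ?_, ?_⟩
  · refine ContDiff.mul (ContDiff.mul (Real.contDiff_exp.comp (by fun_prop)) ?_) ?_
    · exact contDiff_smoothTransition.comp (by fun_prop)
    · exact contDiff_smoothTransition.comp (by fun_prop)
  · refine HasCompactSupport.intro (isCompact_Icc (a := -2) (b := b)) fun t ht => ?_
    rw [mem_Icc, not_and_or, not_le, not_le] at ht
    rcases ht with ht | ht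
    · exact mul_eq_zero_of_right _ (Real.smoothTransition.zero_of_nonpos (by linarith))
    · rw [Real.smoothTransition.zero_of_nonpos (x := b - t) (by linarith), mul_zero, zero_mul]
  · exact fun t => mul_nonneg (mul_nonneg (Real.exp_pos _).le (Real.smoothTransition.nonneg _))
      (Real.smoothTransition.nonneg _)
  · intro t ht
    simp only
    rw [Real.smoothTransition.zero_of_nonpos (x := b - t) (by linarith), mul_zero, zero_mul]
  · intro t ht htb
    exact mul_pos (mul_pos (Real.exp_pos _) (Real.smoothTransition.pos_of_pos (by linarith)))
      (Real.smoothTransition.pos_of_pos (by linarith))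
  · intro t ht
    have h1 : HasDerivAt (fun t => Real.exp (-(C * t)) * Real.smoothTransition (b - t))
        (Real.exp (-(C * t)) * (-(C * 1)) * Real.smoothTransition (b - t) +
          Real.exp (-(C * t)) * (deriv Real.smoothTransition (b - t) * (-1))) t := by
      refine HasDerivAt.mul ((hasDerivAt_id t).const_mul C).neg.exp ?_
      exact HasDerivAt.comp t (contDiff_smoothTransition.differentiable (by simp) _).hasDerivAt
        ((hasDerivAt_id t).const_sub b)
    have h2 : (fun t => Real.exp (-(C * t)) * Real.smoothTransition (b - t) *
        Real.smoothTransition (2 + t)) =ᶠ[𝓝 t]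
        fun t => Real.exp (-(C * t)) * Real.smoothTransition (b - t) := by
      filter_upwards [lt_mem_nhds ht] with s hs
      rw [Real.smoothTransition.one_of_one_le (x := 2 + s) (by linarith), mul_one]
    rw [(h1.congr_of_eventuallyEq h2).deriv]
    simp only
    rw [Real.smoothTransition.one_of_one_le (x := 2 + t)
      (by linarith), mul_one]
    have := mul_nonneg (Real.exp_pos (-(C * t))).le (deriv_smoothTransition_nonneg (b - t))
    linarith

/-- Two coupled subsolutions with nonpositive initial data, whose sources are controlled by the
positive part of the other, are nonpositive. -/
lemma IsZeroDataSubsolution.ae_nonpos {Ω : Set (Space n)} {T M C : ℝ} {w₁ f₁ w₂ f₂ : SpaceTime n → ℝ}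
    {G₁ G₂ : SpaceTime n → Space n} (h₁ : IsZeroDataSubsolution Ω T M w₁ f₁ G₁)
    (h₂ : IsZeroDataSubsolution Ω T M w₂ f₂ G₂) (hΩo : IsOpen Ω)
    (hΩb : Bornology.IsBounded Ω) (hcone : HasInteriorCones Ω) (hT : 0 < T) (hC : 0 ≤ C)
    (hf₁ : ∀ z, 0 < w₁ z → f₁ z ≤ C * max (w₂ z) 0)
    (hf₂ : ∀ z, 0 < w₂ z → f₂ z ≤ C * max (w₁ z) 0) :
    ∀ᵐ z, w₁ z ≤ 0 ∧ w₂ z ≤ 0 := by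
  have i₁ : Integrable (fun z => max (w₁ z) 0) := (h₁.integrable hΩo hΩb).pos_part
  have i₂ : Integrable (fun z => max (w₂ z) 0) := (h₂.integrable hΩo hΩb).pos_part
  set P : SpaceTime n → ℝ := fun z => max (w₁ z) 0 + max (w₂ z) 0 with hP
  have hPi : Integrable P := i₁.add i₂
  have hP0 : ∀ z, 0 ≤ P z := fun z => add_nonneg (le_max_right _ _) (le_max_right _ _)
  have hPz : ∀ z ∉ spaceTimeCylinder Ω T, P z = 0 := fun z hz => by
    simp [hP, h₁.eq_zero z hz, h₂.eq_zero z hz]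
  have key : ∀ b < T, ∀ᵐ z, z.2 < b → P z = 0 := by
    intro b hbT
    obtain ⟨η, hη, hηc, hη0, hηb, hηpos, hηd⟩ := exists_decreasing_weight (C + 1) b
    have hdc : Continuous (deriv η) := hη.continuous_deriv (by simp)
    obtain ⟨D, hD⟩ := hdc.bounded_above_of_compact_support hηc.deriv
    obtain ⟨D', hD'⟩ := hη.continuous.bounded_above_of_compact_support hηc
    have e₁ := h₁.integral_pos_part_mul_deriv_le hΩo hΩb hcone hT (i₂.const_mul C)
      (fun z => mul_nonneg hC (le_max_right _ _)) hf₁ hη hηc hη0 hbT hηb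
    have e₂ := h₂.integral_pos_part_mul_deriv_le hΩo hΩb hcone hT (i₁.const_mul C)
      (fun z => mul_nonneg hC (le_max_right _ _)) hf₂ hη hηc hη0 hbT hηb
    have hmul : ∀ {F : SpaceTime n → ℝ}, Integrable F → Integrable (fun z => F z * η z.2) :=
      fun hF => hF.mul_bdd (hη.continuous.comp continuous_snd).aestronglyMeasurable
        (Eventually.of_forall fun z => hD' _)
    have hmul' : ∀ {F : SpaceTime n → ℝ}, Integrable F → Integrable (fun z => F z * deriv η z.2) :=
      fun hF => hF.mul_bdd (hdc.comp continuous_snd).aestronglyMeasurable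
        (Eventually.of_forall fun z => hD _)
    have s1 : ∫ z, P z * deriv η z.2 =
        (∫ z, max (w₁ z) 0 * deriv η z.2) + ∫ z, max (w₂ z) 0 * deriv η z.2 := by
      rw [← integral_add (hmul' i₁) (hmul' i₂)]
      simp only [hP, add_mul]
    have s2 : C * ∫ z, P z * η z.2 =
        (∫ z, C * max (w₂ z) 0 * η z.2) + ∫ z, C * max (w₁ z) 0 * η z.2 := by
      rw [← integral_add (hmul (i₂.const_mul C)) (hmul (i₁.const_mul C)), ← integral_const_mul]
      congr 1
      ext1 z
      simp only [hP]; ring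
    have s3 : (C + 1) * ∫ z, P z * η z.2 ≤ -∫ z, P z * deriv η z.2 := by
      rw [← integral_neg, ← integral_const_mul]
      refine integral_mono ((hmul hPi).const_mul _) (hmul' hPi).neg fun z => ?_
      simp only
      by_cases hz : z ∈ spaceTimeCylinder Ω T
      · have := mul_le_mul_of_nonneg_left (hηd z.2 hz.2.1) (hP0 z)
        linarith
      · simp [hPz z hz]
    have s4 : ∫ z, P z * η z.2 = 0 := by
      refine le_antisymm ?_ (integral_nonneg fun z => mul_nonneg (hP0 z) (hη0 _))
      linarith
    rw [integral_eq_zero_iff_of_nonneg (fun z => mul_nonneg (hP0 z) (hη0 _)) (hmul hPi)] at s4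
    filter_upwards [s4] with z hz hzb
    by_cases hQ : z ∈ spaceTimeCylinder Ω T
    · exact (mul_eq_zero.1 hz).resolve_right (hηpos _ hQ.2.1 hzb).ne'
    · exact hPz z hQ
  have hall : ∀ᵐ z, ∀ k : ℕ, z.2 < T - 1 / ((k : ℝ) + 1) → P z = 0 :=
    ae_all_iff.2 fun k => key _ (by have : 0 < 1 / ((k : ℝ) + 1) := by positivity
                                    linarith)
  filter_upwards [hall] with z hz
  have hPz0 : P z = 0 := by
    by_cases hQ : z ∈ spaceTimeCylinder Ω T
    · obtain ⟨k, hk⟩ := exists_nat_one_div_lt (sub_pos.2 hQ.2.2)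
      exact hz k (by linarith)
    · exact hPz z hQ
  have h1 := le_max_left (w₁ z) 0
  have h2 := le_max_right (w₁ z) 0
  have h3 := le_max_left (w₂ z) 0
  have h4 := le_max_right (w₂ z) 0
  simp only [hP] at hPz0
  constructor <;> linarith

lemma ae_abs_le_of_memLp_top {α : Type*} [MeasurableSpace α] {μ : Measure α} {u : α → ℝ}
    (hu : MemLp u ⊤ μ) : ∀ᵐ z ∂μ, |u z| ≤ (eLpNorm u ⊤ μ).toReal := by
  have h1 := ae_le_eLpNormEssSup (f := u) (μ := μ)
  rw [← eLpNorm_exponent_top] at h1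
  filter_upwards [h1] with z hz
  have := ENNReal.toReal_mono hu.2.ne hz
  simpa using this

lemma exists_bounded_representative {Q : Set (SpaceTime n)} (hQ : MeasurableSet Q)
    {u : SpaceTime n → ℝ} (hu : MemLp u ⊤ (volume.restrict Q))
    (h0 : ∀ᵐ z ∂(volume.restrict Q), 0 ≤ u z) :
    ∃ (C : ℝ) (u₁ : SpaceTime n → ℝ), Measurable u₁ ∧ (∀ z, 0 ≤ u₁ z) ∧ (∀ z, u₁ z ≤ C) ∧
      (∀ z ∉ Q, u₁ z = 0) ∧ u₁ =ᵐ[volume.restrict Q] u := by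
  set C := (eLpNorm u ⊤ (volume.restrict Q)).toReal with hC
  have hC0 : 0 ≤ C := ENNReal.toReal_nonneg
  refine ⟨C, Q.indicator fun z => max 0 (min C (hu.1.mk u z)), ?_, fun z => ?_, fun z => ?_,
    fun z hz => indicator_of_notMem hz _, ?_⟩
  · exact (measurable_const.max (measurable_const.min
      hu.1.stronglyMeasurable_mk.measurable)).indicator hQ
  · exact indicator_nonneg (fun _ _ => le_max_left _ _) z
  · by_cases hz : z ∈ Q
    · rw [indicator_of_mem hz]
      exact max_le hC0 (min_le_left _ _)
    · rw [indicator_of_notMem hz]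
      exact hC0
  · filter_upwards [hu.1.ae_eq_mk, h0, ae_abs_le_of_memLp_top hu, ae_restrict_mem hQ]
      with z h1 h2 h3 h4
    rw [indicator_of_mem h4, ← h1, min_eq_right ((le_abs_self _).trans h3), max_eq_right h2]

lemma integral_eq_setIntegral_of_ae_eq {H : Type*} [NormedAddCommGroup H] [NormedSpace ℝ H]
    {Q : Set (SpaceTime n)} {a b : SpaceTime n → H} (h0 : ∀ z ∉ Q, a z = 0)
    (hab : a =ᵐ[volume.restrict Q] b) : ∫ z, a z = ∫ z in Q, b z := by
  rw [← setIntegral_eq_integral_of_forall_compl_eq_zero h0]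
  exact integral_congr_ae hab

lemma HasWeakSpaceGrad.ae_eq {Q : Set (SpaceTime n)} (hQ : IsOpen Q) {u : SpaceTime n → ℝ}
    {G G' : SpaceTime n → Space n} (h : HasWeakSpaceGrad Q u G) (h' : HasWeakSpaceGrad Q u G') :
    G =ᵐ[volume.restrict Q] G' := by
  have key := hQ.ae_eq_zero_of_integral_contDiff_smul_eq_zero (μ := volume)
    (h.locallyIntegrable_grad.sub h'.locallyIntegrable_grad) fun φ hφ hφc hφs => by
    have ht : IsTestFunction Q φ := ⟨hφ, hφc, hφs⟩
    have hint : ∀ {G : SpaceTime n → Space n}, LocallyIntegrableOn G Q →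
        Integrable (fun z => φ z • G z) := by
      intro G hG
      obtain ⟨D, -, hD⟩ := exists_norm_le_of_compact hφ.continuous hφc
      have h1 : IntegrableOn (fun z => φ z • G z) (tsupport φ) :=
        (hG.integrableOn_compact_subset hφs hφc).bdd_smul D hφ.continuous.aestronglyMeasurable
          (Eventually.of_forall hD)
      exact h1.integrable_of_forall_notMem_eq_zero fun z hz => by
        rw [image_eq_zero_of_notMem_tsupport hz, zero_smul]
    have e : ∀ {G : SpaceTime n → Space n}, ∫ z, φ z • G z = ∫ z in Q, φ z • G z := by
      intro G
      refine (setIntegral_eq_integral_of_forall_compl_eq_zero fun z hz => ?_).symm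
      rw [image_eq_zero_of_notMem_tsupport fun hm => hz (hφs hm), zero_smul]
    have h1 := h.integral_eq φ ht
    rw [h'.integral_eq φ ht, neg_inj, ← e, ← e] at h1
    simp only [Pi.sub_apply, smul_sub]
    rw [integral_sub (hint h.locallyIntegrable_grad) (hint h'.locallyIntegrable_grad), h1, sub_self]
  rw [EventuallyEq, ae_restrict_iff' hQ.measurableSet]
  filter_upwards [key] with z hz hzQ
  exact sub_eq_zero.1 (hz hzQ)

lemma exists_grad_representative {Ω : Set (Space n)} {T : ℝ} (hΩ : IsOpen Ω)
    {u u₁ : SpaceTime n → ℝ} (hu₁ : u₁ =ᵐ[volume.restrict (spaceTimeCylinder Ω T)] u)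
    (hu₁0 : ∀ z ∉ spaceTimeCylinder Ω T, u₁ z = 0) {G : SpaceTime n → Space n}
    (hu : MemU (spaceTimeCylinder Ω T) u)
    (hG : HasWeakSpaceGrad (spaceTimeCylinder Ω T) u G)
    (hGi : IntegrableOn G (spaceTimeCylinder Ω T)) :
    ∃ G₁ : SpaceTime n → Space n, Measurable G₁ ∧ (∀ z ∉ spaceTimeCylinder Ω T, G₁ z = 0) ∧
      G₁ =ᵐ[volume.restrict (spaceTimeCylinder Ω T)] G ∧ Integrable G₁ ∧
      (∀ τ > 0, MemLp G₁ 2 (volume.restrict {z | τ ≤ z.2})) ∧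
      ∀ φ, IsTestFunction (spaceTimeCylinder Ω T) φ →
        ∫ z, u₁ z • spaceGrad φ z = -∫ z, φ z • G₁ z := by
  set Q := spaceTimeCylinder Ω T with hQd
  have hQ : IsOpen Q := hΩ.prod isOpen_Ioo
  obtain ⟨G₂, hG₂, hG₂τ⟩ := hu.2.2
  have hGG := hG.ae_eq hQ hG₂
  set G₁ := Q.indicator (hGi.1.mk G) with hG₁
  have hm : StronglyMeasurable (hGi.1.mk G) := hGi.1.stronglyMeasurable_mk
  have h0 : ∀ z ∉ Q, G₁ z = 0 := fun z hz => indicator_of_notMem hz _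
  have hae : G₁ =ᵐ[volume.restrict Q] G := by
    filter_upwards [hGi.1.ae_eq_mk, ae_restrict_mem hQ.measurableSet] with z h1 h2
    rw [hG₁, indicator_of_mem h2, h1]
  refine ⟨G₁, hm.measurable.indicator hQ.measurableSet, h0, hae, ?_, fun τ hτ => ?_,
    fun φ hφ => ?_⟩
  · have h1 : IntegrableOn G₁ Q := Integrable.congr hGi hae.symm
    exact h1.integrable_of_forall_notMem_eq_zero h0
  · rw [hG₁, memLp_indicator_iff_restrict hQ.measurableSet,
      Measure.restrict_restrict hQ.measurableSet]
    have h1 : Q ∩ {z : SpaceTime n | τ ≤ z.2} = laterPart Q τ := rfl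
    rw [h1]
    refine (hG₂τ τ hτ).ae_eq ?_
    have h2 : laterPart Q τ ⊆ Q := fun z hz => hz.1
    have h3 := ae_restrict_of_ae_restrict_of_subset h2 (hGG.symm.trans hGi.1.ae_eq_mk)
    exact h3
  · have h1 := hG.integral_eq φ hφ
    rw [integral_eq_setIntegral_of_ae_eq (Q := Q) (b := fun z => u z • spaceGrad φ z)
        (fun z hz => by rw [hu₁0 z hz, zero_smul]) (hu₁.mono fun z hz => by simp only [hz]), h1,
      integral_eq_setIntegral_of_ae_eq (Q := Q) (b := fun z => φ z • G z)
        (fun z hz => by rw [h0 z hz, smul_zero]) (hae.mono fun z hz => by simp only [hz])]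

lemma IsZeroDataSubsolution.mono {Ω : Set (Space n)} {T M M' : ℝ} {w f : SpaceTime n → ℝ}
    {G : SpaceTime n → Space n} (hΩ : IsOpen Ω) (h : IsZeroDataSubsolution Ω T M w f G)
    (hM : M ≤ M') : IsZeroDataSubsolution Ω T M' w f G :=
  { h with
    abs_le := fun z => (h.abs_le z).trans hM
    abs_source_le := fun z => (h.abs_source_le z).trans hM
    weak_le := fun φ hφ hc h0 => (h.weak_le φ hφ hc h0).trans
      (mul_le_mul_of_nonneg_right hM (setIntegral_nonneg hΩ.measurableSet fun _ _ => h0 _)) }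

section Neumann

variable {Ω : Set (Space n)} {T : ℝ} {φ : SpaceTime n → ℝ}

lemma integrable_slice_mul {g : Space n → ℝ} (hΩb : Bornology.IsBounded Ω)
    (hg : MemLp g ⊤ (volume.restrict Ω)) (hφ : Continuous φ) (hc : HasCompactSupport φ) (t : ℝ) :
    Integrable (fun x => g x * φ (x, t)) (volume.restrict Ω) := by
  have : IsFiniteMeasure (volume.restrict Ω) := ⟨by simpa using hΩb.measure_lt_top⟩
  obtain ⟨D, -, hD⟩ := exists_norm_le_of_compact hφ hc
  exact (hg.integrable le_top).mul_bdd (hφ.comp (by fun_prop)).aestronglyMeasurable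
    (Eventually.of_forall fun x => hD (x, t))

/-- The space-time part of the weak formulation. -/
noncomputable def interiorForm (u f : SpaceTime n → ℝ) (G : SpaceTime n → Space n)
    (φ : SpaceTime n → ℝ) : ℝ :=
  ∫ z, (-(u z * timeDeriv φ z) + inner ℝ (G z) (spaceGrad φ z) + f z * φ z)

lemma interiorForm_eq {u f u₁ f₁ : SpaceTime n → ℝ} {G G₁ : SpaceTime n → Space n}
    (hu : u₁ =ᵐ[volume.restrict (spaceTimeCylinder Ω T)] u)
    (hf : f₁ =ᵐ[volume.restrict (spaceTimeCylinder Ω T)] f)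
    (hG : G₁ =ᵐ[volume.restrict (spaceTimeCylinder Ω T)] G)
    (hu0 : ∀ z ∉ spaceTimeCylinder Ω T, u₁ z = 0) (hf0 : ∀ z ∉ spaceTimeCylinder Ω T, f₁ z = 0)
    (hG0 : ∀ z ∉ spaceTimeCylinder Ω T, G₁ z = 0) :
    interiorForm u₁ f₁ G₁ φ = ∫ z in spaceTimeCylinder Ω T,
      (-(u z * timeDeriv φ z) + inner ℝ (G z) (spaceGrad φ z) + f z * φ z) := by
  refine integral_eq_setIntegral_of_ae_eq (fun z hz => ?_) ?_
  · rw [hu0 z hz, hf0 z hz, hG0 z hz]; simp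
  · filter_upwards [hu, hf, hG] with z h1 h2 h3
    rw [h1, h2, h3]

lemma interiorForm_sub {u f u' f' : SpaceTime n → ℝ} {G G' : SpaceTime n → Space n} {M : ℝ}
    (hu : Measurable u) (hu' : Measurable u') (hf : Measurable f) (hf' : Measurable f')
    (hG : Integrable G) (hG' : Integrable G') (huM : ∀ z, |u z| ≤ M) (huM' : ∀ z, |u' z| ≤ M)
    (hfM : ∀ z, |f z| ≤ M) (hfM' : ∀ z, |f' z| ≤ M) (hφ : ContDiff ℝ ∞ φ)
    (hc : HasCompactSupport φ) :
    ∫ z, (-((u' z - u z) * timeDeriv φ z) + inner ℝ (G' z - G z) (spaceGrad φ z) -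
      (f z - f' z) * φ z) = interiorForm u' f' G' φ - interiorForm u f G φ := by
  have h1 : ∀ {v g : SpaceTime n → ℝ} {H : SpaceTime n → Space n}, Measurable v → Measurable g →
      Integrable H → (∀ z, |v z| ≤ M) → (∀ z, |g z| ≤ M) → Integrable fun z =>
        (-(v z * timeDeriv φ z) + inner ℝ (H z) (spaceGrad φ z) + g z * φ z) :=
    fun hv hg hH hvM hgM =>
    ((integrable_mul_of_compact hv hvM (continuous_timeDeriv hφ)
      (hasCompactSupport_timeDeriv hφ hc)).neg.add
      (integrable_inner_of_compact hH (continuous_spaceGrad hφ)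
        (hasCompactSupport_spaceGrad hφ hc))).add
      (integrable_mul_of_compact hg hgM hφ.continuous hc)
  rw [interiorForm, interiorForm, ← integral_sub (h1 hu' hf' hG' huM' hfM') (h1 hu hf hG huM hfM)]
  congr 1
  ext1 z
  rw [inner_sub_left]
  ring

/-- The difference of a Neumann sub- and a Neumann supersolution with ordered initial values. -/
lemma exists_isZeroDataSubsolution_of_neumann (hΩ : IsOpen Ω) (hΩb : Bornology.IsBounded Ω)
    {M : ℝ} {u u' f f' u₁ u₁' f₁ f₁' : SpaceTime n → ℝ}
    (hu : MemU (spaceTimeCylinder Ω T) u) (hu' : MemU (spaceTimeCylinder Ω T) u')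
    (hsuper : IsNeumannSupersolution Ω T u f) (hsub : IsNeumannSubsolution Ω T u' f')
    (hinit : ∀ᵐ x ∂(volume.restrict Ω), u' (x, 0) ≤ u (x, 0))
    (hm : Measurable u₁) (hm' : Measurable u₁') (hfm : Measurable f₁) (hfm' : Measurable f₁')
    (huM : ∀ z, |u₁ z| ≤ M) (huM' : ∀ z, |u₁' z| ≤ M)
    (hfM : ∀ z, |f₁ z| ≤ M) (hfM' : ∀ z, |f₁' z| ≤ M)
    (hu0 : ∀ z ∉ spaceTimeCylinder Ω T, u₁ z = 0) (hu0' : ∀ z ∉ spaceTimeCylinder Ω T, u₁' z = 0)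
    (hf0 : ∀ z ∉ spaceTimeCylinder Ω T, f₁ z = 0) (hf0' : ∀ z ∉ spaceTimeCylinder Ω T, f₁' z = 0)
    (hue : u₁ =ᵐ[volume.restrict (spaceTimeCylinder Ω T)] u)
    (hue' : u₁' =ᵐ[volume.restrict (spaceTimeCylinder Ω T)] u')
    (hfe : f₁ =ᵐ[volume.restrict (spaceTimeCylinder Ω T)] f)
    (hfe' : f₁' =ᵐ[volume.restrict (spaceTimeCylinder Ω T)] f') :
    ∃ (M' : ℝ) (G : SpaceTime n → Space n), IsZeroDataSubsolution Ω T M'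
      (fun z => u₁' z - u₁ z) (fun z => f₁ z - f₁' z) G := by
  obtain ⟨htr0, htrT, -, G, hG, hGi, hform⟩ := hsuper
  obtain ⟨htr0', htrT', -, G', hG', hGi', hform'⟩ := hsub
  obtain ⟨G₁, hGm, hG0, hGe, hGint, hGτ, hGw⟩ := exists_grad_representative hΩ hue hu0 hu hG hGi
  obtain ⟨G₁', hGm', hG0', hGe', hGint', hGτ', hGw'⟩ :=
    exists_grad_representative hΩ hue' hu0' hu' hG' hGi'
  set M₁ := (eLpNorm (fun x => u (x, T)) ⊤ (volume.restrict Ω)).toReal with hM₁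
  set M₂ := (eLpNorm (fun x => u' (x, T)) ⊤ (volume.restrict Ω)).toReal with hM₂
  have hM0 : 0 ≤ M := (abs_nonneg _).trans (huM 0)
  have hM₁0 : 0 ≤ M₁ := ENNReal.toReal_nonneg
  have hM₂0 : 0 ≤ M₂ := ENNReal.toReal_nonneg
  have hTe := ae_abs_le_of_memLp_top htrT.1
  have hTe' := ae_abs_le_of_memLp_top htrT'.1
  refine ⟨M + M + M₁ + M₂, fun z => G₁' z - G₁ z, ?_⟩
  constructor
  · exact hm'.sub hm
  · exact hfm.sub hfm'
  · exact hGm'.sub hGm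
  · intro z
    have := (abs_sub (u₁' z) (u₁ z)).trans (add_le_add (huM' z) (huM z))
    linarith
  · intro z
    have := (abs_sub (f₁ z) (f₁' z)).trans (add_le_add (hfM z) (hfM' z))
    linarith
  · intro z hz
    rw [hu0 z hz, hu0' z hz, sub_self]
  · intro z hz
    rw [hf0 z hz, hf0' z hz, sub_self]
  · intro z hz
    rw [hG0 z hz, hG0' z hz, sub_self]
  · exact hGint'.sub hGint
  · exact fun τ hτ => (hGτ' τ hτ).sub (hGτ τ hτ)
  · intro φ hφ hc h0
    have k1 := hform φ hφ fun z _ => h0 z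
    have k2 := hform' φ hφ fun z _ => h0 z
    rw [neumannForm, ← interiorForm_eq hue hfe hGe hu0 hf0 hG0] at k1
    rw [neumannForm, ← interiorForm_eq hue' hfe' hGe' hu0' hf0' hG0'] at k2
    rw [interiorForm_sub hm hm' hfm hfm' hGint hGint' huM huM' hfM hfM' hφ hc]
    have b1 := integrable_slice_mul hΩb htrT.1 hφ.continuous hc T
    have b2 := integrable_slice_mul hΩb htr0.1 hφ.continuous hc 0
    have b3 := integrable_slice_mul hΩb htrT'.1 hφ.continuous hc T
    have b4 := integrable_slice_mul hΩb htr0'.1 hφ.continuous hc 0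
    have b5 : Integrable (fun x => (1 : ℝ) * φ (x, T)) (volume.restrict Ω) :=
      integrable_slice_mul hΩb (memLp_top_const 1) hφ.continuous hc T
    have k3 : (∫ x in Ω, (u (x, T) * φ (x, T) - u (x, 0) * φ (x, 0))) -
        ∫ x in Ω, (u' (x, T) * φ (x, T) - u' (x, 0) * φ (x, 0)) ≤
        (M + M + M₁ + M₂) * ∫ x in Ω, φ (x, T) := by
      have b12 : Integrable (fun x => u (x, T) * φ (x, T) - u (x, 0) * φ (x, 0))
        (volume.restrict Ω) := b1.sub b2
      have b34 : Integrable (fun x => u' (x, T) * φ (x, T) - u' (x, 0) * φ (x, 0))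
        (volume.restrict Ω) := b3.sub b4
      rw [← integral_sub b12 b34, ← integral_const_mul]
      simp only [one_mul] at b5
      refine integral_mono_ae (b12.sub b34) (b5.const_mul _) ?_
      filter_upwards [hTe, hTe', hinit] with x h1 h2 h3
      have e1 := mul_le_mul_of_nonneg_right ((le_abs_self _).trans h1) (h0 (x, T))
      have e2 := mul_le_mul_of_nonneg_right ((neg_le_abs _).trans h2) (h0 (x, T))
      have e3 := mul_le_mul_of_nonneg_right h3 (h0 (x, 0))
      have e4 := mul_nonneg hM0 (h0 (x, T))
      linarith
    linarith
  · refine Or.inr fun φ hφ => ?_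
    obtain ⟨D, -, hD⟩ := exists_norm_le_of_compact (continuous_spaceGrad hφ.contDiff)
      (hasCompactSupport_spaceGrad hφ.contDiff hφ.hasCompactSupport)
    obtain ⟨D', -, hD'⟩ := exists_norm_le_of_compact hφ.contDiff.continuous hφ.hasCompactSupport
    have i1 : ∀ {v : SpaceTime n → ℝ}, Measurable v → (∀ z, |v z| ≤ M) →
        (∀ z ∉ spaceTimeCylinder Ω T, v z = 0) → Integrable (fun z => v z • spaceGrad φ z) :=
      fun hv hvM hv0 => (IsZeroDataSubsolution.integrable_of_bounded hΩ hΩb hv hvM hv0).smul_bdd D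
        (continuous_spaceGrad hφ.contDiff).aestronglyMeasurable (Eventually.of_forall hD)
    have i2 : ∀ {H : SpaceTime n → Space n}, Integrable H → Integrable (fun z => φ z • H z) :=
      fun hH => hH.bdd_smul D' hφ.contDiff.continuous.aestronglyMeasurable
        (Eventually.of_forall hD')
    simp only [sub_smul, smul_sub]
    rw [integral_sub (i1 hm' huM' hu0') (i1 hm huM hu0), integral_sub (i2 hGint') (i2 hGint),
      hGw φ hφ, hGw' φ hφ]
    abel

end Neumann

section TimeStep

/-- A smooth function, `0` before `h` and `1` after `2h`, with derivative `initialBump h`. -/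
noncomputable def timeStep (h t : ℝ) : ℝ := 1 - Real.smoothTransition (2 - t / h)

lemma contDiff_timeStep (h : ℝ) : ContDiff ℝ ∞ (timeStep h) :=
  contDiff_const.sub (contDiff_smoothTransition.comp (contDiff_const.sub (contDiff_id.div_const h)))

lemma timeStep_nonneg (h t : ℝ) : 0 ≤ timeStep h t := sub_nonneg.2 (Real.smoothTransition.le_one _)

lemma timeStep_le_one (h t : ℝ) : timeStep h t ≤ 1 :=
  sub_le_self _ (Real.smoothTransition.nonneg _)

variable {h : ℝ}

lemma timeStep_eq_zero (hh : 0 < h) {t : ℝ} (ht : t ≤ h) : timeStep h t = 0 := by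
  have : t / h ≤ 1 := by rw [div_le_iff₀ hh]; linarith
  rw [timeStep, Real.smoothTransition.one_of_one_le (by linarith), sub_self]

lemma timeStep_eq_one (hh : 0 < h) {t : ℝ} (ht : 2 * h ≤ t) : timeStep h t = 1 := by
  have : 2 ≤ t / h := by rw [le_div_iff₀ hh]; linarith
  rw [timeStep, Real.smoothTransition.zero_of_nonpos (by linarith), sub_zero]

lemma hasDerivAt_timeStep (h t : ℝ) : HasDerivAt (timeStep h) (initialBump h t) t := by
  have h1 : HasDerivAt (fun t => Real.smoothTransition (2 - t / h))
      (deriv Real.smoothTransition (2 - t / h) * (-(1 / h))) t := by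
    refine HasDerivAt.comp t (contDiff_smoothTransition.differentiable (by simp) _).hasDerivAt ?_
    exact ((hasDerivAt_id t).div_const h).const_sub 2
  refine (h1.const_sub 1).congr_deriv ?_
  rw [initialBump]; ring

/-- A smooth cutoff in time, compactly supported in `(0, T)`. -/
noncomputable def cylinderCutoff (T h t : ℝ) : ℝ := timeStep h t * timeStep h (T - t)

lemma contDiff_cylinderCutoff (T h : ℝ) : ContDiff ℝ ∞ (cylinderCutoff T h) :=
  (contDiff_timeStep h).mul ((contDiff_timeStep h).comp (contDiff_const.sub contDiff_id))

lemma cylinderCutoff_nonneg (T h t : ℝ) : 0 ≤ cylinderCutoff T h t :=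
  mul_nonneg (timeStep_nonneg _ _) (timeStep_nonneg _ _)

lemma cylinderCutoff_le_one (T h t : ℝ) : cylinderCutoff T h t ≤ 1 :=
  mul_le_one₀ (timeStep_le_one _ _) (timeStep_nonneg _ _) (timeStep_le_one _ _)

lemma tsupport_cylinderCutoff_subset (T : ℝ) (hh : 0 < h) :
    tsupport (cylinderCutoff T h) ⊆ Ioo 0 T := by
  refine (closure_minimal (t := Icc h (T - h)) (fun t ht => ⟨?_, ?_⟩) isClosed_Icc).trans
    (Icc_subset_Ioo hh (by linarith))
  · by_contra hcon
    exact ht (mul_eq_zero_of_left (timeStep_eq_zero hh (not_le.1 hcon).le) _)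
  · by_contra hcon
    exact ht (mul_eq_zero_of_right _ (timeStep_eq_zero hh (by linarith [not_le.1 hcon])))

lemma tendsto_cylinderCutoff {T t : ℝ} (ht : t ∈ Ioo 0 T) :
    Tendsto (fun h => cylinderCutoff T h t) (𝓝[>] 0) (𝓝 1) := by
  have h1 : ∀ {s : ℝ}, 0 < s → ∀ᶠ h : ℝ in 𝓝[>] 0, timeStep h s = 1 := by
    intro s hs
    have h2 : ∀ᶠ h : ℝ in 𝓝[>] 0, h < s / 2 :=
      mem_nhdsWithin_of_mem_nhds (gt_mem_nhds (by positivity))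
    filter_upwards [h2, eventually_mem_nhdsWithin] with h hh hh0
    exact timeStep_eq_one hh0 (by linarith)
  refine tendsto_const_nhds.congr' ?_
  filter_upwards [h1 ht.1, h1 (sub_pos.2 ht.2)] with h e1 e2
  rw [cylinderCutoff, e1, e2, one_mul]

lemma hasDerivAt_cylinderCutoff {T : ℝ} (hh : 0 < h) (hT : 4 * h ≤ T) (t : ℝ) :
    HasDerivAt (cylinderCutoff T h) (initialBump h t - initialBump h (T - t)) t := by
  have h1 : HasDerivAt (fun t => timeStep h (T - t)) (initialBump h (T - t) * (-1)) t :=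
    HasDerivAt.comp t (h₂ := timeStep h) (hasDerivAt_timeStep h _) ((hasDerivAt_id t).const_sub T)
  refine ((hasDerivAt_timeStep h t).mul h1).congr_deriv ?_
  have e1 : initialBump h t * timeStep h (T - t) = initialBump h t := by
    by_cases ht : t ∈ Icc h (2 * h)
    · rw [timeStep_eq_one hh (by linarith [ht.2]), mul_one]
    · rw [initialBump_eq_zero hh ht, zero_mul]
  have e2 : timeStep h t * initialBump h (T - t) = initialBump h (T - t) := by
    by_cases ht : T - t ∈ Icc h (2 * h)
    · rw [timeStep_eq_one hh (by linarith [ht.2]), one_mul]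
    · rw [initialBump_eq_zero hh ht, mul_zero]
  linear_combination e1 - e2

end TimeStep

section InitialAverage

lemma initialBump_eq (h t : ℝ) : initialBump h t = initialBump 1 (t / h) / h := by
  simp [initialBump]

lemma deriv_initialBump (h t : ℝ) :
    deriv (initialBump h) t = deriv (initialBump 1) (t / h) / h ^ 2 := by
  have h1 : HasDerivAt (initialBump h) (deriv (initialBump 1) (t / h) * (1 / h) / h) t := by
    have h2 : initialBump h = fun t => initialBump 1 (t / h) / h := funext (initialBump_eq h)
    rw [h2]
    refine HasDerivAt.div_const (HasDerivAt.comp t (h₂ := initialBump 1)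
      ((contDiff_initialBump 1).differentiable (by simp) _).hasDerivAt
      ((hasDerivAt_id t).div_const h)) h
  rw [h1.deriv]
  ring

lemma integral_mul_deriv_initialBump : ∫ y, y * deriv (initialBump 1) y = -1 := by
  have hc := hasCompactSupport_initialBump one_pos
  have hd : Continuous (deriv (initialBump 1)) := (contDiff_initialBump 1).continuous_deriv (by simp)
  have := integral_mul_deriv_eq_deriv_mul_of_integrable (u := fun y : ℝ => y) (u' := fun _ => 1)
    (v := initialBump 1) (v' := deriv (initialBump 1)) (fun y _ => hasDerivAt_id y)
    (fun y _ => ((contDiff_initialBump 1).differentiable (by simp) y).hasDerivAt)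
    ((continuous_id.mul hd).integrable_of_hasCompactSupport hc.deriv.mul_left)
    ((continuous_const.mul (contDiff_initialBump 1).continuous).integrable_of_hasCompactSupport
      hc.mul_left)
    ((continuous_id.mul (contDiff_initialBump 1).continuous).integrable_of_hasCompactSupport
      hc.mul_left)
  rw [this]
  simp [integral_initialBump one_pos]

variable {g : SpaceTime n → ℝ}

lemma integral_mul_initialBump_eq (hg : Integrable g) {h : ℝ} (hh : 0 < h) :
    ∫ z, g z * initialBump h z.2 =
      -∫ s, deriv (initialBump h) s * ∫ z in {z : SpaceTime n | z.2 < s}, g z := by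
  have hd : Continuous (deriv (initialBump h)) := (contDiff_initialBump h).continuous_deriv (by simp)
  have hc := hasCompactSupport_initialBump hh
  have hdi : Integrable (deriv (initialBump h)) := hd.integrable_of_hasCompactSupport hc.deriv
  have hm : MeasurableSet {p : ℝ × SpaceTime n | p.2.2 < p.1} :=
    measurableSet_lt (measurable_snd.comp measurable_snd) measurable_fst
  have hi : Integrable (fun p : ℝ × SpaceTime n => {p : ℝ × SpaceTime n | p.2.2 < p.1}.indicator
      (fun p => deriv (initialBump h) p.1 * g p.2) p) (volume.prod volume) :=
    (hdi.mul_prod hg).indicator hm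
  have hswap := integral_integral_swap (f := fun s z => {p : ℝ × SpaceTime n |
    p.2.2 < p.1}.indicator (fun p => deriv (initialBump h) p.1 * g p.2) (s, z)) hi
  have e1 : ∀ s, ∫ z, {p : ℝ × SpaceTime n | p.2.2 < p.1}.indicator
      (fun p => deriv (initialBump h) p.1 * g p.2) (s, z) =
      deriv (initialBump h) s * ∫ z in {z : SpaceTime n | z.2 < s}, g z := by
    intro s
    rw [← integral_indicator (measurableSet_lt measurable_snd measurable_const),
      ← integral_const_mul]
    congr 1
    ext1 z
    by_cases hz : z.2 < s
    · rw [indicator_of_mem (by exact hz), indicator_of_mem (by exact hz)]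
    · rw [indicator_of_notMem (by exact hz), indicator_of_notMem (by exact hz), mul_zero]
  have e2 : ∀ z : SpaceTime n, ∫ s, {p : ℝ × SpaceTime n | p.2.2 < p.1}.indicator
      (fun p => deriv (initialBump h) p.1 * g p.2) (s, z) = -(g z * initialBump h z.2) := by
    intro z
    have h1 := hc.integral_Ioi_deriv_eq ((contDiff_initialBump h).of_le (by simp)) z.2
    rw [← mul_neg, ← h1, ← integral_indicator measurableSet_Ioi, ← integral_const_mul]
    congr 1
    ext1 s
    by_cases hz : z.2 < s
    · rw [indicator_of_mem (by exact hz), indicator_of_mem (by exact hz), mul_comm]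
    · rw [indicator_of_notMem (by exact hz), indicator_of_notMem (by exact hz), mul_zero]
  simp only [e1, e2] at hswap
  rw [hswap, integral_neg, neg_neg]

lemma measurable_integral_lt (hg : Measurable g) :
    Measurable fun s : ℝ => ∫ z in {z : SpaceTime n | z.2 < s}, g z := by
  have hm : MeasurableSet {p : ℝ × SpaceTime n | p.2.2 < p.1} :=
    measurableSet_lt (measurable_snd.comp measurable_snd) measurable_fst
  have h1 : StronglyMeasurable (fun p : ℝ × SpaceTime n =>
      {p : ℝ × SpaceTime n | p.2.2 < p.1}.indicator (fun p => g p.2) p) :=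
    ((hg.comp measurable_snd).indicator hm).stronglyMeasurable
  have h2 : Measurable fun s : ℝ => ∫ z, {p : ℝ × SpaceTime n | p.2.2 < p.1}.indicator
      (fun p => g p.2) (s, z) := h1.integral_prod_right'.measurable
  convert h2 using 2 with s
  rw [← integral_indicator (measurableSet_lt measurable_snd measurable_const)]
  rfl

/-- Convergence of the box averages at time `0⁺` implies convergence of the smooth averages. -/
lemma tendsto_integral_mul_initialBump (hgm : Measurable g) (hg : Integrable g) {α : ℝ}
    (hα : Tendsto (fun s : ℝ => s⁻¹ * ∫ z in {z : SpaceTime n | z.2 < s}, g z) (𝓝[>] 0) (𝓝 α)) :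
    Tendsto (fun h => ∫ z, g z * initialBump h z.2) (𝓝[>] 0) (𝓝 α) := by
  set J : ℝ → ℝ := fun s => ∫ z in {z : SpaceTime n | z.2 < s}, g z with hJ
  have hJm : Measurable J := measurable_integral_lt hgm
  set q := deriv (initialBump 1) with hq
  have hqc : Continuous q := (contDiff_initialBump 1).continuous_deriv (by simp)
  have hq0 : ∀ y ∉ Icc (1 : ℝ) 2, q y = 0 := by
    intro y hy
    have h1 : tsupport q ⊆ Icc 1 2 := (tsupport_deriv_subset (f := initialBump 1)).trans
      ((tsupport_initialBump_subset one_pos).trans_eq (by norm_num))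
    exact image_eq_zero_of_notMem_tsupport fun hm => hy (h1 hm)
  have hqs : HasCompactSupport q := (hasCompactSupport_initialBump one_pos).deriv
  have hform : ∀ h : ℝ, 0 < h → ∫ z, g z * initialBump h z.2 =
      -∫ y, y * q y * ((h * y)⁻¹ * J (h * y)) := by
    intro h hh
    rw [integral_mul_initialBump_eq hg hh]
    have h1 := Measure.integral_comp_div (fun y => q y / h ^ 2 * J (h * y)) h
    have h2 : ∀ s : ℝ, h * (s / h) = s := fun s => by field_simp
    simp only [h2] at h1
    have h3 : ∀ s, deriv (initialBump h) s = q (s / h) / h ^ 2 := deriv_initialBump h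
    simp only [h3]
    rw [h1, abs_of_pos hh, smul_eq_mul, ← integral_const_mul]
    congr 2
    ext1 y
    by_cases hy : y ∈ Icc (1 : ℝ) 2
    · have : y ≠ 0 := by linarith [hy.1]
      field_simp
    · rw [hq0 y hy]; simp
  have hlim : Tendsto (fun h : ℝ => ∫ y, y * q y * ((h * y)⁻¹ * J (h * y))) (𝓝[>] 0)
      (𝓝 (∫ y, y * q y * α)) := by
    obtain ⟨δ, hδ, hδα⟩ : ∃ δ > 0, ∀ s, 0 < s → s < δ → |s⁻¹ * J s| ≤ |α| + 1 := by
      have h1 : ∀ᶠ s : ℝ in 𝓝[>] 0, |s⁻¹ * J s| < |α| + 1 :=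
        (tendsto_order.1 hα.abs).2 _ (lt_add_one _)
      obtain ⟨δ, hδ, h2⟩ := mem_nhdsGT_iff_exists_Ioo_subset.1 h1
      exact ⟨δ, hδ, fun s hs hsδ => le_of_lt (h2 ⟨hs, hsδ⟩)⟩
    have hsmall : ∀ᶠ h : ℝ in 𝓝[>] 0, 0 < h ∧ h < δ / 2 :=
      eventually_mem_nhdsWithin.and
        (mem_nhdsWithin_of_mem_nhds (gt_mem_nhds (by positivity)))
    refine tendsto_integral_filter_of_dominated_convergence (fun y => ‖y * q y‖ * (|α| + 1))
      (Eventually.of_forall fun h => ?_) ?_ ?_ (Eventually.of_forall fun y => ?_)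
    · have := hqc.measurable
      exact Measurable.aestronglyMeasurable (by fun_prop)
    · filter_upwards [hsmall] with h hh
      refine Eventually.of_forall fun y => ?_
      rw [norm_mul]
      by_cases hy : y ∈ Icc (1 : ℝ) 2
      · refine mul_le_mul_of_nonneg_left (hδα _ ?_ ?_) (norm_nonneg _)
        · exact mul_pos hh.1 (by linarith [hy.1])
        · nlinarith [hy.2, hh.1, hh.2]
      · rw [hq0 y hy]; simp
    · exact ((continuous_id.mul hqc).integrable_of_hasCompactSupport
        hqs.mul_left).norm.mul_const _
    · by_cases hy : y ∈ Icc (1 : ℝ) 2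
      · have hy0 : 0 < y := by linarith [hy.1]
        refine (hα.comp ?_).const_mul (y * q y)
        refine tendsto_nhdsWithin_iff.2 ⟨?_, eventually_mem_nhdsWithin.mono fun h hh =>
          mul_pos hh hy0⟩
        exact ((continuous_id.mul continuous_const).tendsto' 0 0 (by simp)).mono_left
          nhdsWithin_le_nhds
      · simp [hq0 y hy]
  have hval : ∫ y, y * q y * α = -α := by
    rw [integral_mul_const, integral_mul_deriv_initialBump]; ring
  rw [hval] at hlim
  have := hlim.neg
  rw [neg_neg] at this
  exact this.congr' (eventually_mem_nhdsWithin.mono fun h hh => (hform h hh).symm)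

end InitialAverage

lemma exists_space_cutoffs {Ω : Set (Space n)} (hΩ : IsOpen Ω) (hΩb : Bornology.IsBounded Ω) :
    ∃ χ : ℕ → Space n → ℝ, (∀ k, IsTestFunction Ω (χ k)) ∧ (∀ k x, 0 ≤ χ k x) ∧
      (∀ k x, χ k x ≤ 1) ∧ ∀ x ∈ Ω, Tendsto (fun k => χ k x) atTop (𝓝 1) := by
  obtain ⟨f, hfs, hf, hf01⟩ := hΩ.exists_contDiff_support_eq (n := ⊤)
  have hf0 : ∀ x, 0 ≤ f x := fun x => (hf01 (mem_range_self x)).1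
  refine ⟨fun k x => Real.smoothTransition (k * f x - 1), fun k => ?_, fun k x =>
    Real.smoothTransition.nonneg _, fun k x => Real.smoothTransition.le_one _, fun x hx => ?_⟩
  · have hsub : tsupport (fun x => Real.smoothTransition (k * f x - 1)) ⊆ Ω := by
      have h1 : tsupport (fun x => Real.smoothTransition (k * f x - 1)) ⊆ {x | 1 ≤ k * f x} := by
        refine closure_minimal (fun x hx => ?_) (isClosed_le continuous_const
          (continuous_const.mul hf.continuous))
        by_contra hcon
        rw [mem_ofPred_eq, not_le] at hcon
        exact hx (Real.smoothTransition.zero_of_nonpos (by linarith))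
      intro x hx
      have h2 := h1 hx
      rw [mem_ofPred_eq] at h2
      rw [← hfs, Function.mem_support]
      intro h3
      rw [h3, mul_zero] at h2
      linarith
    refine ⟨contDiff_smoothTransition.comp ((contDiff_const.mul hf).sub contDiff_const), ?_, hsub⟩
    exact (hΩb.subset hsub).isCompact_closure.of_isClosed_subset (isClosed_tsupport _)
      subset_closure
  · rw [← hfs, Function.mem_support] at hx
    have hx0 : 0 < f x := lt_of_le_of_ne (hf0 x) hx.symm
    have h1 : ∀ᶠ k : ℕ in atTop, 2 ≤ (k : ℝ) * f x :=
      (tendsto_natCast_atTop_atTop.atTop_mul_const hx0).eventually_ge_atTop 2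
    refine tendsto_const_nhds.congr' ?_
    filter_upwards [h1] with k hk
    exact (Real.smoothTransition.one_of_one_le (by linarith)).symm

lemma timeDeriv_comp_snd_mul {θ : ℝ → ℝ} {a : SpaceTime n → ℝ} {d : ℝ} {z : SpaceTime n}
    (hθ : HasDerivAt θ d z.2) (ha : ContDiff ℝ ∞ a) :
    timeDeriv (fun z : SpaceTime n => θ z.2 * a z) z = d * a z + θ z.2 * timeDeriv a z :=
  (hθ.mul (hasDerivAt_timeDeriv ha z.1 z.2)).deriv

lemma timeDeriv_comp_fst_mul {χ : Space n → ℝ} {a : SpaceTime n → ℝ} (ha : ContDiff ℝ ∞ a)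
    (z : SpaceTime n) : timeDeriv (fun z : SpaceTime n => χ z.1 * a z) z = χ z.1 * timeDeriv a z :=
  ((hasDerivAt_timeDeriv ha z.1 z.2).const_mul (χ z.1)).deriv

lemma abs_sub_le_of_timeDeriv_le {a : SpaceTime n → ℝ} (ha : ContDiff ℝ ∞ a) {D : ℝ}
    (hD : ∀ z, ‖timeDeriv a z‖ ≤ D) (x : Space n) (s t : ℝ) :
    |a (x, t) - a (x, s)| ≤ D * |t - s| := by
  have := Convex.norm_image_sub_le_of_norm_hasDerivWithin_le (f := fun t => a (x, t))
    (f' := fun t => timeDeriv a (x, t)) (s := univ) (x := s) (y := t) (C := D)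
    (fun t _ => (hasDerivAt_timeDeriv ha x t).hasDerivWithinAt) (fun t _ => hD _) convex_univ
    (mem_univ _) (mem_univ _)
  simpa using this

lemma integral_mul_initialBump_reflect {h : ℝ} (hh : 0 < h) (T : ℝ) (g : Space n → ℝ) :
    ∫ z : SpaceTime n, g z.1 * initialBump h (T - z.2) = ∫ x, g x := by
  rw [Measure.volume_eq_prod, integral_prod_mul g fun t => initialBump h (T - t),
    integral_sub_left_eq_self (initialBump h) volume T, integral_initialBump hh, mul_one]

section TimeSubsolution

variable {Ω : Set (Space n)} {T M : ℝ} {w f : SpaceTime n → ℝ}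

lemma integral_le_of_time_subsolution (hΩ : IsOpen Ω) (hΩb : Bornology.IsBounded Ω) (hT : 0 < T)
    (hw : Measurable w) (hf : Measurable f) (hwM : ∀ z, |w z| ≤ M) (hfM : ∀ z, |f z| ≤ M)
    (hw0 : ∀ z ∉ spaceTimeCylinder Ω T, w z = 0) (hf0 : ∀ z ∉ spaceTimeCylinder Ω T, f z = 0)
    (hweak : ∀ φ, IsTestFunction (spaceTimeCylinder Ω T) φ → (∀ z, 0 ≤ φ z) →
      ∫ z, (-(w z * timeDeriv φ z) - f z * φ z) ≤ 0)
    (htrace : ∀ ψ, IsTestFunction Ω ψ → (∀ x, 0 ≤ ψ x) → ∃ α ≤ 0, Tendsto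
      (fun s : ℝ => s⁻¹ * ∫ z in {z : SpaceTime n | z.2 < s}, w z * ψ z.1) (𝓝[>] 0) (𝓝 α))
    {a : SpaceTime n → ℝ} (ha : IsTestFunction (Ω ×ˢ univ) a) (ha0 : ∀ z, 0 ≤ a z) :
    ∫ z, (-(w z * timeDeriv a z) - f z * a z) ≤ M * ∫ x in Ω, a (x, T) := by
  have has := ha.contDiff
  have hac := ha.hasCompactSupport
  have hM : 0 ≤ M := (abs_nonneg _).trans (hwM 0)
  obtain ⟨D, hD0, hD⟩ := exists_norm_le_of_compact (continuous_timeDeriv has)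
    (hasCompactSupport_timeDeriv has hac)
  obtain ⟨D', -, hD'⟩ := exists_norm_le_of_compact has.continuous hac
  have haz : ∀ z : SpaceTime n, z.1 ∉ Ω → a z = 0 := fun z hz =>
    image_eq_zero_of_notMem_tsupport fun hm => hz (ha.tsupport_subset hm).1
  have hwz : ∀ z : SpaceTime n, z.1 ∉ Ω → w z = 0 := fun z hz => hw0 z fun hm => hz hm.1
  have hslice : ∀ t, Integrable fun x => a (x, t) := fun t =>
    integrable_of_bounded_of_support hΩb ((has.continuous.comp (by fun_prop)).measurable)
      (fun x => hD' (x, t)) fun x hx => haz _ hx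
  have h1i : Integrable (Ω.indicator (fun _ => (1 : ℝ))) :=
    (integrable_indicator_iff hΩ.measurableSet).2 (integrableOn_const hΩb.measure_lt_top.ne)
  have h1v : ∫ x, Ω.indicator (fun _ => (1 : ℝ)) x = volume.real Ω := by
    rw [integral_indicator hΩ.measurableSet, setIntegral_const, smul_eq_mul, mul_one]
  have hψ : IsTestFunction Ω fun x => a (x, 0) := by
    have hcl : tsupport (fun x => a (x, 0)) ⊆ (fun x => (x, (0 : ℝ))) ⁻¹' tsupport a :=
      closure_minimal (fun x hx => subset_tsupport a hx)
        ((isClosed_tsupport _).preimage (by fun_prop))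
    refine ⟨has.comp (contDiff_id.prodMk contDiff_const), ?_, fun x hx =>
      (ha.tsupport_subset (hcl hx)).1⟩
    exact (hac.isCompact.image continuous_fst).of_isClosed_subset (isClosed_tsupport _)
      fun x hx => ⟨(x, 0), hcl hx, rfl⟩
  obtain ⟨α, hα, hαt⟩ := htrace _ hψ fun x => ha0 _
  have hwi := IsZeroDataSubsolution.integrable_of_bounded hΩ hΩb hw hwM hw0
  have hgm : Measurable fun z : SpaceTime n => w z * a (z.1, 0) :=
    hw.mul (has.continuous.comp (by fun_prop)).measurable
  have hgi : Integrable fun z : SpaceTime n => w z * a (z.1, 0) :=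
    hwi.mul_bdd (has.continuous.comp (by fun_prop)).aestronglyMeasurable
      (Eventually.of_forall fun z => hD' (z.1, 0))
  have hinit := tendsto_integral_mul_initialBump hgm hgi hαt
  have i0 : Integrable fun z => -(w z * timeDeriv a z) - f z * a z :=
    (integrable_mul_of_compact hw hwM (continuous_timeDeriv has)
      (hasCompactSupport_timeDeriv has hac)).neg.sub
      (integrable_mul_of_compact hf hfM has.continuous hac)
  have hstep : ∀ h, 0 < h → 4 * h ≤ T →
      ∫ z, cylinderCutoff T h z.2 * (-(w z * timeDeriv a z) - f z * a z) ≤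
      (∫ z, w z * a (z.1, 0) * initialBump h z.2) + M * (∫ x in Ω, a (x, T)) +
        4 * M * D * h * volume.real Ω := by
    intro h hh hhT
    have hθ := contDiff_cylinderCutoff T h
    have hp := contDiff_initialBump h
    have hpi : Integrable (initialBump h) :=
      hp.continuous.integrable_of_hasCompactSupport (hasCompactSupport_initialBump hh)
    have hpi' : Integrable fun t => initialBump h (T - t) := hpi.comp_sub_left T
    have hΦs : ContDiff ℝ ∞ fun z : SpaceTime n => cylinderCutoff T h z.2 * a z :=
      (hθ.comp contDiff_snd).mul has
    have hΦ : IsTestFunction (spaceTimeCylinder Ω T)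
        fun z : SpaceTime n => cylinderCutoff T h z.2 * a z :=
      ⟨hΦs, hac.mul_left, fun z hz => ⟨(ha.tsupport_subset (tsupport_mul_subset_right hz)).1,
        tsupport_cylinderCutoff_subset T hh
          (tsupport_comp_snd_subset _ (tsupport_mul_subset_left hz))⟩⟩
    have k1 := hweak _ hΦ fun z => mul_nonneg (cylinderCutoff_nonneg _ _ _) (ha0 z)
    have iΦ : Integrable fun z => -(w z * timeDeriv (fun z : SpaceTime n =>
        cylinderCutoff T h z.2 * a z) z) - f z * (cylinderCutoff T h z.2 * a z) :=
      (integrable_mul_of_compact hw hwM (continuous_timeDeriv hΦs)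
        (hasCompactSupport_timeDeriv hΦs hΦ.hasCompactSupport)).neg.sub
        (integrable_mul_of_compact hf hfM hΦs.continuous hΦ.hasCompactSupport)
    have iL : Integrable fun z => cylinderCutoff T h z.2 * (-(w z * timeDeriv a z) - f z * a z) :=
      i0.bdd_mul (c := 1) (hθ.continuous.comp continuous_snd).aestronglyMeasurable
        (Eventually.of_forall fun z => by
          rw [Real.norm_eq_abs, abs_of_nonneg (cylinderCutoff_nonneg _ _ _)]
          exact cylinderCutoff_le_one _ _ _)
    have i1 : Integrable fun z : SpaceTime n => w z * a (z.1, 0) * initialBump h z.2 := by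
      refine integrable_of_support_prod hΩb hp.continuous (hasCompactSupport_initialBump hh)
        (D := M * D') hgm (fun z => ?_) fun z hz => by rw [hwz z hz, zero_mul]
      rw [abs_mul]
      exact mul_le_mul (hwM z) (hD' _) (abs_nonneg _) hM
    have i2 : Integrable fun z : SpaceTime n => a (z.1, T) * initialBump h (T - z.2) :=
      (hslice T).mul_prod hpi'
    have i3 : Integrable fun z : SpaceTime n =>
        Ω.indicator (fun _ => (1 : ℝ)) z.1 * initialBump h z.2 := h1i.mul_prod hpi
    have i4 : Integrable fun z : SpaceTime n =>
        Ω.indicator (fun _ => (1 : ℝ)) z.1 * initialBump h (T - z.2) := h1i.mul_prod hpi'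
    have hpt : ∀ z : SpaceTime n,
        cylinderCutoff T h z.2 * (-(w z * timeDeriv a z) - f z * a z) ≤
        (-(w z * timeDeriv (fun z : SpaceTime n => cylinderCutoff T h z.2 * a z) z) -
          f z * (cylinderCutoff T h z.2 * a z)) + w z * a (z.1, 0) * initialBump h z.2 +
        M * (a (z.1, T) * initialBump h (T - z.2)) +
        2 * M * D * h * (Ω.indicator (fun _ => (1 : ℝ)) z.1 * initialBump h z.2) +
        2 * M * D * h * (Ω.indicator (fun _ => (1 : ℝ)) z.1 * initialBump h (T - z.2)) := by
      rintro ⟨x, t⟩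
      rw [timeDeriv_comp_snd_mul (z := (x, t)) (hasDerivAt_cylinderCutoff hh hhT t) has]
      have hp0 := initialBump_nonneg hh t
      have hp0' := initialBump_nonneg hh (T - t)
      by_cases hx : x ∈ Ω
      · simp only [indicator_of_mem hx, one_mul]
        have e1 : w (x, t) * a (x, t) * initialBump h t ≤
            w (x, t) * a (x, 0) * initialBump h t + 2 * M * D * h * initialBump h t := by
          by_cases ht : t ∈ Icc h (2 * h)
          · have b1 := abs_sub_le_of_timeDeriv_le has hD x 0 t
            rw [sub_zero, abs_of_nonneg (hh.le.trans ht.1)] at b1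
            have b2 : w (x, t) * (a (x, t) - a (x, 0)) ≤ M * (D * (2 * h)) := by
              refine (le_abs_self _).trans ?_
              rw [abs_mul]
              exact mul_le_mul (hwM _) (b1.trans (mul_le_mul_of_nonneg_left ht.2 hD0))
                (abs_nonneg _) hM
            have b3 := mul_le_mul_of_nonneg_right b2 hp0
            linarith
          · simp [initialBump_eq_zero hh ht]
        have e2 : -(w (x, t) * a (x, t) * initialBump h (T - t)) ≤
            M * (a (x, T) * initialBump h (T - t)) +
              2 * M * D * h * initialBump h (T - t) := by
          by_cases ht : T - t ∈ Icc h (2 * h)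
          · have b1 := abs_sub_le_of_timeDeriv_le has hD x T t
            rw [abs_sub_comm t T, abs_of_nonneg (hh.le.trans ht.1)] at b1
            have b2 : a (x, t) ≤ a (x, T) + D * (2 * h) := by
              have := (le_abs_self _).trans (b1.trans (mul_le_mul_of_nonneg_left ht.2 hD0))
              linarith
            have b3 : -(w (x, t) * a (x, t)) ≤ M * (a (x, T) + D * (2 * h)) := by
              refine le_trans ?_ (mul_le_mul_of_nonneg_left b2 hM)
              have := mul_le_mul_of_nonneg_right ((neg_le_abs _).trans (hwM (x, t))) (ha0 (x, t))
              linarith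
            have b4 := mul_le_mul_of_nonneg_right b3 hp0'
            linarith
          · simp [initialBump_eq_zero hh ht]
        linarith
      · rw [hwz (x, t) hx, haz (x, t) hx, haz (x, T) hx, indicator_of_notMem hx]
        simp
    have hI12 := iΦ.add i1
    have hI123 := hI12.add (i2.const_mul M)
    have hI1234 := hI123.add (i3.const_mul (2 * M * D * h))
    have hmono := integral_mono iL (hI1234.add (i4.const_mul (2 * M * D * h))) hpt
    have s1 := integral_add hI1234 (i4.const_mul (2 * M * D * h))
    have s2 := integral_add hI123 (i3.const_mul (2 * M * D * h))
    have s3 := integral_add hI12 (i2.const_mul M)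
    have s4 := integral_add iΦ i1
    simp only [Pi.add_apply] at s1 s2 s3 s4 hmono
    have r2 : ∫ z : SpaceTime n, a (z.1, T) * initialBump h (T - z.2) = ∫ x in Ω, a (x, T) := by
      rw [integral_mul_initialBump_reflect hh T fun x => a (x, T)]
      exact (setIntegral_eq_integral_of_forall_compl_eq_zero fun x hx => haz (x, T) hx).symm
    rw [s1, s2, s3, s4, integral_const_mul, integral_const_mul, integral_const_mul, r2,
      integral_mul_initialBump hh, integral_mul_initialBump_reflect hh, h1v] at hmono
    linarith
  have hlhs : Tendsto (fun h => ∫ z, cylinderCutoff T h z.2 *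
      (-(w z * timeDeriv a z) - f z * a z)) (𝓝[>] 0)
      (𝓝 (∫ z, (-(w z * timeDeriv a z) - f z * a z))) := by
    refine tendsto_integral_filter_of_dominated_convergence
      (fun z => ‖-(w z * timeDeriv a z) - f z * a z‖)
      (Eventually.of_forall fun h => ?_) (Eventually.of_forall fun h => Eventually.of_forall
        fun z => ?_) i0.norm (Eventually.of_forall fun z => ?_)
    · exact ((contDiff_cylinderCutoff T h).continuous.comp continuous_snd).aestronglyMeasurable.mul
        i0.1
    · rw [norm_mul]
      refine mul_le_of_le_one_left (norm_nonneg _) ?_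
      rw [Real.norm_eq_abs, abs_of_nonneg (cylinderCutoff_nonneg _ _ _)]
      exact cylinderCutoff_le_one _ _ _
    · by_cases hz : z ∈ spaceTimeCylinder Ω T
      · simpa using (tendsto_cylinderCutoff hz.2).mul_const (-(w z * timeDeriv a z) - f z * a z)
      · simp [hw0 z hz, hf0 z hz]
  have hrhs : Tendsto (fun h => (∫ z, w z * a (z.1, 0) * initialBump h z.2) +
      M * (∫ x in Ω, a (x, T)) + 4 * M * D * h * volume.real Ω) (𝓝[>] 0)
      (𝓝 (α + M * (∫ x in Ω, a (x, T)) + 4 * M * D * 0 * volume.real Ω)) := by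
    refine (hinit.add tendsto_const_nhds).add ?_
    exact (Continuous.tendsto (by fun_prop) 0).mono_left nhdsWithin_le_nhds
  have hev : ∀ᶠ h : ℝ in 𝓝[>] 0, 0 < h ∧ 4 * h ≤ T := by
    refine eventually_mem_nhdsWithin.and (mem_nhdsWithin_of_mem_nhds ?_)
    filter_upwards [gt_mem_nhds (show (0 : ℝ) < T / 4 by positivity)] with s hs
    linarith
  have := le_of_tendsto_of_tendsto hlhs hrhs (hev.mono fun h hh => hstep h hh.1 hh.2)
  rw [mul_zero, zero_mul, add_zero] at this
  linarith

lemma isZeroDataSubsolution_of_time (hΩ : IsOpen Ω) (hΩb : Bornology.IsBounded Ω) (hT : 0 < T)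
    (hw : Measurable w) (hf : Measurable f) (hwM : ∀ z, |w z| ≤ M) (hfM : ∀ z, |f z| ≤ M)
    (hw0 : ∀ z ∉ spaceTimeCylinder Ω T, w z = 0) (hf0 : ∀ z ∉ spaceTimeCylinder Ω T, f z = 0)
    (hweak : ∀ φ, IsTestFunction (spaceTimeCylinder Ω T) φ → (∀ z, 0 ≤ φ z) →
      ∫ z, (-(w z * timeDeriv φ z) - f z * φ z) ≤ 0)
    (htrace : ∀ ψ, IsTestFunction Ω ψ → (∀ x, 0 ≤ ψ x) → ∃ α ≤ 0, Tendsto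
      (fun s : ℝ => s⁻¹ * ∫ z in {z : SpaceTime n | z.2 < s}, w z * ψ z.1) (𝓝[>] 0) (𝓝 α)) :
    IsZeroDataSubsolution Ω T M w f (fun _ => 0) where
  measurable := hw
  measurable_source := hf
  measurable_grad := measurable_const
  abs_le := hwM
  abs_source_le := hfM
  eq_zero := hw0
  source_eq_zero := hf0
  grad_eq_zero _ _ := rfl
  integrable_grad := integrable_zero _ _ _
  memLp_grad _ _ := MemLp.zero'
  grad_eq := Or.inl fun _ => rfl
  weak_le φ hφ hc h0 := by
    have hM : 0 ≤ M := (abs_nonneg _).trans (hwM 0)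
    obtain ⟨χ, hχ, hχ0, hχ1, hχt⟩ := exists_space_cutoffs hΩ hΩb
    have i0 : Integrable fun z => -(w z * timeDeriv φ z) - f z * φ z :=
      (integrable_mul_of_compact hw hwM (continuous_timeDeriv hφ)
        (hasCompactSupport_timeDeriv hφ hc)).neg.sub
        (integrable_mul_of_compact hf hfM hφ.continuous hc)
    have hk : ∀ k, ∫ z, χ k z.1 * (-(w z * timeDeriv φ z) - f z * φ z) ≤
        M * ∫ x in Ω, φ (x, T) := by
      intro k
      have ha : IsTestFunction (Ω ×ˢ univ) fun z : SpaceTime n => χ k z.1 * φ z := by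
        refine ⟨((hχ k).contDiff.comp contDiff_fst).mul hφ, hc.mul_left, fun z hz =>
          ⟨(hχ k).tsupport_subset ?_, mem_univ _⟩⟩
        have h1 : tsupport (fun z : SpaceTime n => χ k z.1) ⊆ Prod.fst ⁻¹' tsupport (χ k) :=
          closure_minimal (fun z hz => subset_tsupport (χ k) hz)
            ((isClosed_tsupport _).preimage continuous_fst)
        exact h1 (tsupport_mul_subset_left hz)
      have k1 := integral_le_of_time_subsolution hΩ hΩb hT hw hf hwM hfM hw0 hf0 hweak htrace ha
        fun z => mul_nonneg (hχ0 _ _) (h0 z)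
      have e : ∀ z : SpaceTime n, -(w z * timeDeriv (fun z : SpaceTime n => χ k z.1 * φ z) z) -
          f z * (χ k z.1 * φ z) = χ k z.1 * (-(w z * timeDeriv φ z) - f z * φ z) := fun z => by
        rw [timeDeriv_comp_fst_mul hφ]; ring
      simp only [e] at k1
      refine k1.trans (mul_le_mul_of_nonneg_left ?_ hM)
      have hi : Integrable (fun x => (1 : ℝ) * φ (x, T)) (volume.restrict Ω) :=
        integrable_slice_mul hΩb (memLp_top_const 1) hφ.continuous hc T
      simp only [one_mul] at hi
      exact integral_mono_of_nonneg (Eventually.of_forall fun x => mul_nonneg (hχ0 _ _) (h0 _)) hi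
        (Eventually.of_forall fun x => mul_le_of_le_one_left (h0 _) (hχ1 _ _))
    have hlim : Tendsto (fun k => ∫ z, χ k z.1 * (-(w z * timeDeriv φ z) - f z * φ z)) atTop
        (𝓝 (∫ z, (-(w z * timeDeriv φ z) - f z * φ z))) := by
      refine tendsto_integral_of_dominated_convergence
        (fun z => ‖-(w z * timeDeriv φ z) - f z * φ z‖) (fun k => ?_) i0.norm
        (fun k => Eventually.of_forall fun z => ?_) (Eventually.of_forall fun z => ?_)
      · exact ((hχ k).contDiff.continuous.comp continuous_fst).aestronglyMeasurable.mul i0.1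
      · rw [norm_mul]
        refine mul_le_of_le_one_left (norm_nonneg _) ?_
        rw [Real.norm_eq_abs, abs_of_nonneg (hχ0 _ _)]
        exact hχ1 _ _
      · by_cases hz : z ∈ spaceTimeCylinder Ω T
        · simpa using (hχt z.1 hz.1).mul_const (-(w z * timeDeriv φ z) - f z * φ z)
        · simp [hw0 z hz, hf0 z hz]
    simpa using le_of_tendsto' hlim hk

/-- The difference of a sub- and a supersolution in time with ordered initial values. -/
lemma exists_isZeroDataSubsolution_of_time (hΩ : IsOpen Ω) (hΩb : Bornology.IsBounded Ω)
    (hT : 0 < T) {v v' g g' v₁ v₁' g₁ g₁' : SpaceTime n → ℝ}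
    (hsub : IsTimeSubsolution (spaceTimeCylinder Ω T) v g)
    (hsuper : IsTimeSupersolution (spaceTimeCylinder Ω T) v' g')
    (htr : HasInitialTrace Ω v) (htr' : HasInitialTrace Ω v')
    (hinit : ∀ᵐ x ∂(volume.restrict Ω), v (x, 0) ≤ v' (x, 0))
    (hm : Measurable v₁) (hm' : Measurable v₁') (hgm : Measurable g₁) (hgm' : Measurable g₁')
    (hvM : ∀ z, |v₁ z| ≤ M) (hvM' : ∀ z, |v₁' z| ≤ M)
    (hgM : ∀ z, |g₁ z| ≤ M) (hgM' : ∀ z, |g₁' z| ≤ M)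
    (hv0 : ∀ z ∉ spaceTimeCylinder Ω T, v₁ z = 0) (hv0' : ∀ z ∉ spaceTimeCylinder Ω T, v₁' z = 0)
    (hg0 : ∀ z ∉ spaceTimeCylinder Ω T, g₁ z = 0) (hg0' : ∀ z ∉ spaceTimeCylinder Ω T, g₁' z = 0)
    (hve : v₁ =ᵐ[volume.restrict (spaceTimeCylinder Ω T)] v)
    (hve' : v₁' =ᵐ[volume.restrict (spaceTimeCylinder Ω T)] v')
    (hge : g₁ =ᵐ[volume.restrict (spaceTimeCylinder Ω T)] g)
    (hge' : g₁' =ᵐ[volume.restrict (spaceTimeCylinder Ω T)] g') :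
    IsZeroDataSubsolution Ω T (M + M) (fun z => v₁ z - v₁' z) (fun z => g₁' z - g₁ z)
      (fun _ => 0) := by
  refine isZeroDataSubsolution_of_time hΩ hΩb hT (hm.sub hm') (hgm'.sub hgm)
    (fun z => (abs_sub _ _).trans (add_le_add (hvM z) (hvM' z)))
    (fun z => (abs_sub _ _).trans (add_le_add (hgM' z) (hgM z)))
    (fun z hz => by rw [hv0 z hz, hv0' z hz, sub_self])
    (fun z hz => by rw [hg0 z hz, hg0' z hz, sub_self]) (fun φ hφ h0 => ?_) fun ψ hψ h0 => ?_
  · have k1 := hsub.2 φ hφ h0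
    have k2 := hsuper.2 φ hφ h0
    have e1 : interiorForm v₁ g₁ (fun _ => 0) φ =
        ∫ z in spaceTimeCylinder Ω T, (-(v z * timeDeriv φ z) + g z * φ z) := by
      rw [interiorForm_eq (G := fun _ => 0) hve hge (EventuallyEq.refl _ _) hv0 hg0 fun _ _ => rfl]
      simp
    have e2 : interiorForm v₁' g₁' (fun _ => 0) φ =
        ∫ z in spaceTimeCylinder Ω T, (-(v' z * timeDeriv φ z) + g' z * φ z) := by
      rw [interiorForm_eq (G := fun _ => 0) hve' hge' (EventuallyEq.refl _ _) hv0' hg0'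
        fun _ _ => rfl]
      simp
    have e3 := interiorForm_sub (G := fun _ => 0) (G' := fun _ => 0) hm' hm hgm' hgm
      (integrable_zero _ _ _) (integrable_zero _ _ _) hvM' hvM hgM' hgM hφ.contDiff
      hφ.hasCompactSupport
    simp only [sub_self, inner_zero_left, add_zero] at e3
    linarith
  · have htend := (htr.2 ψ hψ).sub (htr'.2 ψ hψ)
    refine ⟨_, ?_, htend.congr' ?_⟩
    · obtain ⟨D, hD⟩ := hψ.contDiff.continuous.bounded_above_of_compact_support
        hψ.hasCompactSupport
      have : IsFiniteMeasure (volume.restrict Ω) := ⟨by simpa using hΩb.measure_lt_top⟩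
      have hi : ∀ {p : Space n → ℝ}, MemLp p ⊤ (volume.restrict Ω) →
          Integrable (fun x => p x * ψ x) (volume.restrict Ω) := fun hp =>
        (hp.integrable le_top).mul_bdd hψ.contDiff.continuous.aestronglyMeasurable
          (Eventually.of_forall hD)
      rw [sub_nonpos]
      refine integral_mono_ae (hi htr.1) (hi htr'.1) ?_
      filter_upwards [hinit] with x hx
      exact mul_le_mul_of_nonneg_right hx (h0 x)
    · have hsT : ∀ᶠ s : ℝ in 𝓝[>] 0, s < T := mem_nhdsWithin_of_mem_nhds (gt_mem_nhds hT)
      filter_upwards [hsT] with s hs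
      have hset : MeasurableSet (Ω ×ˢ Ioo 0 s : Set (SpaceTime n)) :=
        hΩ.measurableSet.prod measurableSet_Ioo
      have hsub : (Ω ×ˢ Ioo 0 s : Set (SpaceTime n)) ⊆ spaceTimeCylinder Ω T :=
        prod_mono_right (Ioo_subset_Ioo_right hs.le)
      obtain ⟨D, hD⟩ := hψ.contDiff.continuous.bounded_above_of_compact_support
        hψ.hasCompactSupport
      have hi : ∀ {p : SpaceTime n → ℝ}, Measurable p → (∀ z, |p z| ≤ M) →
          (∀ z ∉ spaceTimeCylinder Ω T, p z = 0) → Integrable (fun z => p z * ψ z.1) :=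
        fun hp hpM hp0 =>
          (IsZeroDataSubsolution.integrable_of_bounded hΩ hΩb hp hpM hp0).mul_bdd
            (hψ.contDiff.continuous.comp continuous_fst).aestronglyMeasurable
            (Eventually.of_forall fun z => hD z.1)
      have e1 : ∀ {p q : SpaceTime n → ℝ}, p =ᵐ[volume.restrict (spaceTimeCylinder Ω T)] q →
          ∫ z in Ω ×ˢ Ioo 0 s, q z * ψ z.1 = ∫ z in Ω ×ˢ Ioo 0 s, p z * ψ z.1 := fun hpq =>
        integral_congr_ae ((ae_restrict_of_ae_restrict_of_subset hsub hpq).mono fun z hz => by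
          simp only [hz])
      rw [← mul_sub, e1 hve, e1 hve', ← integral_sub (hi hm hvM hv0).integrableOn
        (hi hm' hvM' hv0').integrableOn]
      congr 1
      simp only [← sub_mul]
      refine (setIntegral_eq_of_subset_of_forall_sdiff_eq_zero
        (measurableSet_lt measurable_snd measurable_const) (fun z hz => hz.2.2) fun z hz => ?_).symm
      have hz' : z ∉ spaceTimeCylinder Ω T := fun hm => hz.2 ⟨hm.1, hm.2.1, hz.1⟩
      rw [hv0 z hz', hv0' z hz', sub_self, zero_mul]

end TimeSubsolution

lemma rpow_sub_rpow_le {m M a b : ℝ} (hm : 1 ≤ m) (hb : 0 ≤ b) (hba : b ≤ a) (haM : a ≤ M) :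
    a ^ m - b ^ m ≤ m * M ^ (m - 1) * (a - b) := by
  have h := Convex.norm_image_sub_le_of_norm_hasDerivWithin_le (f := fun x : ℝ => x ^ m)
    (f' := fun x => m * x ^ (m - 1)) (s := Icc 0 M) (x := b) (y := a) (C := m * M ^ (m - 1))
    (fun x _ => (Real.hasDerivAt_rpow_const (Or.inr hm)).hasDerivWithinAt) (fun x hx => by
      rw [Real.norm_eq_abs, abs_of_nonneg (mul_nonneg (by linarith) (Real.rpow_nonneg hx.1 _))]
      exact mul_le_mul_of_nonneg_left (Real.rpow_le_rpow hx.1 hx.2 (by linarith)) (by linarith))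
    (convex_Icc 0 M) ⟨hb, hba.trans haM⟩ ⟨hb.trans hba, haM⟩
  rw [Real.norm_eq_abs, Real.norm_eq_abs, abs_of_nonneg (sub_nonneg.2 hba)] at h
  exact (le_abs_self _).trans h

lemma linear_source_le {k M u u' v v' : ℝ} (hk : 0 ≤ k) (hu : 0 ≤ u) (huM : u ≤ M)
    (hv' : 0 ≤ v') (huu : u ≤ u') :
    k * u * v - k * u' * v' ≤ k * M * max (v - v') 0 := by
  have h1 : k * u * v' ≤ k * u' * v' := by gcongr
  have h2 : k * u * (v - v') ≤ k * u * max (v - v') 0 :=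
    mul_le_mul_of_nonneg_left (le_max_left _ _) (by positivity)
  have h3 : k * u * max (v - v') 0 ≤ k * M * max (v - v') 0 := by gcongr
  linarith

lemma power_source_le {k M m₃ m₄ u u' v v' : ℝ} (hk : 0 ≤ k) (hm₃ : 1 ≤ m₃) (hm₄ : 1 ≤ m₄)
    (hu : 0 ≤ u) (hu' : 0 ≤ u') (huM' : u' ≤ M) (hv' : 0 ≤ v') (hvM' : v' ≤ M) (hvv : v' ≤ v) :
    k * u' ^ m₃ * v' ^ m₄ - k * u ^ m₃ * v ^ m₄ ≤
      k * (m₃ * M ^ (m₃ - 1)) * M ^ m₄ * max (u' - u) 0 := by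
  have hM : 0 ≤ M := hu'.trans huM'
  have h1 : k * u ^ m₃ * v' ^ m₄ ≤ k * u ^ m₃ * v ^ m₄ := by
    have := Real.rpow_le_rpow hv' hvv (by linarith : 0 ≤ m₄)
    have := Real.rpow_nonneg hu m₃
    gcongr
  have h2 : u' ^ m₃ - u ^ m₃ ≤ m₃ * M ^ (m₃ - 1) * max (u' - u) 0 := by
    rcases le_total u u' with h | h
    · rw [max_eq_left (sub_nonneg.2 h)]
      exact rpow_sub_rpow_le hm₃ hu h huM'
    · rw [max_eq_right (sub_nonpos.2 h), mul_zero, sub_nonpos]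
      exact Real.rpow_le_rpow hu' h (by linarith)
  have h3 : 0 ≤ v' ^ m₄ := Real.rpow_nonneg hv' _
  have h4 : v' ^ m₄ ≤ M ^ m₄ := Real.rpow_le_rpow hv' hvM' (by linarith)
  have h5 : 0 ≤ m₃ * M ^ (m₃ - 1) * max (u' - u) 0 :=
    mul_nonneg (mul_nonneg (by linarith) (Real.rpow_nonneg hM _)) (le_max_right _ _)
  calc k * u' ^ m₃ * v' ^ m₄ - k * u ^ m₃ * v ^ m₄
      ≤ k * ((u' ^ m₃ - u ^ m₃) * v' ^ m₄) := by linarith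
    _ ≤ k * ((m₃ * M ^ (m₃ - 1) * max (u' - u) 0) * M ^ m₄) := by
        refine mul_le_mul_of_nonneg_left ?_ hk
        exact (mul_le_mul_of_nonneg_right h2 h3).trans (mul_le_mul_of_nonneg_left h4 h5)
    _ = _ := by ring

end UnbalancedRD

theorem theorem2p1 {n : ℕ} (hn : 1 ≤ n) {Ω : Set (EuclideanSpace ℝ (Fin n))}
    (hΩ : IsBoundedLipschitzDomain Ω) {T k m₃ m₄ : ℝ} (hT : 0 < T) (hk : 0 < k)
    (hm₃ : 1 ≤ m₃) (hm₄ : 1 ≤ m₄)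
    {u u' v v' : EuclideanSpace ℝ (Fin n) × ℝ → ℝ}
    (hu : MemU (spaceTimeCylinder Ω T) u) (hu' : MemU (spaceTimeCylinder Ω T) u')
    (hv : MemV (spaceTimeCylinder Ω T) v) (hv' : MemV (spaceTimeCylinder Ω T) v')
    (hnonneg : ∀ᵐ z ∂(volume.restrict (spaceTimeCylinder Ω T)),
      0 ≤ u z ∧ 0 ≤ u' z ∧ 0 ≤ v z ∧ 0 ≤ v' z)
    (hu_super : IsNeumannSupersolution Ω T u (fun z => k * u z * v z))
    (hu_sub' : IsNeumannSubsolution Ω T u' (fun z => k * u' z * v' z))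
    (hv_sub : IsTimeSubsolution (spaceTimeCylinder Ω T) v (fun z => k * u z ^ m₃ * v z ^ m₄))
    (hv_super' : IsTimeSupersolution (spaceTimeCylinder Ω T) v' (fun z => k * u' z ^ m₃ * v' z ^ m₄))
    (hv_trace : HasInitialTrace Ω v) (hv_trace' : HasInitialTrace Ω v')
    (hinit : ∀ᵐ x ∂(volume.restrict Ω), u' (x, 0) ≤ u (x, 0) ∧ v (x, 0) ≤ v' (x, 0)) :
    ∀ᵐ z ∂(volume.restrict (spaceTimeCylinder Ω T)), u' z ≤ u z ∧ v z ≤ v' z := by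
  have hΩo := hΩ.isOpen
  have hΩb := hΩ.isBounded
  have hQ : MeasurableSet (spaceTimeCylinder Ω T) := hΩo.measurableSet.prod measurableSet_Ioo
  obtain ⟨C₁, a, ham, ha0, haC, haz, hae⟩ :=
    exists_bounded_representative hQ hu.1 (hnonneg.mono fun _ h => h.1)
  obtain ⟨C₂, a', ham', ha0', haC', haz', hae'⟩ :=
    exists_bounded_representative hQ hu'.1 (hnonneg.mono fun _ h => h.2.1)
  obtain ⟨C₃, b, hbm, hb0, hbC, hbz, hbe⟩ :=
    exists_bounded_representative hQ hv.1 (hnonneg.mono fun _ h => h.2.2.1)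
  obtain ⟨C₄, b', hbm', hb0', hbC', hbz', hbe'⟩ :=
    exists_bounded_representative hQ hv'.1 (hnonneg.mono fun _ h => h.2.2.2)
  obtain ⟨N, hN₁, hN₂, hN₃, hN₄⟩ : ∃ N, C₁ ≤ N ∧ C₂ ≤ N ∧ C₃ ≤ N ∧ C₄ ≤ N :=
    ⟨max (max C₁ C₂) (max C₃ C₄), by simp, by simp, by simp, by simp⟩
  have haN := fun z => (haC z).trans hN₁
  have haN' := fun z => (haC' z).trans hN₂
  have hbN := fun z => (hbC z).trans hN₃
  have hbN' := fun z => (hbC' z).trans hN₄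
  have hN0 : 0 ≤ N := (ha0 0).trans (haN 0)
  have hp₃ : 0 ≤ N ^ m₃ := Real.rpow_nonneg hN0 _
  have hp₄ : 0 ≤ N ^ m₄ := Real.rpow_nonneg hN0 _
  set M := N + k * N * N + k * N ^ m₃ * N ^ m₄ with hM
  have hkN : 0 ≤ k * N * N := by positivity
  have hkp : 0 ≤ k * N ^ m₃ * N ^ m₄ := by positivity
  have habs : ∀ {c : EuclideanSpace ℝ (Fin n) × ℝ → ℝ}, (∀ z, 0 ≤ c z) → (∀ z, c z ≤ N) →
      ∀ z, |c z| ≤ M := fun h0 hN z => by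
    rw [abs_of_nonneg (h0 z)]
    linarith [hN z]
  have hlin : ∀ {c d : EuclideanSpace ℝ (Fin n) × ℝ → ℝ}, (∀ z, 0 ≤ c z) → (∀ z, c z ≤ N) →
      (∀ z, 0 ≤ d z) → (∀ z, d z ≤ N) → ∀ z, |k * c z * d z| ≤ M :=
    fun {c d} hc0 hcN hd0 hdN z => by
    rw [abs_of_nonneg (mul_nonneg (mul_nonneg hk.le (hc0 z)) (hd0 z))]
    have : k * c z * d z ≤ k * N * N := by
      have := hc0 z; have := hd0 z; have := hcN z; have := hdN z
      gcongr
    linarith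
  have hpow : ∀ {c d : EuclideanSpace ℝ (Fin n) × ℝ → ℝ}, (∀ z, 0 ≤ c z) → (∀ z, c z ≤ N) →
      (∀ z, 0 ≤ d z) → (∀ z, d z ≤ N) → ∀ z, |k * c z ^ m₃ * d z ^ m₄| ≤ M :=
    fun {c d} hc0 hcN hd0 hdN z => by
    have h1 := Real.rpow_nonneg (hc0 z) m₃
    have h2 := Real.rpow_nonneg (hd0 z) m₄
    have h3 := Real.rpow_le_rpow (hc0 z) (hcN z) (by linarith : 0 ≤ m₃)
    have h4 := Real.rpow_le_rpow (hd0 z) (hdN z) (by linarith : 0 ≤ m₄)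
    rw [abs_of_nonneg (mul_nonneg (mul_nonneg hk.le h1) h2)]
    have : k * c z ^ m₃ * d z ^ m₄ ≤ k * N ^ m₃ * N ^ m₄ := by gcongr
    linarith
  have hm₃' : m₃ ≠ 0 := by linarith
  obtain ⟨M₁, G, h₁⟩ := exists_isZeroDataSubsolution_of_neumann hΩo hΩb (M := M)
    (f₁ := fun z => k * a z * b z) (f₁' := fun z => k * a' z * b' z) hu hu' hu_super
    hu_sub' (hinit.mono fun _ h => h.1) ham ham' ((ham.const_mul k).mul hbm)
    ((ham'.const_mul k).mul hbm') (habs ha0 haN) (habs ha0' haN') (hlin ha0 haN hb0 hbN)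
    (hlin ha0' haN' hb0' hbN') haz haz' (fun z hz => by rw [haz z hz, mul_zero, zero_mul])
    (fun z hz => by rw [haz' z hz, mul_zero, zero_mul]) hae hae'
    (by filter_upwards [hae, hbe] with z h1 h2 using by rw [h1, h2])
    (by filter_upwards [hae', hbe'] with z h1 h2 using by rw [h1, h2])
  have h₂ := exists_isZeroDataSubsolution_of_time hΩo hΩb hT (M := M) hv_sub hv_super' hv_trace
    hv_trace' (hinit.mono fun _ h => h.2) hbm hbm'
    (g₁ := fun z => k * a z ^ m₃ * b z ^ m₄) (g₁' := fun z => k * a' z ^ m₃ * b' z ^ m₄)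
    (((ham.pow_const m₃).const_mul k).mul (hbm.pow_const m₄))
    (((ham'.pow_const m₃).const_mul k).mul (hbm'.pow_const m₄))
    (habs hb0 hbN) (habs hb0' hbN') (hpow ha0 haN hb0 hbN) (hpow ha0' haN' hb0' hbN') hbz hbz'
    (fun z hz => by rw [haz z hz, Real.zero_rpow hm₃', mul_zero, zero_mul])
    (fun z hz => by rw [haz' z hz, Real.zero_rpow hm₃', mul_zero, zero_mul]) hbe hbe'
    (by filter_upwards [hae, hbe] with z h1 h2 using by rw [h1, h2])
    (by filter_upwards [hae', hbe'] with z h1 h2 using by rw [h1, h2])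
  have hC₁ : 0 ≤ k * N := by positivity
  have hC₂ : 0 ≤ k * (m₃ * N ^ (m₃ - 1)) * N ^ m₄ :=
    mul_nonneg (mul_nonneg hk.le (mul_nonneg (by linarith) (Real.rpow_nonneg hN0 _))) hp₄
  have key := (h₁.mono hΩo (le_max_left M₁ (M + M))).ae_nonpos
    (h₂.mono hΩo (le_max_right M₁ (M + M))) hΩo hΩb hΩ.hasInteriorCones hT (add_nonneg hC₁ hC₂)
    (fun z hz => (linear_source_le hk.le (ha0 z) (haN z) (hb0' z) (sub_pos.1 hz).le).trans
      (mul_le_mul_of_nonneg_right (le_add_of_nonneg_right hC₂) (le_max_right _ _)))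
    (fun z hz => (power_source_le hk.le hm₃ hm₄ (ha0 z) (ha0' z) (haN' z) (hb0' z) (hbN' z)
      (sub_pos.1 hz).le).trans
      (mul_le_mul_of_nonneg_right (le_add_of_nonneg_left hC₁) (le_max_right _ _)))
  filter_upwards [ae_restrict_of_ae key, hae, hae', hbe, hbe'] with z h1 h2 h3 h4 h5
  rw [← h2, ← h3, ← h4, ← h5]
  exact ⟨sub_nonpos.1 h1.1, sub_nonpos.1 h1.2⟩
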